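/- Let $n\ge 1$, $0<\alpha<1$, and let $\Omega$ be a non-empty open subset of the unit sphere $\mathbb S^n\subset\mathbb R^{n+1}$ such that the cone $\{rx : r>0,\ x\in\Omega\}$ is convex and its boundary $\Sigma=\{rx : r>0,\ x\in\partial\Omega\}$ is smooth and strictly convex (the second fundamental form of $\partial\Omega$ in $\mathbb S^n$, with respect to the outward unit normal $\mu$, is positive definite). Let $\sigma$ be the round metric on $\mathbb S^n$, and let $D$ and indices denote covariant derivatives with respect to $\sigma$. Let $\varphi_0\in C^2(\overline\Omega)$ be such that the matrix $\sigma_{ij}-\varphi_{0;ij}+\varphi_{0;i}\varphi_{0;j}$ is positive definite on $\overline\Omega$. For $0<T\le\infty$, a solution of the flow on $\Omega\times[0,T)$ with initial value $\varphi_0$ is a function $\varphi$ such that $\varphi, D\varphi, D^2\varphi,\partial_t\varphi$ are continuous on $\overline\Omega\times[0,T)$, $\varphi$ is smooth in $\Omega\times(0,T)$, and $$\frac{\partial\varphi}{\partial t}=e^{(\alpha-1)\varphi}\,(1+|D\varphi|^2)^{\beta/n}\,\frac{\det(\sigma_{ij})^{\alpha/n}}{\det(\sigma_{ij}-\varphi_{ij}+\varphi_i\varphi_j)^{\alpha/n}}\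 \text{ in }\Omega\times(0,T),\qquad D_\mu\varphi=0\ \text{ on }\partial\Omega\times(0,T),\qquad \varphi(\cdot,0)=\varphi_0,$$ where $\beta=\frac{(\alpha+1)n}{2}+\alpha$. (i) Every such solution satisfies $$|D\varphi(x,t)|\le\sup_{\overline\Omega}|D\varphi(\cdot,0)|\qquad\text{for all }(x,t)\in\overline\Omega\times[0,T),$$ and $|D\varphi|^2$ has a derivative in the direction $\mu$ on the boundary, with $D_\mu|D\varphi|^2\le 0$ on $\partial\Omega\times[0,T)$. (ii) There is a constant $\lambda>0$, depending only on $n$, $\alpha$, $\Omega$ and $\varphi_0$, with the following property. Let $T$ and $\varphi$ be as above, let $\inf_{\overline\Omega}\varphi_0\le c\le\sup_{\overline\Omega}\varphi_0$, put $\Theta(t)=\big((1-\alpha)t+e^{(1-\alpha)c}\big)^{1/(1-\alpha)}$ and $s(t)=\int_0^t\Theta(\tau)^{\alpha-1}\,d\tau$, and let $\widetilde\varphi(x,s(t))=\varphi(x,t)-\log\Theta(t)$ be the rescaled solution as a function of $x$ and $s$. Then for all $x\in\overline\Omega$ and all $s=s(t)$ with $t\in[0,T)$, $$|D\widetilde\varphi(x,s)|\le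 e^{-\lambda s}\,\sup_{\overline\Omega}|D\widetilde\varphi(\cdot,0)|.$$ -/

import Mathlib

open scoped ContDiff Topology

noncomputable section

/-- The ambient space `ℝ^{n+1}` of the unit sphere `𝕊ⁿ`. -/
abbrev Amb (n : ℕ) : Type := EuclideanSpace ℝ (Fin (n + 1))

/-- The cone `{r x : r > 0, x ∈ S}` (without its vertex) over a subset `S` of the unit sphere. -/
def coneOver {n : ℕ} (S : Set (Amb n)) : Set (Amb n) :=
  {y | ∃ r : ℝ, 0 < r ∧ ∃ x ∈ S, y = r • x}

/-- The boundary in the sphere of a relatively open subset `Ω` of the sphere. -/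
def sphBoundary {n : ℕ} (Ω : Set (Amb n)) : Set (Amb n) := closure Ω \ Ω

/-- `ρ` is a smooth local defining function at `p` of the set `C`: near `p`, `C = {ρ < 0}`, and
`ρ` has a non-vanishing derivative at `p`. -/
def IsLocalDefiningFunction {n : ℕ} (C : Set (Amb n)) (p : Amb n) (ρ : Amb n → ℝ) : Prop :=
  ContDiff ℝ ∞ ρ ∧ (∀ᶠ y in 𝓝 p, y ∈ C ↔ ρ y < 0) ∧ fderiv ℝ ρ p ≠ 0

/-- `Ω` is a non-empty relatively open part of the unit sphere over which the cone is convex, has a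
smooth boundary `Σ` (away from the vertex), and is strictly convex: at every `p ∈ ∂Ω` the second
fundamental form of `Σ` (`D²ρ / |Dρ|` on the tangent space `ker Dρ` for a defining function `ρ`) is
positive definite on the tangent vectors orthogonal to the ruling through `p`.  On these vectors it
is the second fundamental form of `∂Ω` in the sphere. -/
structure IsStrictlyConvexSphericalDomain {n : ℕ} (Ω : Set (Amb n)) : Prop where
  subset_sphere : Ω ⊆ Metric.sphere 0 1
  nonempty : Ω.Nonempty
  isOpen_cone : IsOpen (coneOver Ω)
  convex_cone : Convex ℝ (coneOver Ω)
  boundary : ∀ p ∈ sphBoundary Ω, ∃ ρ : Amb n → ℝ, IsLocalDefiningFunction (coneOver Ω) p ρ ∧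
    ∀ X : Amb n, fderiv ℝ ρ p X = 0 → inner ℝ p X = 0 → X ≠ 0 →
      0 < fderiv ℝ (fun y => fderiv ℝ ρ y) p X X

/-- `μ` is the outward unit normal at `p ∈ ∂Ω` of the boundary of the cone over `Ω`; it is tangent
to the sphere and is the outward unit conormal of `∂Ω` there. -/
def IsOutwardUnitNormal {n : ℕ} (Ω : Set (Amb n)) (p μ : Amb n) : Prop :=
  ‖μ‖ = 1 ∧ ∃ ρ : Amb n → ℝ, IsLocalDefiningFunction (coneOver Ω) p ρ ∧
    ∃ a : ℝ, 0 < a ∧ ∀ X : Amb n, fderiv ℝ ρ p X = a * inner ℝ μ X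

/-- The extension, constant along rays, of a function on (a part of) the unit sphere. -/
def radialExt {n : ℕ} (f : Amb n → ℝ) (y : Amb n) : ℝ := f (‖y‖⁻¹ • y)

/-- The gradient `Df` for the round metric, up to the boundary of `Ω`: at points of the unit sphere
the Euclidean gradient of the radially constant extension is tangent to the sphere and is the
gradient on the sphere.  At boundary points it is the gradient within the closed cone. -/
def sphGrad {n : ℕ} (Ω : Set (Amb n)) (f : Amb n → ℝ) (x : Amb n) : Amb n :=
  gradientWithin (radialExt f) (coneOver (closure Ω)) x

/-- The derivative of the gradient field of the radially constant extension. -/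
def sphGradDeriv {n : ℕ} (Ω : Set (Amb n)) (f : Amb n → ℝ) (x : Amb n) : Amb n →L[ℝ] Amb n :=
  fderivWithin ℝ (sphGrad Ω f) (coneOver (closure Ω)) x

/-- For `X`, `Y` tangent to the sphere at `x` this is the covariant Hessian `D²f(X, Y)` of the round
metric, as the Levi-Civita connection of the sphere is the tangential part of the Euclidean
derivative. -/
def sphHess {n : ℕ} (Ω : Set (Amb n)) (f : Amb n → ℝ) (x X Y : Amb n) : ℝ :=
  inner ℝ (sphGradDeriv Ω f x X) Y

/-- The bilinear form `σ - D²f + Df ⊗ Df`. -/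
def wForm {n : ℕ} (Ω : Set (Amb n)) (f : Amb n → ℝ) (x X Y : Amb n) : ℝ :=
  inner ℝ X Y - sphHess Ω f x X Y + inner ℝ (sphGrad Ω f x) X * inner ℝ (sphGrad Ω f x) Y

/-- `det (σ_{ij} - f_{ij} + f_i f_j) / det (σ_{ij})` at `x`, computed in an orthonormal basis of the
tangent space `x^⊥` of the sphere, where `det (σ_{ij}) = 1`. -/
def wDet {n : ℕ} (Ω : Set (Amb n)) (f : Amb n → ℝ) (x : Amb n) : ℝ :=
  Matrix.det (Matrix.of fun i j : Fin (Module.finrank ℝ (ℝ ∙ x)ᗮ) =>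
    wForm Ω f x (stdOrthonormalBasis ℝ (ℝ ∙ x)ᗮ i : Amb n)
      (stdOrthonormalBasis ℝ (ℝ ∙ x)ᗮ j : Amb n))

/-- The operator `Q(f, Df, D²f) = e^{(α-1)f} (1 + |Df|²)^{β/n} (det σ / det (σ - D²f + Df ⊗ Df))^{α/n}`
with `β = (α+1)n/2 + α`. -/
def flowOp {n : ℕ} (α : ℝ) (Ω : Set (Amb n)) (f : Amb n → ℝ) (x : Amb n) : ℝ :=
  Real.exp ((α - 1) * f x)
    * (1 + ‖sphGrad Ω f x‖ ^ 2) ^ (((α + 1) * (n : ℝ) / 2 + α) / (n : ℝ))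
    / wDet Ω f x ^ (α / (n : ℝ))

/-- The time interval `[0, T)`, where `T = ∞` is allowed. -/
def timeInterval (T : EReal) : Set ℝ := {t | 0 ≤ t ∧ (t : EReal) < T}

/-- Initial data: `φ₀` is `C²` up to the boundary, and the matrix `σ - D²φ₀ + Dφ₀ ⊗ Dφ₀` is positive
definite up to the boundary. -/
structure IsStrictlyConvexDatum {n : ℕ} (Ω : Set (Amb n)) (φ₀ : Amb n → ℝ) : Prop where
  contDiff : ContDiffOn ℝ 2 (radialExt φ₀) (coneOver (closure Ω))
  posDef : ∀ x ∈ closure Ω, ∀ X : Amb n, inner ℝ x X = 0 → X ≠ 0 → 0 < wForm Ω φ₀ x X X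

/-- `φ` is a solution on `Ω × [0, T)` of `φ_t = Q(φ, Dφ, D²φ)` with the homogeneous Neumann condition
and initial value `φ₀`.  It is smooth in `Ω × (0, T)`, and `φ`, `Dφ`, `D²φ`, `φ_t` are continuous on
`closure Ω × [0, T)`. -/
structure IsSolution {n : ℕ} (α : ℝ) (Ω : Set (Amb n)) (T : EReal) (φ₀ : Amb n → ℝ)
    (φ : Amb n → ℝ → ℝ) : Prop where
  smooth : ContDiffOn ℝ ∞ (fun p : Amb n × ℝ => radialExt (fun y => φ y p.2) p.1)
    (coneOver Ω ×ˢ {t : ℝ | 0 < t ∧ (t : EReal) < T})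
  contDiff_space : ∀ t ∈ timeInterval T,
    ContDiffOn ℝ 2 (radialExt fun y => φ y t) (coneOver (closure Ω))
  differentiable_time : ∀ x ∈ closure Ω, DifferentiableOn ℝ (φ x) (timeInterval T)
  continuous : ContinuousOn (fun p : Amb n × ℝ => φ p.1 p.2) (closure Ω ×ˢ timeInterval T)
  continuous_grad : ContinuousOn (fun p : Amb n × ℝ => sphGrad Ω (fun y => φ y p.2) p.1)
    (closure Ω ×ˢ timeInterval T)
  continuous_hess : ContinuousOn (fun p : Amb n × ℝ => sphGradDeriv Ω (fun y => φ y p.2) p.1)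
    (closure Ω ×ˢ timeInterval T)
  continuous_time : ContinuousOn (fun p : Amb n × ℝ => derivWithin (φ p.1) (timeInterval T) p.2)
    (closure Ω ×ˢ timeInterval T)
  evolution : ∀ x ∈ Ω, ∀ t ∈ timeInterval T, 0 < t →
    HasDerivAt (φ x) (flowOp α Ω (fun y => φ y t) x) t
  neumann : ∀ x ∈ sphBoundary Ω, ∀ t ∈ timeInterval T, 0 < t → ∀ μ : Amb n,
    IsOutwardUnitNormal Ω x μ → inner ℝ (sphGrad Ω (fun y => φ y t) x) μ = 0
  initial : ∀ x ∈ closure Ω, φ x 0 = φ₀ x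

/-- `sup |Df|` over the closure of `Ω`. -/
def supGrad {n : ℕ} (Ω : Set (Amb n)) (f : Amb n → ℝ) : ℝ :=
  sSup ((fun x => ‖sphGrad Ω f x‖) '' closure Ω)

/-- The radius `Θ(t) = ((1-α) t + e^{(1-α)c})^{1/(1-α)}` of the spherical solution of the flow that
starts with radius `e^c`. -/
def Theta (α c t : ℝ) : ℝ := ((1 - α) * t + Real.exp ((1 - α) * c)) ^ (1 / (1 - α))

/-- The rescaled time `s(t)`, with `ds/dt = Θ^{α-1}` and `s(0) = 0`. -/
def rescaledTime (α c t : ℝ) : ℝ := ∫ τ in (0 : ℝ)..t, Theta α c τ ^ (α - 1)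

/-- `ψ(x, s)` is the rescaled solution `φ̃ = φ - log Θ`, as a function of `x` and the rescaled time. -/
def IsRescaledFlow {n : ℕ} (α c : ℝ) (Ω : Set (Amb n)) (T : EReal) (φ ψ : Amb n → ℝ → ℝ) : Prop :=
  ∀ x ∈ closure Ω, ∀ t ∈ timeInterval T,
    ψ x (rescaledTime α c t) = φ x t - Real.log (Theta α c t)

end

section

open Set Filter
variable {n : ℕ} {Ω : Set (Amb n)}

/-! ### One-sided derivative tests -/

/-! The gradient bounds come from a two-point maximum principle. Differentiating the equation for
|Dφ|² would need third derivatives up to the boundary. Instead, φ(x,t) - φ(y,t) is bounded by e^{-λ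
s(t)} L times the spherical distance of x and y, where L = sup |Dφ₀|, and y then tends to x. The
rescaled solution differs from φ by a function of time only, so this is the decay in (ii). The bound
in (i) follows on dropping the factor e^{-λ s} ≤ 1.

Suppose the difference first touches a slightly enlarged barrier at (x,y)
(`IsSolution.sub_lt_two_point`). The Neumann condition and strict convexity keep x and y off the
boundary (`exists_gt_of_boundary`). Let S be the reflection exchanging x and -y; on the tangent
space at x it is parallel transport along the geodesic to y. Varying x along X and y along S X gives
|Dφ(x)| = |Dφ(y)| and W(y) ≤ W(x) for the form W = σ - D²φ + Dφ ⊗ Dφ, hence an inequality of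
determinants (`comparison_of_two_point_max`). With Δ = φ(x) - φ(y), only the factor e^{(α-1)φ}
separates the two speeds: φ_t(x) ≤ e^{-(1-α)Δ} φ_t(y). As α < 1, Δ shrinks at rate at least (1 -
e^{-(1-α)Δ}) φ_t(y).

Exponential decay in s then needs φ_t ≥ q ds/dt with q > 0 (`IsSolution.speed_lower_bound`). It
comes from a scaling symmetry: φ(x, (1+ε)t + ετ) - log(1+ε)/(1-α) solves the same equation.
Comparing it with φ and letting ε tend to 0 bounds φ_t from below without differentiating the
equation in time. Since Δ stays bounded, 1 - e^{-(1-α)Δ} dominates a multiple of Δ, and λ results.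

W stays positive because the speed is finite: the flow equation, multiplied by the power of det W,
is violated where W degenerates (`IsSolution.posDef`). The sign of D_μ|Dφ|² comes from
differentiating the Neumann condition along ∂Ω, which produces the second fundamental form. -/

theorem eventually_lt_of_hasDerivWithinAt_neg {h : ℝ → ℝ} {a : ℝ}
    (hd : HasDerivWithinAt h a (Ici 0) 0) (ha : a < 0) : ∀ᶠ s in 𝓝[>] (0 : ℝ), h s < h 0 := by
  have h1 := (hasDerivWithinAt_iff_tendsto_slope.1 hd)
  rw [show Ici (0 : ℝ) \ {0} = Ioi 0 from Ici_sdiff_left] at h1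
  filter_upwards [h1.eventually (gt_mem_nhds ha), self_mem_nhdsWithin] with s hs hs0
  have hs0' : (0 : ℝ) < s := hs0
  rw [slope_def_field, sub_zero, div_lt_iff₀ hs0'] at hs
  linarith

theorem eventually_gt_of_hasDerivWithinAt_pos {h : ℝ → ℝ} {a : ℝ}
    (hd : HasDerivWithinAt h a (Ici 0) 0) (ha : 0 < a) : ∀ᶠ s in 𝓝[>] (0 : ℝ), h 0 < h s := by
  filter_upwards [eventually_lt_of_hasDerivWithinAt_neg hd.neg (neg_neg_of_pos ha)] with s hs
  simpa using hs

/-- The derivative of `h` is needed only for positive arguments, so the test applies along segments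
that start at a boundary point and enter the cone. `h` increases because `k` becomes positive at
once. -/
theorem eventually_gt_of_second_deriv_pos {h k : ℝ → ℝ} {κ : ℝ}
    (hc : ContinuousWithinAt h (Ici 0) 0) (hd : ∀ᶠ s in 𝓝[>] (0 : ℝ), HasDerivAt h (k s) s)
    (hk : HasDerivWithinAt k κ (Ici 0) 0) (hk0 : k 0 = 0) (hκ : 0 < κ) :
    ∀ᶠ s in 𝓝[>] (0 : ℝ), h 0 < h s := by
  have h1 := hd.and (eventually_gt_of_hasDerivWithinAt_pos hk hκ)
  rw [hk0] at h1
  obtain ⟨δ, hδ, hδs⟩ := mem_nhdsGT_iff_exists_Ioo_subset.1 h1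
  have hδ' : (0 : ℝ) < δ := hδ
  filter_upwards [Ioo_mem_nhdsGT hδ'] with s hs
  have hmono : StrictMonoOn h (Icc 0 s) := by
    apply strictMonoOn_of_deriv_pos (convex_Icc 0 s)
    · intro u hu
      rcases eq_or_lt_of_le hu.1 with h0 | h0
      · rw [← h0]; exact hc.mono Icc_subset_Ici_self
      · exact ((hδs ⟨h0, lt_of_le_of_lt hu.2 hs.2⟩).1).continuousAt.continuousWithinAt
    · intro u hu
      rw [interior_Icc] at hu
      have h2 := hδs ⟨hu.1, lt_trans hu.2 hs.2⟩
      rw [h2.1.deriv]; exact h2.2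
  exact hmono (left_mem_Icc.2 hs.1.le) (right_mem_Icc.2 hs.1.le) hs.1

/-! ### Cones over subsets of the sphere -/

theorem subset_coneOver (S : Set (Amb n)) : S ⊆ coneOver S :=
  fun x hx => ⟨1, one_pos, x, hx, (one_smul ℝ x).symm⟩

theorem smul_mem_coneOver {S : Set (Amb n)} {r : ℝ} (hr : 0 < r) {z : Amb n}
    (hz : z ∈ coneOver S) : r • z ∈ coneOver S := by
  obtain ⟨q, hq, x, hx, rfl⟩ := hz
  exact ⟨r * q, mul_pos hr hq, x, hx, by rw [smul_smul]⟩

theorem smul_mem_coneOver_iff {S : Set (Amb n)} {r : ℝ} (hr : 0 < r) {z : Amb n} :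
    r • z ∈ coneOver S ↔ z ∈ coneOver S := by
  refine ⟨fun h => ?_, smul_mem_coneOver hr⟩
  have := smul_mem_coneOver (inv_pos.2 hr) h
  rwa [smul_smul, inv_mul_cancel₀ hr.ne', one_smul] at this

theorem mem_coneOver_iff {S : Set (Amb n)} (hS : S ⊆ Metric.sphere 0 1) {z : Amb n} :
    z ∈ coneOver S ↔ z ≠ 0 ∧ ‖z‖⁻¹ • z ∈ S := by
  constructor
  · rintro ⟨r, hr, x, hx, rfl⟩
    have hx1 : ‖x‖ = 1 := by simpa using hS hx
    have hx0 : x ≠ 0 := by rintro rfl; simp at hx1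
    refine ⟨smul_ne_zero hr.ne' hx0, ?_⟩
    rw [norm_smul, hx1, Real.norm_of_nonneg hr.le, mul_one, smul_smul, inv_mul_cancel₀ hr.ne',
      one_smul]
    exact hx
  · rintro ⟨hz, hzS⟩
    have : 0 < ‖z‖ := norm_pos_iff.2 hz
    exact ⟨‖z‖, this, _, hzS, by rw [smul_smul, mul_inv_cancel₀ this.ne', one_smul]⟩

theorem mem_coneOver_iff_of_norm_eq_one {S : Set (Amb n)} (hS : S ⊆ Metric.sphere 0 1) {z : Amb n}
    (hz : ‖z‖ = 1) : z ∈ coneOver S ↔ z ∈ S := by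
  rw [mem_coneOver_iff hS, hz, inv_one, one_smul]
  exact ⟨fun h => h.2, fun h => ⟨by rintro rfl; simp at hz, h⟩⟩

theorem coneOver_subset_closure : coneOver Ω ⊆ coneOver (closure Ω) := by
  rintro _ ⟨r, hr, x, hx, rfl⟩
  exact ⟨r, hr, x, subset_closure hx, rfl⟩

theorem smul_mem_closure_cone {r : ℝ} (hr : 0 < r) {z : Amb n} (hz : z ∈ closure (coneOver Ω)) :
    r • z ∈ closure (coneOver Ω) :=
  map_mem_closure (continuous_const_smul r) hz fun _ hy => smul_mem_coneOver hr hy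

theorem mem_closure_cone {x : Amb n} (hx : x ∈ closure Ω) : x ∈ closure (coneOver Ω) :=
  closure_mono (subset_coneOver _) hx

namespace IsStrictlyConvexSphericalDomain

variable (hΩ : IsStrictlyConvexSphericalDomain Ω)
include hΩ

theorem closure_subset_sphere : closure Ω ⊆ Metric.sphere 0 1 :=
  closure_minimal hΩ.subset_sphere Metric.isClosed_sphere

theorem norm_eq_one {x : Amb n} (hx : x ∈ closure Ω) : ‖x‖ = 1 := by
  simpa using hΩ.closure_subset_sphere hx

theorem isCompact_closure : IsCompact (closure Ω) :=
  (isCompact_sphere (0 : Amb n) 1).of_isClosed_subset isClosed_closure hΩ.closure_subset_sphere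

theorem zero_notMem : (0 : Amb n) ∉ coneOver Ω := fun h =>
  ((mem_coneOver_iff hΩ.subset_sphere).1 h).1 rfl

theorem coneOver_closure : coneOver (closure Ω) = closure (coneOver Ω) ∩ {0}ᶜ := by
  ext z
  constructor
  · intro hz
    refine ⟨?_, ((mem_coneOver_iff hΩ.closure_subset_sphere).1 hz).1⟩
    obtain ⟨r, hr, x, hx, rfl⟩ := hz
    exact map_mem_closure (continuous_const_smul r) hx fun y hy =>
      smul_mem_coneOver hr (subset_coneOver _ hy)
  · rintro ⟨hz, hz0⟩
    have hz0' : z ≠ 0 := hz0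
    refine (mem_coneOver_iff hΩ.closure_subset_sphere).2 ⟨hz0', ?_⟩
    have hc : ContinuousWithinAt (fun y : Amb n => ‖y‖⁻¹ • y) (coneOver Ω) z :=
      ((continuous_norm.continuousAt.inv₀ (norm_ne_zero_iff.2 hz0')).smul
        continuousAt_id).continuousWithinAt
    exact hc.mem_closure hz fun y hy => ((mem_coneOver_iff hΩ.subset_sphere).1 hy).2

/-- The set is a closed convex set with interior points, minus the vertex. This makes gradients and
Hessians within the closed cone well defined up to the boundary. -/
theorem uniqueDiffOn : UniqueDiffOn ℝ (coneOver (closure Ω)) := by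
  rw [hΩ.coneOver_closure]
  refine UniqueDiffOn.inter (uniqueDiffOn_convex hΩ.convex_cone.closure ?_)
    isOpen_compl_singleton
  obtain ⟨x, hx⟩ := hΩ.nonempty
  exact ⟨x, interior_mono subset_closure (hΩ.isOpen_cone.interior_eq.symm ▸ subset_coneOver _ hx)⟩

theorem subset_closure_interior : coneOver (closure Ω) ⊆ closure (interior (coneOver (closure Ω))) := by
  have h1 : coneOver Ω ⊆ interior (coneOver (closure Ω)) :=
    interior_maximal coneOver_subset_closure hΩ.isOpen_cone
  intro z hz
  rw [hΩ.coneOver_closure] at hz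
  exact closure_mono h1 hz.1

/-- The midpoint of an interior point and a point of the closure is interior; doubling it stays in
the cone. -/
theorem add_mem {z w : Amb n} (hz : z ∈ coneOver Ω) (hw : w ∈ closure (coneOver Ω)) :
    z + w ∈ coneOver Ω := by
  have h := hΩ.convex_cone.combo_interior_closure_mem_interior
    (hΩ.isOpen_cone.interior_eq.symm ▸ hz) hw (a := 1 / 2) (b := 1 / 2) (by norm_num) (by norm_num)
    (by norm_num)
  rw [hΩ.isOpen_cone.interior_eq] at h
  have h2 := smul_mem_coneOver (r := 2) two_pos h
  rw [smul_add, smul_smul, smul_smul] at h2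
  norm_num at h2
  exact h2

theorem add_mem_closure {z w : Amb n} (hz : z ∈ closure (coneOver Ω))
    (hw : w ∈ closure (coneOver Ω)) : z + w ∈ closure (coneOver Ω) :=
  closure_closure (s := coneOver Ω) ▸
    map_mem_closure (f := fun y => y + w) (by fun_prop) hz fun _ hy => subset_closure (hΩ.add_mem hy hw)

/-- Otherwise the cone would contain the sum 0. Antipodal pairs in `closure Ω` can therefore occur
only on the boundary. -/
theorem neg_notMem {x : Amb n} (hx : x ∈ Ω) : -x ∉ closure Ω := fun h =>
  hΩ.zero_notMem (by
    simpa using hΩ.add_mem (subset_coneOver _ hx) (mem_closure_cone h))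

theorem notMem_cone {p : Amb n} (hp : p ∈ sphBoundary Ω) : p ∉ coneOver Ω := fun h =>
  hp.2 ((mem_coneOver_iff_of_norm_eq_one hΩ.subset_sphere (hΩ.norm_eq_one hp.1)).1 h)

end IsStrictlyConvexSphericalDomain

/-! ### Local defining functions and normals -/

theorem hasDerivAt_comp_line {f : Amb n → ℝ} {f' : Amb n →L[ℝ] ℝ} {x v : Amb n} {s : ℝ}
    (hf : HasFDerivAt f f' (x + s • v)) : HasDerivAt (fun s : ℝ => f (x + s • v)) (f' v) s := by
  have h1 : HasDerivAt (fun s : ℝ => x + s • v) v s := by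
    simpa using ((hasDerivAt_id s).smul_const v).const_add x
  exact hf.comp_hasDerivAt s h1

theorem tendsto_line (x v : Amb n) : Tendsto (fun s : ℝ => x + s • v) (𝓝[>] 0) (𝓝 x) := by
  have h : ContinuousAt (fun s : ℝ => x + s • v) 0 := by fun_prop
  have h' : Tendsto (fun s : ℝ => x + s • v) (𝓝 0) (𝓝 x) := by simpa [ContinuousAt] using h
  exact h'.mono_left nhdsWithin_le_nhds

namespace IsLocalDefiningFunction

variable {C : Set (Amb n)} {p : Amb n} {ρ : Amb n → ℝ} (hρ : IsLocalDefiningFunction C p ρ)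
include hρ

theorem hasFDerivAt (y : Amb n) : HasFDerivAt ρ (fderiv ℝ ρ y) y :=
  (hρ.1.differentiable (by simp) y).hasFDerivAt

theorem differentiable_fderiv : Differentiable ℝ (fderiv ℝ ρ) :=
  (hρ.1.fderiv_right (m := 1) (by norm_cast)).differentiable (by simp)

theorem eventually_nonpos : ∀ᶠ y in 𝓝 p, y ∈ closure C → ρ y ≤ 0 := by
  filter_upwards [hρ.2.1.eventually_nhds] with y hy hyC
  by_contra! hpos
  have h1 : ∀ᶠ z in 𝓝 y, 0 < ρ z := (hρ.1.continuous.tendsto y).eventually (lt_mem_nhds hpos)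
  obtain ⟨z, hz, hz1⟩ := (mem_closure_iff_frequently.1 hyC).and_eventually (hy.and h1) |>.exists
  linarith [hz1.1.1 hz, hz1.2]

theorem eventually_eq_zero : ∀ᶠ y in 𝓝 p, y ∈ closure C → y ∉ C → ρ y = 0 := by
  filter_upwards [hρ.2.1, hρ.eventually_nonpos] with y h1 h2 h3 h4
  exact le_antisymm (h2 h3) (not_lt.1 fun h => h4 (h1.2 h))

theorem eq_zero (hp : p ∈ closure C) (hp' : p ∉ C) : ρ p = 0 :=
  hρ.eventually_eq_zero.self_of_nhds hp hp'

theorem eventually_mem (hp : p ∈ closure C) (hp' : p ∉ C) {v : Amb n} (hv : fderiv ℝ ρ p v < 0) :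
    ∀ᶠ s in 𝓝[>] (0 : ℝ), p + s • v ∈ C := by
  have h1 : HasDerivAt (fun s : ℝ => ρ (p + s • v)) (fderiv ℝ ρ p v) 0 :=
    hasDerivAt_comp_line (by simpa using hρ.hasFDerivAt p)
  filter_upwards [eventually_lt_of_hasDerivWithinAt_neg h1.hasDerivWithinAt hv,
    (tendsto_line p v).eventually hρ.2.1] with s hs1 hs2
  apply hs2.2
  simpa [hρ.eq_zero hp hp'] using hs1

theorem fderiv_nonpos (hp : p ∈ closure C) (hp' : p ∉ C) {v : Amb n}
    (hv : ∀ᶠ s in 𝓝[>] (0 : ℝ), p + s • v ∈ closure C) : fderiv ℝ ρ p v ≤ 0 := by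
  by_contra! h
  have h1 : HasDerivAt (fun s : ℝ => ρ (p + s • v)) (fderiv ℝ ρ p v) 0 :=
    hasDerivAt_comp_line (by simpa using hρ.hasFDerivAt p)
  obtain ⟨s, h2, h3, h4⟩ := ((eventually_gt_of_hasDerivWithinAt_pos h1.hasDerivWithinAt h).and
    (((tendsto_line p v).eventually hρ.eventually_nonpos).and hv)).exists
  have := h3 h4
  simp only [zero_smul, add_zero, hρ.eq_zero hp hp'] at h2
  linarith

theorem second_fderiv_nonpos (hp : p ∈ closure C) (hp' : p ∉ C) {v : Amb n}
    (h0 : fderiv ℝ ρ p v = 0)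
    (hv : ∀ᶠ s in 𝓝[>] (0 : ℝ), p + s • v ∈ closure C) :
    fderiv ℝ (fun y => fderiv ℝ ρ y) p v v ≤ 0 := by
  by_contra! h
  have h1 : ∀ s : ℝ, HasDerivAt (fun s : ℝ => ρ (p + s • v)) (fderiv ℝ ρ (p + s • v) v) s :=
    fun s => hasDerivAt_comp_line (hρ.hasFDerivAt _)
  have h5 : HasDerivAt (fun s : ℝ => fderiv ℝ ρ (p + s • v) v)
      (fderiv ℝ (fun y => fderiv ℝ ρ y) p v v) 0 := by
    have h6 : HasFDerivAt (fun y => fderiv ℝ ρ y v)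
        ((fderiv ℝ (fun y => fderiv ℝ ρ y) p).flip v) p :=
      by
      simpa using ((hρ.differentiable_fderiv p).hasFDerivAt).clm_apply (hasFDerivAt_const v p)
    have := hasDerivAt_comp_line (x := p) (v := v) (s := 0)
      (f := fun y => fderiv ℝ ρ y v) (by simpa using h6)
    simpa using this
  obtain ⟨s, h2, h3, h4⟩ := ((eventually_gt_of_second_deriv_pos
    (h1 0).continuousAt.continuousWithinAt (Eventually.of_forall h1) h5.hasDerivWithinAt
    (by simpa using h0) h).and
    (((tendsto_line p v).eventually hρ.eventually_nonpos).and hv)).exists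
  have := h3 h4
  simp only [zero_smul, add_zero, hρ.eq_zero hp hp'] at h2
  linarith

end IsLocalDefiningFunction

/-! ### The outward normal of a strictly convex cone -/

/-- Serves to compare the differentials of two defining functions at the same point. Testing with
the component of `w` orthogonal to `μ`, a limit of vectors of the open half space, shows that this
component vanishes. -/
theorem eq_inner_smul_of_halfspace {μ w : Amb n} (hμ : ‖μ‖ = 1)
    (h : ∀ v : Amb n, inner ℝ μ v < 0 → inner ℝ w v ≤ 0) :
    w = (inner ℝ μ w : ℝ) • μ ∧ 0 ≤ (inner ℝ μ w : ℝ) := by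
  have hμμ : inner ℝ μ μ = (1 : ℝ) := by rw [real_inner_self_eq_norm_sq, hμ]; norm_num
  have hlim : ∀ v : Amb n, inner ℝ μ v = (0 : ℝ) → inner ℝ w v ≤ (0 : ℝ) := by
    intro v hv
    have hc : Tendsto (fun ε : ℝ => (inner ℝ w (v - ε • μ) : ℝ)) (𝓝[>] 0) (𝓝 (inner ℝ w v)) := by
      have : ContinuousAt (fun ε : ℝ => (inner ℝ w (v - ε • μ) : ℝ)) 0 := by fun_prop
      have h2 : Tendsto (fun ε : ℝ => (inner ℝ w (v - ε • μ) : ℝ)) (𝓝 0) (𝓝 (inner ℝ w v)) := by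
        simpa [ContinuousAt] using this
      exact h2.mono_left nhdsWithin_le_nhds
    refine le_of_tendsto hc ?_
    filter_upwards [self_mem_nhdsWithin] with ε hε
    have hε' : (0 : ℝ) < ε := hε
    apply h
    rw [inner_sub_right, hv, inner_smul_right, hμμ]
    linarith
  have hpos : 0 ≤ (inner ℝ μ w : ℝ) := by
    have := h (-μ) (by rw [inner_neg_right, hμμ]; norm_num)
    rw [inner_neg_right, real_inner_comm] at this
    linarith
  refine ⟨?_, hpos⟩
  set v := w - (inner ℝ μ w : ℝ) • μ with hv
  have hv0 : inner ℝ μ v = (0 : ℝ) := by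
    rw [hv, inner_sub_right, inner_smul_right, hμμ]; ring
  have h1 := hlim v hv0
  have h2 : inner ℝ w v = (inner ℝ v v : ℝ) := by
    conv_rhs => rw [hv, inner_sub_left, inner_smul_left, ← hv, hv0]
    simp
  rw [h2] at h1
  rw [real_inner_self_eq_norm_sq] at h1
  have h3 : ‖v‖ = 0 := by nlinarith [norm_nonneg v]
  exact sub_eq_zero.1 (norm_eq_zero.1 h3)

namespace IsStrictlyConvexSphericalDomain

theorem exists_normal (hΩ : IsStrictlyConvexSphericalDomain Ω) {p : Amb n}
    (hp : p ∈ sphBoundary Ω) : ∃ μ, IsOutwardUnitNormal Ω p μ := by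
  obtain ⟨ρ, hρ, -⟩ := hΩ.boundary p hp
  set w := (InnerProductSpace.toDual ℝ (Amb n)).symm (fderiv ℝ ρ p) with hw
  have hw0 : w ≠ 0 := by
    intro h
    exact hρ.2.2 (by simpa [hw] using h)
  have hn : 0 < ‖w‖ := norm_pos_iff.2 hw0
  refine ⟨‖w‖⁻¹ • w, ?_, ρ, hρ, ‖w‖, hn, fun X => ?_⟩
  · rw [norm_smul, norm_inv, norm_norm, inv_mul_cancel₀ hn.ne']
  · rw [inner_smul_left, hw, InnerProductSpace.toDual_symm_apply, ← hw]
    simp [hn.ne']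

variable (hΩ : IsStrictlyConvexSphericalDomain Ω) {p μ : Amb n} (hp : p ∈ sphBoundary Ω)
  (hμ : IsOutwardUnitNormal Ω p μ)
include hΩ hp hμ

theorem eventually_mem {v : Amb n} (hv : inner ℝ μ v < (0 : ℝ)) :
    ∀ᶠ s in 𝓝[>] (0 : ℝ), p + s • v ∈ coneOver Ω := by
  obtain ⟨-, ρ, hρ, a, ha, hρa⟩ := hμ
  apply hρ.eventually_mem (mem_closure_cone hp.1) (hΩ.notMem_cone hp)
  rw [hρa]
  exact mul_neg_of_pos_of_neg ha hv

theorem inner_normal_nonpos {z : Amb n} (hz : z ∈ closure (coneOver Ω)) :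
    inner ℝ μ z ≤ (0 : ℝ) := by
  obtain ⟨-, ρ, hρ, a, ha, hρa⟩ := hμ
  have h := hρ.fderiv_nonpos (mem_closure_cone hp.1) (hΩ.notMem_cone hp) (v := z) (by
    filter_upwards [self_mem_nhdsWithin] with s hs
    exact hΩ.add_mem_closure (mem_closure_cone hp.1) (smul_mem_closure_cone hs hz))
  rw [hρa] at h
  exact nonpos_of_mul_nonpos_right h ha

theorem inner_normal_self : inner ℝ μ p = (0 : ℝ) := by
  refine le_antisymm (hΩ.inner_normal_nonpos hp hμ (mem_closure_cone hp.1)) ?_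
  obtain ⟨-, ρ, hρ, a, ha, hρa⟩ := hμ
  have h := hρ.fderiv_nonpos (mem_closure_cone hp.1) (hΩ.notMem_cone hp) (v := -p) (by
    filter_upwards [Ioo_mem_nhdsGT (zero_lt_one (α := ℝ))] with s hs
    rw [smul_neg, ← sub_eq_add_neg]
    have := smul_mem_closure_cone (r := 1 - s) (by linarith [hs.2]) (mem_closure_cone hp.1)
    rwa [sub_smul, one_smul] at this)
  rw [hρa, inner_neg_right] at h
  have := nonpos_of_mul_nonpos_right h ha
  linarith

/-- The second fundamental form is positive for some local defining function whose differential is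
a positive multiple of the given outward normal. -/
theorem exists_convex_definingFunction : ∃ ρ : Amb n → ℝ,
    IsLocalDefiningFunction (coneOver Ω) p ρ ∧
    (∃ a : ℝ, 0 < a ∧ ∀ X : Amb n, fderiv ℝ ρ p X = a * inner ℝ μ X) ∧
    ∀ X : Amb n, fderiv ℝ ρ p X = 0 → inner ℝ p X = 0 → X ≠ 0 →
      0 < fderiv ℝ (fun y => fderiv ℝ ρ y) p X X := by
  obtain ⟨ρ, hρ, hconv⟩ := hΩ.boundary p hp
  refine ⟨ρ, hρ, ?_, hconv⟩
  set w := (InnerProductSpace.toDual ℝ (Amb n)).symm (fderiv ℝ ρ p) with hw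
  have hwX : ∀ X, inner ℝ w X = fderiv ℝ ρ p X := fun X => by
    rw [hw, InnerProductSpace.toDual_symm_apply]
  obtain ⟨h1, h2⟩ := eq_inner_smul_of_halfspace (w := w) hμ.1 fun v hv => by
    rw [hwX]
    refine hρ.fderiv_nonpos (mem_closure_cone hp.1) (hΩ.notMem_cone hp) ?_
    filter_upwards [hΩ.eventually_mem hp hμ hv] with s hs using subset_closure hs
  refine ⟨inner ℝ μ w, lt_of_le_of_ne h2 ?_, fun X => ?_⟩
  · intro h0
    rw [← h0, zero_smul] at h1
    apply hρ.2.2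
    ext X
    rw [← hwX, h1]; simp
  · rw [← hwX]
    conv_lhs => rw [h1, inner_smul_left]
    simp

/-- Strict convexity: the supporting hyperplane at `p` meets the closed cone only along the line
through `p`. Otherwise the part `X` of `z` orthogonal to `p` is a tangent direction in which the
segment from `p` stays in the closed cone, against D²ρ(X,X) > 0. -/
theorem eq_smul_of_inner_normal_eq_zero {z : Amb n} (hz : z ∈ closure (coneOver Ω))
    (h0 : inner ℝ μ z = (0 : ℝ)) : z = (inner ℝ p z : ℝ) • p := by
  obtain ⟨ρ, hρ, ⟨a, ha, hρa⟩, hconv⟩ := hΩ.exists_convex_definingFunction hp hμ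
  set X := z - (inner ℝ p z : ℝ) • p with hX
  by_contra hne
  have hX0 : X ≠ 0 := sub_ne_zero.2 hne
  have hpp : inner ℝ p p = (1 : ℝ) := by
    rw [real_inner_self_eq_norm_sq, hΩ.norm_eq_one hp.1]; norm_num
  have hd : fderiv ℝ ρ p X = 0 := by
    rw [hρa, hX, inner_sub_right, h0, inner_smul_right, hΩ.inner_normal_self hp hμ]; simp
  have hpX : inner ℝ p X = (0 : ℝ) := by
    rw [hX, inner_sub_right, inner_smul_right, hpp]; ring
  refine absurd (hρ.second_fderiv_nonpos (mem_closure_cone hp.1) (hΩ.notMem_cone hp) hd ?_)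
    (not_le.2 (hconv X hd hpX hX0))
  have hc : ∀ᶠ s in 𝓝[>] (0 : ℝ), 0 < 1 - s * (inner ℝ p z : ℝ) := by
    have : ContinuousAt (fun s : ℝ => 1 - s * (inner ℝ p z : ℝ)) 0 := by fun_prop
    exact nhdsWithin_le_nhds (this.eventually (lt_mem_nhds (by simp)))
  filter_upwards [hc, self_mem_nhdsWithin] with s hs hs0
  have : p + s • X = (1 - s * (inner ℝ p z : ℝ)) • p + s • z := by
    rw [hX]; module
  rw [this]
  exact hΩ.add_mem_closure (smul_mem_closure_cone hs (mem_closure_cone hp.1))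
    (smul_mem_closure_cone hs0 hz)

/-- Points p + s(X - εμ) lie in the cone for small s, and adding -p and rescaling puts X - εμ, hence
X in the limit, into the closed cone; strict convexity then gives X = 0. An antipodal pair thus
forces n = 1, with Ω a half circle. -/
theorem eq_zero_of_neg_mem (hneg : -p ∈ closure Ω) {X : Amb n} (hpX : inner ℝ p X = (0 : ℝ))
    (hX : inner ℝ μ X = (0 : ℝ)) : X = 0 := by
  have hmem : X ∈ closure (coneOver Ω) := by
    have hc : Tendsto (fun ε : ℝ => X + ε • (-μ)) (𝓝[>] 0) (𝓝 X) := tendsto_line X (-μ)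
    refine mem_closure_of_tendsto hc ?_
    filter_upwards [self_mem_nhdsWithin] with ε hε
    have hε' : (0 : ℝ) < ε := hε
    obtain ⟨s, hs, hs0⟩ := ((hΩ.eventually_mem hp hμ (v := X + ε • (-μ)) (by
      rw [inner_add_right, hX, inner_smul_right, inner_neg_right, real_inner_self_eq_norm_sq, hμ.1]
      linarith)).and self_mem_nhdsWithin).exists
    have h2 := hΩ.add_mem hs (mem_closure_cone hneg)
    rw [add_neg_cancel_comm] at h2
    exact (smul_mem_coneOver_iff hs0).1 h2
  have := hΩ.eq_smul_of_inner_normal_eq_zero hp hμ hmem hX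
  rwa [hpX, zero_smul] at this

theorem inner_normal_neg {y : Amb n} (hy : y ∈ closure Ω)
    (h1 : y ≠ p) (h2 : y ≠ -p) : inner ℝ μ y < (0 : ℝ) := by
  refine lt_of_le_of_ne (hΩ.inner_normal_nonpos hp hμ (mem_closure_cone hy)) fun h0 => ?_
  have h3 := hΩ.eq_smul_of_inner_normal_eq_zero hp hμ (mem_closure_cone hy) h0
  have h4 : |(inner ℝ p y : ℝ)| = 1 := by
    have := congrArg norm h3
    rw [norm_smul, hΩ.norm_eq_one hy, hΩ.norm_eq_one hp.1, mul_one, Real.norm_eq_abs] at this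
    exact this.symm
  rcases eq_or_eq_neg_of_abs_eq h4 with h | h
  · rw [h, one_smul] at h3; exact h1 h3
  · rw [h, neg_one_smul] at h3; exact h2 h3

end IsStrictlyConvexSphericalDomain

/-! ### Gradient and Hessian of functions on a spherical domain -/

theorem radialExt_of_norm_eq_one (f : Amb n → ℝ) {x : Amb n} (hx : ‖x‖ = 1) :
    radialExt f x = f x := by
  rw [radialExt, hx, inv_one, one_smul]

theorem radialExt_smul (f : Amb n → ℝ) {r : ℝ} (hr : 0 < r) (z : Amb n) :
    radialExt f (r • z) = radialExt f z := by
  unfold radialExt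
  rw [norm_smul, Real.norm_of_nonneg hr.le, smul_smul, mul_inv, mul_right_comm,
    inv_mul_cancel₀ hr.ne', one_mul]

theorem hasDerivWithinAt_comp_line {V : Type*} [NormedAddCommGroup V] [NormedSpace ℝ V]
    {F : Amb n → V} {F' : Amb n →L[ℝ] V} {K : Set (Amb n)} {x v : Amb n}
    (hF : HasFDerivWithinAt F F' K x) (hv : ∀ᶠ s in 𝓝[>] (0 : ℝ), x + s • v ∈ K) (hx : x ∈ K) :
    HasDerivWithinAt (fun s : ℝ => F (x + s • v)) (F' v) (Ici 0) 0 := by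
  have hmem : {s : ℝ | x + s • v ∈ K} ∈ 𝓝[Ici 0] (0 : ℝ) := by
    rw [← Ioi_insert, nhdsWithin_insert]
    exact ⟨by simpa using hx, hv⟩
  have h1 : HasDerivWithinAt (fun s : ℝ => x + s • v) v {s : ℝ | x + s • v ∈ K} 0 := by
    simpa using (((hasDerivAt_id (0 : ℝ)).smul_const v).const_add x).hasDerivWithinAt
  have h2 := HasFDerivWithinAt.comp_hasDerivWithinAt (t := K) (0 : ℝ) (by simpa using hF) h1
    (fun s hs => hs)
  exact h2.mono_of_mem_nhdsWithin hmem

namespace IsStrictlyConvexSphericalDomain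

theorem self_mem {x : Amb n} (hx : x ∈ closure Ω) : x ∈ coneOver (closure Ω) :=
  subset_coneOver _ hx

theorem cone_mem_nhds (hΩ : IsStrictlyConvexSphericalDomain Ω) {z : Amb n} (hz : z ∈ coneOver Ω) :
    coneOver (closure Ω) ∈ 𝓝 z :=
  mem_of_superset (hΩ.isOpen_cone.mem_nhds hz) coneOver_subset_closure

theorem hasFDerivWithinAt {f : Amb n → ℝ} {x : Amb n}
    (hf : DifferentiableWithinAt ℝ (radialExt f) (coneOver (closure Ω)) x) :
    HasFDerivWithinAt (radialExt f) (innerSL ℝ (sphGrad Ω f x)) (coneOver (closure Ω)) x :=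
  hf.hasGradientWithinAt.hasFDerivWithinAt

theorem sphGrad_add_const (f : Amb n → ℝ) (c : ℝ) {x : Amb n} :
    sphGrad Ω (fun y => f y + c) x = sphGrad Ω f x := by
  have : radialExt (fun y => f y + c) = fun z => radialExt f z + c := rfl
  unfold sphGrad gradientWithin
  rw [this, fderivWithin_add_const]

theorem hasDerivWithinAt_line {f : Amb n → ℝ}
    (hf : ContDiffOn ℝ 2 (radialExt f) (coneOver (closure Ω))) {x v : Amb n} (hx : x ∈ coneOver (closure Ω))
    (hv : ∀ᶠ s in 𝓝[>] (0 : ℝ), x + s • v ∈ coneOver (closure Ω)) :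
    HasDerivWithinAt (fun s : ℝ => radialExt f (x + s • v)) (inner ℝ (sphGrad Ω f x) v)
      (Ici 0) 0 :=
  hasDerivWithinAt_comp_line (hasFDerivWithinAt (hf.differentiableOn (by norm_num) x hx)) hv hx

variable (hΩ : IsStrictlyConvexSphericalDomain Ω)
include hΩ

theorem sphGrad_eq_of_hasFDerivWithinAt {f : Amb n → ℝ} {x g : Amb n} 
    (hx : x ∈ coneOver (closure Ω))
    (hf : HasFDerivWithinAt (radialExt f) (innerSL ℝ g) (coneOver (closure Ω)) x) :
    sphGrad Ω f x = g := by
  have h1 := (hasFDerivWithinAt hf.differentiableWithinAt).fderivWithin (hΩ.uniqueDiffOn x hx)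
  rw [hf.fderivWithin (hΩ.uniqueDiffOn x hx)] at h1
  refine (ext_inner_right ℝ fun v => ?_)
  simpa using (DFunLike.congr_fun h1 v).symm

theorem radialExt_eqOn {f g : Amb n → ℝ} (h : EqOn f g (closure Ω)) :
    EqOn (radialExt f) (radialExt g) (coneOver (closure Ω)) := fun _ hz =>
  h ((mem_coneOver_iff hΩ.closure_subset_sphere).1 hz).2

theorem sphGrad_congr {f g : Amb n → ℝ} (h : EqOn f g (closure Ω)) :
    EqOn (sphGrad Ω f) (sphGrad Ω g) (coneOver (closure Ω)) := fun z hz => by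
  unfold sphGrad gradientWithin
  rw [fderivWithin_congr (hΩ.radialExt_eqOn h) (hΩ.radialExt_eqOn h hz)]

theorem sphGradDeriv_congr {f g : Amb n → ℝ} (h : EqOn f g (closure Ω)) :
    EqOn (sphGradDeriv Ω f) (sphGradDeriv Ω g) (coneOver (closure Ω)) := fun _ hz =>
  fderivWithin_congr (hΩ.sphGrad_congr h) (hΩ.sphGrad_congr h hz)

theorem wForm_congr {f g : Amb n → ℝ} (h : EqOn f g (closure Ω)) {x : Amb n} (hx : x ∈ closure Ω) :
    wForm Ω f x = wForm Ω g x := by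
  ext X Y
  unfold wForm sphHess
  rw [hΩ.sphGrad_congr h (self_mem hx), hΩ.sphGradDeriv_congr h (self_mem hx)]

theorem flowOp_congr (α : ℝ) {f g : Amb n → ℝ} (h : EqOn f g (closure Ω)) {x : Amb n}
    (hx : x ∈ closure Ω) : flowOp α Ω f x = flowOp α Ω g x := by
  unfold flowOp wDet
  rw [hΩ.sphGrad_congr h (self_mem hx), h hx, hΩ.wForm_congr h hx]

theorem supGrad_congr {f g : Amb n → ℝ} (h : EqOn f g (closure Ω)) :
    supGrad Ω f = supGrad Ω g := by
  unfold supGrad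
  rw [image_congr fun x hx => by rw [hΩ.sphGrad_congr h (self_mem hx)]]

theorem sphGrad_sub {f g : Amb n → ℝ}
    (hf : DifferentiableOn ℝ (radialExt f) (coneOver (closure Ω)))
    (hg : DifferentiableOn ℝ (radialExt g) (coneOver (closure Ω))) {x : Amb n}
    (hx : x ∈ coneOver (closure Ω)) :
    sphGrad Ω (fun y => f y - g y) x = sphGrad Ω f x - sphGrad Ω g x := by
  apply hΩ.sphGrad_eq_of_hasFDerivWithinAt hx
  rw [map_sub]
  exact (hasFDerivWithinAt (hf x hx)).sub (hasFDerivWithinAt (hg x hx))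

theorem sphGrad_neg {f : Amb n → ℝ}
    (hf : DifferentiableOn ℝ (radialExt f) (coneOver (closure Ω))) {x : Amb n}
    (hx : x ∈ coneOver (closure Ω)) : sphGrad Ω (fun y => -f y) x = -sphGrad Ω f x := by
  apply hΩ.sphGrad_eq_of_hasFDerivWithinAt hx
  rw [map_neg]
  exact (hasFDerivWithinAt (hf x hx)).neg

variable {f : Amb n → ℝ} (hf : ContDiffOn ℝ 2 (radialExt f) (coneOver (closure Ω)))
include hf

theorem contDiffOn_sphGrad : ContDiffOn ℝ 1 (sphGrad Ω f) (coneOver (closure Ω)) :=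
  (InnerProductSpace.toDual ℝ (Amb n)).symm.contDiff.comp_contDiffOn
    (hf.fderivWithin hΩ.uniqueDiffOn (by norm_num))

theorem hasFDerivWithinAt_sphGrad {x : Amb n} (hx : x ∈ coneOver (closure Ω)) :
    HasFDerivWithinAt (sphGrad Ω f) (sphGradDeriv Ω f x) (coneOver (closure Ω)) x :=
  ((hΩ.contDiffOn_sphGrad hf).differentiableOn (by norm_num) x hx).hasFDerivWithinAt

theorem continuousOn_sphGradDeriv : ContinuousOn (sphGradDeriv Ω f) (coneOver (closure Ω)) :=
  (hΩ.contDiffOn_sphGrad hf).continuousOn_fderivWithin hΩ.uniqueDiffOn (by norm_num)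

theorem sphGradDeriv_sub {g : Amb n → ℝ}
    (hg : ContDiffOn ℝ 2 (radialExt g) (coneOver (closure Ω))) {x : Amb n}
    (hx : x ∈ coneOver (closure Ω)) :
    sphGradDeriv Ω (fun y => f y - g y) x = sphGradDeriv Ω f x - sphGradDeriv Ω g x := by
  have h1 : EqOn (sphGrad Ω fun y => f y - g y) (fun z => sphGrad Ω f z - sphGrad Ω g z)
      (coneOver (closure Ω)) := fun z hz => hΩ.sphGrad_sub
        (hf.differentiableOn (by norm_num)) (hg.differentiableOn (by norm_num)) hz
  unfold sphGradDeriv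
  rw [fderivWithin_congr h1 (h1 hx)]
  exact ((hΩ.hasFDerivWithinAt_sphGrad hf hx).sub
    (hΩ.hasFDerivWithinAt_sphGrad hg hx)).fderivWithin (hΩ.uniqueDiffOn x hx)

theorem sphHess_symm {x : Amb n} (hx : x ∈ coneOver (closure Ω)) (X Y : Amb n) :
    sphHess Ω f x X Y = sphHess Ω f x Y X := by
  have h1 := (hf x hx).isSymmSndFDerivWithinAt (by simp) hΩ.uniqueDiffOn
    (hΩ.subset_closure_interior hx) hx
  have h2 : ∀ X Y, sphHess Ω f x X Y =
      fderivWithin ℝ (fderivWithin ℝ (radialExt f) (coneOver (closure Ω))) (coneOver (closure Ω))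
        x X Y := by
    intro X Y
    have h3 := ((hf.fderivWithin hΩ.uniqueDiffOn (m := 1) (by norm_num)).differentiableOn
      (by norm_num) x hx).hasFDerivWithinAt.clm_apply (hasFDerivWithinAt_const Y x _)
    have h4 := (hΩ.hasFDerivWithinAt_sphGrad hf hx).inner ℝ (hasFDerivWithinAt_const Y x _)
    have h5 : (fun z => fderivWithin ℝ (radialExt f) (coneOver (closure Ω)) z Y) =
        fun z => (inner ℝ (sphGrad Ω f z) Y : ℝ) := by
      funext z
      simp [sphGrad, gradientWithin]
    rw [h5] at h3
    have h6 := DFunLike.congr_fun ((hΩ.uniqueDiffOn x hx).eq h4 h3) X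
    simpa [sphHess] using h6
  rw [h2, h2]
  exact h1 X Y

theorem eventually_hasDerivAt_line {x v : Amb n}
    (hv : ∀ᶠ s in 𝓝[>] (0 : ℝ), x + s • v ∈ coneOver Ω) :
    ∀ᶠ s in 𝓝[>] (0 : ℝ), HasDerivAt (fun s : ℝ => radialExt f (x + s • v))
      (inner ℝ (sphGrad Ω f (x + s • v)) v) s := by
  filter_upwards [hv] with s hs
  have h1 := (hasFDerivWithinAt (hf.differentiableOn (by norm_num) _
    (coneOver_subset_closure hs))).hasFDerivAt (hΩ.cone_mem_nhds hs)
  exact hasDerivAt_comp_line h1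

theorem hasDerivWithinAt_sphGrad_line {x v : Amb n} (hx : x ∈ coneOver (closure Ω))
    (hv : ∀ᶠ s in 𝓝[>] (0 : ℝ), x + s • v ∈ coneOver (closure Ω)) :
    HasDerivWithinAt (fun s : ℝ => (inner ℝ (sphGrad Ω f (x + s • v)) v : ℝ))
      (sphHess Ω f x v v) (Ici 0) 0 := by
  have h1 := hasDerivWithinAt_comp_line (hΩ.hasFDerivWithinAt_sphGrad hf hx) hv hx
  simpa [sphHess] using h1.inner ℝ (hasDerivWithinAt_const (0 : ℝ) (Ici 0) v)

omit hΩ in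
theorem inner_sphGrad_self {x : Amb n} (hx : x ∈ coneOver (closure Ω)) :
    inner ℝ (sphGrad Ω f x) x = (0 : ℝ) := by
  have hmem : ∀ᶠ s in 𝓝[>] (0 : ℝ), x + s • x ∈ coneOver (closure Ω) := by
    filter_upwards [self_mem_nhdsWithin] with s hs
    have hs' : (0 : ℝ) < s := hs
    have : x + s • x = (1 + s) • x := by module
    rw [this]
    exact smul_mem_coneOver (by linarith) hx
  have h1 := hasDerivWithinAt_line hf hx hmem
  have h2 : HasDerivWithinAt (fun s : ℝ => radialExt f (x + s • x)) 0 (Ici 0) 0 := by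
    refine (hasDerivWithinAt_const (0 : ℝ) (Ici 0) (radialExt f x)).congr (fun s hs => ?_)
      (by simp)
    have hs' : (0 : ℝ) ≤ s := hs
    have : x + s • x = (1 + s) • x := by module
    rw [this, radialExt_smul f (by linarith)]
  exact (uniqueDiffWithinAt_Ici (0 : ℝ)).eq_deriv _ h1 h2

-- Treats interior and boundary points together. At an interior point every direction is admissible
-- and `μ = x` may be taken, because gradients of radial extensions are orthogonal to x.
omit hf in
theorem exists_inward {x : Amb n} (hx : x ∈ closure Ω) : ∃ μ : Amb n, ‖μ‖ = 1 ∧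
    (∀ v, inner ℝ μ v < (0 : ℝ) → ∀ᶠ s in 𝓝[>] (0 : ℝ), x + s • v ∈ coneOver Ω) ∧
    (x ∈ Ω → μ = x) ∧ (x ∈ sphBoundary Ω → IsOutwardUnitNormal Ω x μ) := by
  by_cases hxΩ : x ∈ Ω
  · refine ⟨x, hΩ.norm_eq_one hx, fun v _ => ?_, fun _ => rfl, fun h => absurd hxΩ h.2⟩
    exact (tendsto_line x v).eventually (hΩ.isOpen_cone.mem_nhds (subset_coneOver _ hxΩ))
  · have hp : x ∈ sphBoundary Ω := ⟨hx, hxΩ⟩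
    obtain ⟨μ, hμ⟩ := hΩ.exists_normal hp
    exact ⟨μ, hμ.1, fun v hv => hΩ.eventually_mem hp hμ hv, fun h => absurd h hxΩ, fun _ => hμ⟩

omit hf in
theorem le_radialExt {x : Amb n} (hx : x ∈ closure Ω) (hmin : ∀ y ∈ closure Ω, f x ≤ f y)
    {z : Amb n} (hz : z ∈ coneOver (closure Ω)) : radialExt f x ≤ radialExt f z := by
  rw [radialExt_of_norm_eq_one f (hΩ.norm_eq_one hx)]
  exact hmin _ ((mem_coneOver_iff hΩ.closure_subset_sphere).1 hz).2

/-- First and second order conditions at a minimum point, also at the boundary if the derivative in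
the normal direction vanishes there. -/
theorem grad_eq_zero_and_hess_nonneg_of_min {x : Amb n} (hx : x ∈ closure Ω)
    (hmin : ∀ y ∈ closure Ω, f x ≤ f y)
    (hN : ∀ μ, IsOutwardUnitNormal Ω x μ → x ∈ sphBoundary Ω →
      inner ℝ (sphGrad Ω f x) μ = (0 : ℝ)) :
    sphGrad Ω f x = 0 ∧ ∀ v, 0 ≤ sphHess Ω f x v v := by
  obtain ⟨μ, hμ1, hμ, hint, hbd⟩ := hΩ.exists_inward hx
  have hK := self_mem hx
  have hμμ : inner ℝ μ μ = (1 : ℝ) := by rw [real_inner_self_eq_norm_sq, hμ1]; norm_num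
  have hNμ : inner ℝ (sphGrad Ω f x) μ = (0 : ℝ) := by
    by_cases hxΩ : x ∈ Ω
    · rw [hint hxΩ]; exact inner_sphGrad_self hf hK
    · exact hN μ (hbd ⟨hx, hxΩ⟩) ⟨hx, hxΩ⟩
  have hcl : ∀ v, inner ℝ μ v < (0 : ℝ) →
      ∀ᶠ s in 𝓝[>] (0 : ℝ), x + s • v ∈ coneOver (closure Ω) := fun v hv =>
    (hμ v hv).mono fun s hs => coneOver_subset_closure hs
  have hG : sphGrad Ω f x = 0 := by
    set G := sphGrad Ω f x with hGdef
    by_contra hne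
    have hpos : 0 < ‖G‖ ^ 2 := by positivity
    -- Subtracting μ makes the descent direction -G point strictly inward. Since G is orthogonal to
    -- μ, the slope is still -|G|².
    have hv : inner ℝ μ (-G - μ) < (0 : ℝ) := by
      rw [inner_sub_right, inner_neg_right, real_inner_comm, hNμ, hμμ]; norm_num
    have h1 := hasDerivWithinAt_line hf hK (hcl _ hv)
    rw [← hGdef, inner_sub_right, inner_neg_right, hNμ, real_inner_self_eq_norm_sq] at h1
    obtain ⟨s, hs1, hs2⟩ := ((eventually_lt_of_hasDerivWithinAt_neg h1 (by linarith)).and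
      (hcl _ hv)).exists
    have := hΩ.le_radialExt hx hmin hs2
    simp only [zero_smul, add_zero] at hs1
    linarith
  refine ⟨hG, ?_⟩
  have key : ∀ v, inner ℝ μ v < (0 : ℝ) → 0 ≤ sphHess Ω f x v v := by
    intro v hv
    by_contra! hneg
    have h1 := hasDerivWithinAt_line hf hK (hcl _ hv)
    have h2 := hΩ.hasDerivWithinAt_sphGrad_line hf hK (hcl _ hv)
    have h3 := hΩ.eventually_hasDerivAt_line hf (hμ v hv)
    obtain ⟨s, hs1, hs2⟩ := ((eventually_gt_of_second_deriv_pos h1.neg.continuousWithinAt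
      (h3.mono fun s hs => hs.neg) h2.neg (by simp [hG]) (by linarith)).and (hcl _ hv)).exists
    have := hΩ.le_radialExt hx hmin hs2
    simp only [Pi.neg_apply, zero_smul, add_zero] at hs1
    linarith
  -- Tangential directions are limits of strictly inward ones, and outward directions are covered
  -- because the quadratic form is even.
  have hcont : ∀ v : Amb n, Tendsto (fun ε : ℝ => sphHess Ω f x (v + ε • (-μ)) (v + ε • (-μ)))
      (𝓝[>] 0) (𝓝 (sphHess Ω f x v v)) := by
    intro v
    have : Continuous fun w : Amb n => sphHess Ω f x w w := by unfold sphHess; fun_prop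
    exact (this.tendsto v).comp (tendsto_line v (-μ))
  have key2 : ∀ v, inner ℝ μ v ≤ (0 : ℝ) → 0 ≤ sphHess Ω f x v v := by
    intro v hv
    refine ge_of_tendsto (hcont v) ?_
    filter_upwards [self_mem_nhdsWithin] with ε hε
    have hε' : (0 : ℝ) < ε := hε
    apply key
    rw [inner_add_right, inner_smul_right, inner_neg_right, hμμ]
    linarith
  intro v
  rcases le_total (inner ℝ μ v : ℝ) 0 with h | h
  · exact key2 v h
  · have := key2 (-v) (by rw [inner_neg_right]; linarith)
    simpa [sphHess] using this

end IsStrictlyConvexSphericalDomain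

/-! ### Monotonicity of the determinant -/

theorem one_le_det_of_posSemidef_sub_one {ι : Type*} [Fintype ι] [DecidableEq ι]
    {M : Matrix ι ι ℝ} (hM : (M - 1).PosSemidef) : 1 ≤ M.det := by
  have hH : M.IsHermitian := by
    have := hM.isHermitian.add (Matrix.isHermitian_one (n := ι) (α := ℝ))
    rwa [sub_add_cancel] at this
  rw [hH.det_eq_prod_eigenvalues]
  have h1 : ∀ i, 1 ≤ hH.eigenvalues i := by
    intro i
    have h2 := hM.dotProduct_mulVec_nonneg (hH.eigenvectorBasis i)
    rw [Matrix.sub_mulVec, Matrix.one_mulVec, dotProduct_sub, hH.mulVec_eigenvectorBasis] at h2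
    have h3 : star (hH.eigenvectorBasis i : ι → ℝ) ⬝ᵥ (hH.eigenvectorBasis i : ι → ℝ) = 1 := by
      have h4 : (inner ℝ (hH.eigenvectorBasis i) (hH.eigenvectorBasis i) : ℝ) = 1 := by
        rw [real_inner_self_eq_norm_sq, hH.eigenvectorBasis.orthonormal.1 i]; norm_num
      rw [EuclideanSpace.inner_eq_star_dotProduct, dotProduct_comm] at h4
      exact h4
    rw [dotProduct_smul, h3] at h2
    simp only [smul_eq_mul, mul_one] at h2
    linarith
  simpa using Finset.prod_le_prod (s := Finset.univ) (f := fun _ : ι => (1 : ℝ))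
    (fun _ _ => zero_le_one) (fun i _ => h1 i)

-- Congruence with B^{-1/2} reduces the claim to B = 1, where all eigenvalues are at least 1.
open scoped MatrixOrder in
theorem Matrix.PosDef.det_le_det_of_posSemidef_sub {ι : Type*} [Fintype ι] [DecidableEq ι]
    {A B : Matrix ι ι ℝ} (hB : B.PosDef) (hAB : (A - B).PosSemidef) : B.det ≤ A.det := by
  set S := CFC.sqrt B with hS
  have hSS : S * S = B := CFC.sqrt_mul_sqrt_self B hB.posSemidef.nonneg
  have hSH : S.IsHermitian := (Matrix.nonneg_iff_posSemidef.1 (CFC.sqrt_nonneg B)).isHermitian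
  have hdet : S.det * S.det = B.det := by rw [← Matrix.det_mul, hSS]
  have hpos := hB.det_pos
  have hu : IsUnit S.det := by
    rw [isUnit_iff_ne_zero]; rintro h; rw [h] at hdet; simp at hdet; linarith
  have hiH : (S⁻¹).IsHermitian := hSH.inv
  have h1 : S⁻¹ * B * S⁻¹ = 1 := by
    rw [← hSS, ← Matrix.mul_assoc, Matrix.nonsing_inv_mul S hu, Matrix.one_mul,
      Matrix.mul_nonsing_inv S hu]
  have h2 : (S⁻¹ * A * S⁻¹ - 1).PosSemidef := by
    have := hAB.conjTranspose_mul_mul_same S⁻¹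
    rwa [hiH.eq, Matrix.mul_sub, Matrix.sub_mul, h1] at this
  have h3 := one_le_det_of_posSemidef_sub_one h2
  rw [Matrix.det_mul, Matrix.det_mul, Matrix.det_nonsing_inv, Ring.inverse_eq_inv'] at h3
  have h4 : S.det⁻¹ * A.det * S.det⁻¹ = A.det / B.det := by
    rw [← hdet]; field_simp
  rw [h4, one_le_div hpos] at h3
  exact h3

section InnerProductSpace

variable {E : Type*} [NormedAddCommGroup E] [InnerProductSpace ℝ E] [FiniteDimensional ℝ E]

theorem LinearMap.IsPositive.posDef_toMatrix {ι : Type*} [Fintype ι] [DecidableEq ι]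
    (b : OrthonormalBasis ι ℝ E) {B : E →ₗ[ℝ] E} (hB : B.IsPositive)
    (hpos : ∀ X, X ≠ 0 → 0 < (inner ℝ (B X) X : ℝ)) :
    (B.toMatrix b.toBasis b.toBasis).PosDef := by
  rw [((LinearMap.posSemidef_toMatrix_iff b).2 hB).posDef_iff_det_ne_zero, LinearMap.det_toMatrix]
  intro h0
  obtain ⟨X, hX, hX0⟩ := (Submodule.ne_bot_iff _).1 (LinearMap.bot_lt_ker_of_det_eq_zero h0).ne'
  have := hpos X hX0
  rw [LinearMap.mem_ker.1 hX, inner_zero_left] at this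
  exact lt_irrefl _ this

theorem LinearMap.IsSymmetric.det_pos_and_det_le_det {A B : E →ₗ[ℝ] E} (hA : A.IsSymmetric)
    (hB : B.IsSymmetric) (hpos : ∀ X, X ≠ 0 → 0 < (inner ℝ (B X) X : ℝ))
    (hAB : ∀ X, (inner ℝ (B X) X : ℝ) ≤ inner ℝ (A X) X) :
    0 < LinearMap.det B ∧ LinearMap.det B ≤ LinearMap.det A := by
  set b := stdOrthonormalBasis ℝ E
  have hBpos : B.IsPositive := ⟨hB, fun X => by
    rcases eq_or_ne X 0 with rfl | hX
    · simp
    · exact (hpos X hX).le⟩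
  have h1 := LinearMap.IsPositive.posDef_toMatrix b hBpos hpos
  have h2 : (A - B).IsPositive := ⟨hA.sub hB, fun X => by
    rw [LinearMap.sub_apply, inner_sub_left]; simpa using hAB X⟩
  have h3 := (LinearMap.posSemidef_toMatrix_iff b).2 h2
  rw [map_sub] at h3
  have h4 := h1.det_le_det_of_posSemidef_sub h3
  have h5 := h1.det_pos
  rw [LinearMap.det_toMatrix, LinearMap.det_toMatrix] at h4
  rw [LinearMap.det_toMatrix] at h5
  exact ⟨h5, h4⟩

/-- In this basis the matrix of `wOp` splits into the block 1 and the transpose of the matrix that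
defines `wDet`. -/
theorem exists_orthonormalBasis_sum {x : E} (hx : ‖x‖ = 1) :
    ∃ b : OrthonormalBasis (Unit ⊕ Fin (Module.finrank ℝ (ℝ ∙ x)ᗮ)) ℝ E,
      b (Sum.inl ()) = x ∧ ∀ i, b (Sum.inr i) = (stdOrthonormalBasis ℝ (ℝ ∙ x)ᗮ i : E) := by
  set e := stdOrthonormalBasis ℝ (ℝ ∙ x)ᗮ with he
  set v : Unit ⊕ Fin (Module.finrank ℝ (ℝ ∙ x)ᗮ) → E := Sum.elim (fun _ => x) (fun i => (e i : E))
    with hv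
  have hxe : ∀ i, inner ℝ x (e i : E) = (0 : ℝ) := fun i =>
    Submodule.mem_orthogonal_singleton_iff_inner_right.1 (e i).2
  have hon : Orthonormal ℝ v := by
    constructor
    · rintro (i | i)
      · simpa [hv] using hx
      · exact e.orthonormal.1 i
    · rintro (i | i) (j | j) hij
      · exact absurd rfl hij
      · simpa [hv] using hxe j
      · simpa [hv, real_inner_comm] using hxe i
      · have := e.orthonormal.2 (i := i) (j := j) (by rintro rfl; exact hij rfl)
        simpa [hv] using this
  have hcard : Fintype.card (Unit ⊕ Fin (Module.finrank ℝ (ℝ ∙ x)ᗮ)) = Module.finrank ℝ E := by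
    have h1 := Submodule.finrank_add_finrank_orthogonal (ℝ ∙ x)
    rw [finrank_span_singleton (by rintro rfl; simp at hx)] at h1
    simpa using h1
  have hspan : ⊤ ≤ Submodule.span ℝ (range v) :=
    (hon.linearIndependent.span_eq_top_of_card_eq_finrank' hcard).ge
  refine ⟨OrthonormalBasis.mk hon hspan, ?_, fun i => ?_⟩ <;> simp [hv]

end InnerProductSpace

/-! ### The operator of the form `σ - D²f + Df ⊗ Df` -/

/-- The orthogonal projection onto the tangent space `x^⊥` of the sphere at `x`. -/
noncomputable def tangentProj (x : Amb n) : Amb n →L[ℝ] Amb n :=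
  ContinuousLinearMap.id ℝ (Amb n) - (innerSL ℝ x).smulRight x

/-- The operator of `σ - D²f + Df ⊗ Df` on the tangent space `x^⊥`, extended by the identity to
the normal line. -/
noncomputable def wOp (Ω : Set (Amb n)) (f : Amb n → ℝ) (x : Amb n) : Amb n →L[ℝ] Amb n :=
  tangentProj x ∘L (ContinuousLinearMap.id ℝ (Amb n) - sphGradDeriv Ω f x
    + (innerSL ℝ (sphGrad Ω f x)).smulRight (sphGrad Ω f x)) ∘L tangentProj x
    + (innerSL ℝ x).smulRight x

theorem tangentProj_apply (x X : Amb n) : tangentProj x X = X - (inner ℝ x X : ℝ) • x := by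
  simp [tangentProj]

theorem tangentProj_of_inner_eq_zero {x X : Amb n} (h : inner ℝ x X = (0 : ℝ)) :
    tangentProj x X = X := by
  simp [tangentProj_apply, h]

theorem inner_self_of_norm_eq_one {x : Amb n} (hx : ‖x‖ = 1) : inner ℝ x x = (1 : ℝ) := by
  rw [real_inner_self_eq_norm_sq, hx]; norm_num

theorem inner_tangentProj_right {x : Amb n} (hx : ‖x‖ = 1) (X : Amb n) :
    inner ℝ x (tangentProj x X) = (0 : ℝ) := by
  rw [tangentProj_apply, inner_sub_right, inner_smul_right, inner_self_of_norm_eq_one hx]; ring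

theorem inner_tangentProj_left (x X Y : Amb n) :
    (inner ℝ (tangentProj x X) Y : ℝ) = inner ℝ X (tangentProj x Y) := by
  simp only [tangentProj_apply, inner_sub_left, inner_sub_right, inner_smul_left,
    inner_smul_right, real_inner_comm x X]
  simp; ring

theorem inner_wOp (f : Amb n → ℝ) (x X Y : Amb n) : (inner ℝ (wOp Ω f x X) Y : ℝ) =
    wForm Ω f x (tangentProj x X) (tangentProj x Y) + inner ℝ x X * inner ℝ x Y := by
  simp only [wOp, add_apply, ContinuousLinearMap.comp_apply, inner_add_left,
    inner_tangentProj_left, sub_apply, ContinuousLinearMap.id_apply,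
    ContinuousLinearMap.smulRight_apply, innerSL_apply_apply, inner_smul_left, inner_sub_left,
    wForm, sphHess]
  simp

/-- The chosen basis of x^⊥ need not vary continuously with x. The determinant of an operator on the
fixed ambient space gives continuity of `wDet` and allows comparison of different tangent spaces. -/
theorem det_wOp (f : Amb n → ℝ) {x : Amb n} (hx : ‖x‖ = 1) : (wOp Ω f x).det = wDet Ω f x := by
  obtain ⟨b, hb1, hb2⟩ := exists_orthonormalBasis_sum hx
  have hxe : ∀ i, inner ℝ x (stdOrthonormalBasis ℝ (ℝ ∙ x)ᗮ i : Amb n) = (0 : ℝ) := fun i =>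
    Submodule.mem_orthogonal_singleton_iff_inner_right.1 (stdOrthonormalBasis ℝ (ℝ ∙ x)ᗮ i).2
  have hPx : tangentProj x x = 0 := by
    rw [tangentProj_apply, inner_self_of_norm_eq_one hx, one_smul, sub_self]
  have hM : LinearMap.toMatrix b.toBasis b.toBasis (wOp Ω f x : Amb n →ₗ[ℝ] Amb n) =
      Matrix.fromBlocks 1 0 0 (Matrix.of fun i j : Fin (Module.finrank ℝ (ℝ ∙ x)ᗮ) =>
        wForm Ω f x (stdOrthonormalBasis ℝ (ℝ ∙ x)ᗮ i : Amb n)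
          (stdOrthonormalBasis ℝ (ℝ ∙ x)ᗮ j : Amb n)).transpose := by
    ext i j
    have h1 : LinearMap.toMatrix b.toBasis b.toBasis (wOp Ω f x : Amb n →ₗ[ℝ] Amb n) i j =
        inner ℝ (wOp Ω f x (b j)) (b i) := by
      rw [LinearMap.toMatrix_apply]
      simp [OrthonormalBasis.repr_apply_apply, real_inner_comm]
    rw [h1, inner_wOp]
    rcases i with i | i <;> rcases j with j | j
    · simp [hb1, hPx, hx, wForm, sphHess]
    · simp [hb1, hb2, hPx, hxe, wForm, sphHess]
    · simp [hb1, hb2, hPx, hxe, wForm, sphHess]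
    · simp [hb2, hxe, tangentProj_of_inner_eq_zero]
  rw [ContinuousLinearMap.det, ← LinearMap.det_toMatrix b.toBasis, hM,
    Matrix.det_fromBlocks_zero₂₁, Matrix.det_one, one_mul, Matrix.det_transpose]
  rfl

theorem wForm_symm (hΩ : IsStrictlyConvexSphericalDomain Ω) {f : Amb n → ℝ}
    (hf : ContDiffOn ℝ 2 (radialExt f) (coneOver (closure Ω))) {x : Amb n} (hx : x ∈ closure Ω)
    (X Y : Amb n) : wForm Ω f x X Y = wForm Ω f x Y X := by
  unfold wForm
  rw [hΩ.sphHess_symm hf (subset_coneOver _ hx) X Y, real_inner_comm X Y]; ring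

theorem isSymmetric_wOp (hΩ : IsStrictlyConvexSphericalDomain Ω) {f : Amb n → ℝ}
    (hf : ContDiffOn ℝ 2 (radialExt f) (coneOver (closure Ω))) {x : Amb n} (hx : x ∈ closure Ω) :
    (wOp Ω f x : Amb n →ₗ[ℝ] Amb n).IsSymmetric := fun X Y => by
  have h1 := inner_wOp (Ω := Ω) f x X Y
  have h2 := inner_wOp (Ω := Ω) f x Y X
  rw [wForm_symm hΩ hf hx, mul_comm, ← h1, real_inner_comm] at h2
  exact h2.symm

theorem inner_wOp_pos {f : Amb n → ℝ} {x : Amb n} (hx : ‖x‖ = 1)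
    (hpos : ∀ X : Amb n, inner ℝ x X = (0 : ℝ) → X ≠ 0 → 0 < wForm Ω f x X X) (X : Amb n)
    (hX : X ≠ 0) : 0 < (inner ℝ (wOp Ω f x X) X : ℝ) := by
  rw [inner_wOp]
  by_cases h0 : tangentProj x X = 0
  · have h1 : X = (inner ℝ x X : ℝ) • x := by
      rw [tangentProj_apply] at h0; exact sub_eq_zero.1 h0
    have h2 : (inner ℝ x X : ℝ) ≠ 0 := fun h => hX (by rw [h1, h, zero_smul])
    rw [h0]
    have h3 : wForm Ω f x 0 0 = 0 := by simp [wForm, sphHess]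
    rw [h3, zero_add]
    exact mul_self_pos.2 h2
  · have := hpos _ (inner_tangentProj_right hx X) h0
    nlinarith [mul_self_nonneg (inner ℝ x X : ℝ)]

theorem wDet_pos (hΩ : IsStrictlyConvexSphericalDomain Ω) {f : Amb n → ℝ}
    (hf : ContDiffOn ℝ 2 (radialExt f) (coneOver (closure Ω))) {x : Amb n} (hx : x ∈ closure Ω)
    (hpos : ∀ X : Amb n, inner ℝ x X = (0 : ℝ) → X ≠ 0 → 0 < wForm Ω f x X X) :
    0 < wDet Ω f x := by
  rw [← det_wOp f (hΩ.norm_eq_one hx)]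
  exact (LinearMap.IsSymmetric.det_pos_and_det_le_det (isSymmetric_wOp hΩ hf hx) (isSymmetric_wOp hΩ hf hx)
    (inner_wOp_pos (hΩ.norm_eq_one hx) hpos) (fun _ => le_rfl)).1

/-- If `S` is an isometric involution with `S x = ± y`, and the form at `y` is dominated on the
tangent spaces by the form at `x`, then so are the determinants. -/
theorem wDet_le_wDet (hΩ : IsStrictlyConvexSphericalDomain Ω) {f g : Amb n → ℝ}
    (hf : ContDiffOn ℝ 2 (radialExt f) (coneOver (closure Ω)))
    (hg : ContDiffOn ℝ 2 (radialExt g) (coneOver (closure Ω))) {x y : Amb n}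
    (hx : x ∈ closure Ω) (hy : y ∈ closure Ω) (S : Amb n ≃ₗᵢ[ℝ] Amb n) (hS : ∀ X, S (S X) = X)
    {a : ℝ} (ha : a ^ 2 = 1) (hSx : S x = a • y)
    (hpos : ∀ X : Amb n, inner ℝ y X = (0 : ℝ) → X ≠ 0 → 0 < wForm Ω g y X X)
    (hle : ∀ X : Amb n, inner ℝ x X = (0 : ℝ) → wForm Ω g y (S X) (S X) ≤ wForm Ω f x X X) :
    wDet Ω g y ≤ wDet Ω f x := by
  set L : Amb n →ₗ[ℝ] Amb n := (S.toLinearEquiv : Amb n →ₗ[ℝ] Amb n) with hL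
  have hSS : L ∘ₗ L = LinearMap.id := LinearMap.ext fun X => hS X
  have hadj : ∀ X Y, (inner ℝ (S X) Y : ℝ) = inner ℝ X (S Y) := fun X Y => by
    rw [← S.inner_map_map X (S Y), hS]
  have hax : ∀ X, inner ℝ y (S X) = a * (inner ℝ x X : ℝ) := by
    intro X
    have h1 : y = a • S x := by rw [hSx, smul_smul, ← sq, ha, one_smul]
    rw [h1, inner_smul_left, S.inner_map_map]; simp
  have hP : ∀ X, tangentProj y (S X) = S (tangentProj x X) := by
    intro X
    rw [tangentProj_apply, tangentProj_apply, map_sub, hax, map_smul, hSx, smul_smul, mul_comm]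
  -- The operator at y is carried to x by conjugation with the involution, which preserves its
  -- determinant.
  set B : Amb n →ₗ[ℝ] Amb n := L ∘ₗ (wOp Ω g y : Amb n →ₗ[ℝ] Amb n) ∘ₗ L with hB
  have hBi : ∀ X Y, (inner ℝ (B X) Y : ℝ) = inner ℝ (wOp Ω g y (S X)) (S Y) := fun X Y =>
    hadj _ _
  have hdet : LinearMap.det B = wDet Ω g y := by
    have h1 : LinearMap.det L * LinearMap.det L = 1 := by
      rw [← LinearMap.det_comp, hSS, LinearMap.det_id]
    rw [hB, LinearMap.det_comp, LinearMap.det_comp, mul_comm, mul_assoc, h1, mul_one,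
      ← det_wOp g (hΩ.norm_eq_one hy)]
  rw [← hdet, ← det_wOp f (hΩ.norm_eq_one hx)]
  refine (LinearMap.IsSymmetric.det_pos_and_det_le_det (isSymmetric_wOp hΩ hf hx) ?_ ?_ ?_).2
  · intro X Y
    rw [hBi, real_inner_comm (B Y) X, hBi, real_inner_comm (S X)]
    exact (isSymmetric_wOp hΩ hg hy _ _)
  · intro X hX
    rw [hBi]
    exact inner_wOp_pos (hΩ.norm_eq_one hy) hpos _ (by simpa using hX)
  · intro X
    rw [hBi, inner_wOp, hP, hax, ContinuousLinearMap.coe_coe, inner_wOp]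
    have h1 := hle _ (inner_tangentProj_right (hΩ.norm_eq_one hx) X)
    have h2 : a * (inner ℝ x X : ℝ) * (a * inner ℝ x X) = inner ℝ x X * inner ℝ x X := by
      linear_combination (inner ℝ x X * inner ℝ x X : ℝ) * ha
    linarith

/-! ### A first-time lemma -/

/-- The set where Z ≥ 0 is compact, so its times have a minimum. The strict sign before that time
gives the sign of the time derivative at the contact point. All the barrier arguments below start
here. -/
theorem exists_first_time {X : Type*} [TopologicalSpace X] [T2Space X] {K : Set X}
    (hK : IsCompact K) {Z : X → ℝ → ℝ} {t₁ : ℝ} (ht₁ : 0 ≤ t₁)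
    (hZ : ContinuousOn (fun p : X × ℝ => Z p.1 p.2) (K ×ˢ Icc 0 t₁))
    (h0 : ∀ x ∈ K, Z x 0 < 0) (hex : ∃ x ∈ K, 0 ≤ Z x t₁) :
    ∃ t, 0 < t ∧ t ≤ t₁ ∧ (∃ x ∈ K, Z x t = 0) ∧ (∀ y ∈ K, Z y t ≤ 0) ∧
      ∀ s, 0 ≤ s → s < t → ∀ y ∈ K, Z y s < 0 := by
  set B : Set (X × ℝ) := (K ×ˢ Icc 0 t₁) ∩ (fun p : X × ℝ => Z p.1 p.2) ⁻¹' Ici 0 with hB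
  have hcomp : IsCompact (K ×ˢ Icc (0 : ℝ) t₁) := hK.prod isCompact_Icc
  have hBc : IsCompact B :=
    hcomp.of_isClosed_subset (hZ.preimage_isClosed_of_isClosed hcomp.isClosed isClosed_Ici)
      inter_subset_left
  obtain ⟨x₁, hx₁, hx₁Z⟩ := hex
  have hBne : (Prod.snd '' B).Nonempty := ⟨t₁, (x₁, t₁), ⟨⟨hx₁, ht₁, le_rfl⟩, hx₁Z⟩, rfl⟩
  have hsc := hBc.image continuous_snd
  obtain ⟨⟨x, t⟩, ⟨⟨hxK, ht0, htt₁⟩, hxZ⟩, hxt⟩ := hsc.sInf_mem hBne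
  have hlow : ∀ s, 0 ≤ s → s < t → ∀ y ∈ K, Z y s < 0 := by
    intro s hs hst y hy
    by_contra! hneg
    have : sInf (Prod.snd '' B) ≤ s := csInf_le hsc.bddBelow
      ⟨(y, s), ⟨⟨hy, hs, hst.le.trans htt₁⟩, hneg⟩, rfl⟩
    rw [← hxt] at this
    exact absurd hst (not_lt.2 this)
  have htpos : 0 < t := by
    refine lt_of_le_of_ne ht0 ?_
    rintro rfl
    exact absurd (h0 x hxK) (not_lt.2 hxZ)
  have hle : ∀ y ∈ K, Z y t ≤ 0 := by
    intro y hy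
    have hc : ContinuousWithinAt (fun s => Z y s) (Icc 0 t₁) t :=
      (hZ.comp (by fun_prop) (fun s hs => ⟨hy, hs⟩ : MapsTo (fun s : ℝ => (y, s)) (Icc 0 t₁)
        (K ×ˢ Icc 0 t₁))) t ⟨ht0, htt₁⟩
    have hc2 : Tendsto (fun s => Z y s) (𝓝[Ico 0 t] t) (𝓝 (Z y t)) :=
      hc.mono fun s hs => ⟨hs.1, hs.2.le.trans htt₁⟩
    have : (𝓝[Ico 0 t] t).NeBot := by
      rw [← mem_closure_iff_nhdsWithin_neBot, closure_Ico htpos.ne]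
      exact ⟨ht0, le_rfl⟩
    refine le_of_tendsto hc2 ?_
    filter_upwards [self_mem_nhdsWithin] with s hs
    exact (hlow s hs.1 hs.2 y hy).le
  exact ⟨t, htpos, htt₁, ⟨x, hxK, le_antisymm (hle x hxK) hxZ⟩, hle, hlow⟩

theorem deriv_nonneg_of_first_time {z : ℝ → ℝ} {z' t : ℝ} (ht : 0 < t) (hz : HasDerivAt z z' t)
    (hle : ∀ s, 0 ≤ s → s < t → z s < z t) : 0 ≤ z' := by
  by_contra! hneg
  have h1 : HasDerivAt (fun s : ℝ => z (t - s)) (-z') 0 := by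
    have h2 : HasDerivAt (fun s : ℝ => t - s) (-1) 0 := by
      simpa using (hasDerivAt_id (0 : ℝ)).const_sub t
    have h3 := HasDerivAt.comp (0 : ℝ) (h₂ := z) (h₂' := z') (by simpa using hz) h2
    rwa [mul_neg_one] at h3
  obtain ⟨s, hs1, hs2⟩ := ((eventually_gt_of_hasDerivWithinAt_pos h1.hasDerivWithinAt
    (by linarith)).and (Ioo_mem_nhdsGT ht)).exists
  simp only [sub_zero] at hs1
  have := hle (t - s) (by linarith [hs2.2]) (by linarith [hs2.1])
  linarith

/-! ### The time interval -/

theorem timeInterval_Icc_subset {T : EReal} {t : ℝ} (ht : t ∈ timeInterval T) :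
    Icc 0 t ⊆ timeInterval T := fun _ hs =>
  ⟨hs.1, lt_of_le_of_lt (EReal.coe_le_coe_iff.2 hs.2) ht.2⟩

theorem timeInterval_mem_nhds {T : EReal} {t : ℝ} (ht : t ∈ timeInterval T) (h0 : 0 < t) :
    timeInterval T ∈ 𝓝 t := by
  have h1 : ∀ᶠ s : ℝ in 𝓝 t, (s : EReal) < T :=
    (continuous_coe_real_ereal.tendsto t).eventually (gt_mem_nhds ht.2)
  filter_upwards [h1, lt_mem_nhds h0] with s h2 h3 using ⟨h3.le, h2⟩

theorem zero_mem_timeInterval {T : EReal} (hT : 0 < T) : (0 : ℝ) ∈ timeInterval T :=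
  ⟨le_rfl, by simpa using hT⟩

theorem exists_pos_mem_timeInterval {T : EReal} (hT : 0 < T) : ∃ t, 0 < t ∧ t ∈ timeInterval T := by
  obtain ⟨t, h1, h2⟩ := EReal.lt_iff_exists_real_btwn.1 hT
  have : (0 : ℝ) < t := by exact_mod_cast h1
  exact ⟨t, this, this.le, h2⟩

/-! ### Degenerate forms -/

/-- A null vector of a nonnegative symmetric form lies in the kernel of its operator. -/
theorem wDet_eq_zero_of_null (hΩ : IsStrictlyConvexSphericalDomain Ω) {f : Amb n → ℝ}
    (hf : ContDiffOn ℝ 2 (radialExt f) (coneOver (closure Ω))) {x : Amb n} (hx : x ∈ closure Ω)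
    (hpos : ∀ X : Amb n, inner ℝ x X = (0 : ℝ) → 0 ≤ wForm Ω f x X X) {X : Amb n}
    (hxX : inner ℝ x X = (0 : ℝ)) (hX : X ≠ 0) (h0 : wForm Ω f x X X = 0) : wDet Ω f x = 0 := by
  have hx1 := hΩ.norm_eq_one hx
  rw [← det_wOp f hx1]
  set A : Amb n →ₗ[ℝ] Amb n := (wOp Ω f x : Amb n →ₗ[ℝ] Amb n) with hA
  have hsym : A.IsSymmetric := isSymmetric_wOp hΩ hf hx
  have hnn : ∀ Y, 0 ≤ (inner ℝ (A Y) Y : ℝ) := by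
    intro Y
    rw [hA, ContinuousLinearMap.coe_coe, inner_wOp]
    nlinarith [hpos _ (inner_tangentProj_right hx1 Y), mul_self_nonneg (inner ℝ x Y : ℝ)]
  have hAX : (inner ℝ (A X) X : ℝ) = 0 := by
    rw [hA, ContinuousLinearMap.coe_coe, inner_wOp, tangentProj_of_inner_eq_zero hxX, h0, hxX]
    ring
  have hzero : A X = 0 := by
    set N : ℝ := inner ℝ (A X) (A X) with hN
    set c : ℝ := inner ℝ (A (A X)) (A X) with hc
    have hc0 : 0 ≤ c := hnn _
    have h1 : ∀ s : ℝ, 0 ≤ 2 * s * N + s ^ 2 * c := by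
      intro s
      have h2 := hnn (X + s • A X)
      have h3 : (inner ℝ (A (A X)) X : ℝ) = N := hsym (A X) X
      simp only [map_add, map_smul, inner_add_left, inner_add_right, inner_smul_left,
        inner_smul_right, hAX, h3, ← hN, ← hc] at h2
      simp at h2
      nlinarith
    -- For small negative s the linear term 2sN outweighs s²c; the denominator c + 1 avoids a case
    -- distinction for c = 0.
    have h4 := h1 (-(N / (c + 1)))
    have h5 : 2 * -(N / (c + 1)) * N + (-(N / (c + 1))) ^ 2 * c
        = -(N ^ 2 * (c + 2)) / (c + 1) ^ 2 := by field_simp; ring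
    rw [h5, neg_div, neg_nonneg] at h4
    have h6 : N ^ 2 * (c + 2) ≤ 0 := by
      by_contra! h7
      exact absurd h4 (not_le.2 (by positivity))
    have h8 : N = 0 := by nlinarith [sq_nonneg N]
    exact inner_self_eq_zero.1 h8
  by_contra hdet
  exact hX ((LinearMap.equivOfDetNeZero A hdet).injective (by
    rw [map_zero]; exact hzero))

/-! ### Regularity of solutions and preservation of convexity -/

theorem continuousOn_wOp_comp {X : Type*} [TopologicalSpace X] {A : Set X} {F : X → Amb n → ℝ}
    {pt : X → Amb n} (h3 : ContinuousOn pt A)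
    (h1 : ContinuousOn (fun p => sphGrad Ω (F p) (pt p)) A)
    (h2 : ContinuousOn (fun p => sphGradDeriv Ω (F p) (pt p)) A) :
    ContinuousOn (fun p => wOp Ω (F p) (pt p)) A := by
  have h4 : ∀ g : X → Amb n, ContinuousOn g A →
      ContinuousOn (fun p => (innerSL ℝ (g p)).smulRight (g p)) A :=
    fun g hg => ((ContinuousLinearMap.smulRightL ℝ (Amb n) (Amb n)).continuous.comp_continuousOn
      ((innerSL ℝ).continuous.comp_continuousOn hg)).clm_apply hg
  unfold wOp tangentProj
  exact (((continuousOn_const.sub (h4 _ h3)).clm_comp (((continuousOn_const.sub h2).add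
    (h4 _ h1)).clm_comp (continuousOn_const.sub (h4 _ h3))))).add (h4 _ h3)

namespace IsSolution

variable {α : ℝ} {T : EReal} {φ₀ : Amb n → ℝ} {φ : Amb n → ℝ → ℝ}
  (hs : IsSolution α Ω T φ₀ φ)
include hs

theorem hasDerivAt_time {x : Amb n} (hx : x ∈ closure Ω) {t : ℝ} (ht : t ∈ timeInterval T)
    (h0 : 0 < t) : HasDerivAt (φ x) (derivWithin (φ x) (timeInterval T) t) t :=
  (hs.differentiable_time x hx t ht).hasDerivWithinAt.hasDerivAt (timeInterval_mem_nhds ht h0)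

theorem continuousOn_wDet (hΩ : IsStrictlyConvexSphericalDomain Ω) :
    ContinuousOn (fun p : Amb n × ℝ => wDet Ω (fun y => φ y p.2) p.1)
      (closure Ω ×ˢ timeInterval T) :=
  (ContinuousLinearMap.continuous_det.comp_continuousOn (continuousOn_wOp_comp
    continuous_fst.continuousOn hs.continuous_grad hs.continuous_hess)).congr
    fun _ hp => (det_wOp _ (hΩ.norm_eq_one hp.1)).symm

theorem continuousOn_rhs (b : ℝ) : ContinuousOn (fun p : Amb n × ℝ =>
    Real.exp ((α - 1) * φ p.1 p.2) * (1 + ‖sphGrad Ω (fun y => φ y p.2) p.1‖ ^ 2) ^ b)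
    (closure Ω ×ˢ timeInterval T) := by
  refine (Real.continuous_exp.comp_continuousOn (hs.continuous.const_smul (α - 1))).mul
    (ContinuousOn.rpow_const (continuousOn_const.add (hs.continuous_grad.norm.pow 2)) ?_)
  intro p _
  left; positivity

/-- The flow equation, up to the boundary and in a form that makes sense for degenerate forms. -/
theorem equation_of_posDef (hn : 1 ≤ n) (hα : 0 < α) (hΩ : IsStrictlyConvexSphericalDomain Ω)
    {t₀ : ℝ} (ht₀ : t₀ ∈ timeInterval T) (h0 : 0 < t₀)
    (hpos : ∀ x ∈ Ω, ∀ t, 0 < t → t < t₀ → 0 < wDet Ω (fun y => φ y t) x) :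
    ∀ x ∈ closure Ω, ∀ t ∈ Icc 0 t₀, derivWithin (φ x) (timeInterval T) t *
      wDet Ω (fun y => φ y t) x ^ (α / (n : ℝ)) = Real.exp ((α - 1) * φ x t) *
        (1 + ‖sphGrad Ω (fun y => φ y t) x‖ ^ 2) ^ (((α + 1) * (n : ℝ) / 2 + α) / (n : ℝ)) := by
  have hn' : (0 : ℝ) < n := by exact_mod_cast hn
  have hsub : closure Ω ×ˢ Icc 0 t₀ ⊆ closure Ω ×ˢ timeInterval T :=
    prod_mono_right (timeInterval_Icc_subset ht₀)
  have key : EqOn (fun p : Amb n × ℝ => derivWithin (φ p.1) (timeInterval T) p.2 *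
      wDet Ω (fun y => φ y p.2) p.1 ^ (α / (n : ℝ)))
      (fun p => Real.exp ((α - 1) * φ p.1 p.2) *
        (1 + ‖sphGrad Ω (fun y => φ y p.2) p.1‖ ^ 2) ^
          (((α + 1) * (n : ℝ) / 2 + α) / (n : ℝ))) (closure Ω ×ˢ Icc 0 t₀) := by
    refine EqOn.of_subset_closure (s := Ω ×ˢ Ioo 0 t₀) ?_ ?_
      ((hs.continuousOn_rhs _).mono hsub) (prod_mono subset_closure Ioo_subset_Icc_self) ?_
    · rintro ⟨x, t⟩ ⟨hx, ht⟩
      have htT : t ∈ timeInterval T := timeInterval_Icc_subset ht₀ ⟨ht.1.le, ht.2.le⟩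
      have h1 := (hs.evolution x hx t htT ht.1).hasDerivWithinAt.derivWithin
        (uniqueDiffWithinAt_of_mem_nhds (timeInterval_mem_nhds htT ht.1))
      have h2 : 0 < wDet Ω (fun y => φ y t) x ^ (α / (n : ℝ)) :=
        Real.rpow_pos_of_pos (hpos x hx t ht.1 ht.2) _
      simp only [h1, flowOp]
      field_simp
    -- The exponent α/n is nonnegative, so the power of `wDet` is continuous also at its zeros. This
    -- is why the equation is stated without a quotient.
    · refine (hs.continuous_time.mono hsub).mul
        (ContinuousOn.rpow_const ((hs.continuousOn_wDet hΩ).mono hsub) ?_)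
      intro p _
      right; positivity
    · rw [closure_prod_eq, closure_Ioo h0.ne]
  exact fun x hx t ht => key (x := (x, t)) ⟨hx, ht⟩

theorem continuousOn_wForm : ContinuousOn (fun q : (Amb n × Amb n) × ℝ =>
    wForm Ω (fun y => φ y q.2) q.1.1 q.1.2 q.1.2) ((closure Ω ×ˢ univ) ×ˢ timeInterval T) := by
  have hm : MapsTo (fun q : (Amb n × Amb n) × ℝ => (q.1.1, q.2))
      ((closure Ω ×ˢ univ) ×ˢ timeInterval T) (closure Ω ×ˢ timeInterval T) :=
    fun q hq => ⟨hq.1.1, hq.2⟩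
  have h1 := hs.continuous_grad.comp (by fun_prop) hm
  have h2 := hs.continuous_hess.comp (by fun_prop) hm
  have h3 : ContinuousOn (fun q : (Amb n × Amb n) × ℝ => q.1.2)
    ((closure Ω ×ˢ univ) ×ˢ timeInterval T) := by fun_prop
  unfold wForm sphHess
  exact ((h3.inner h3).sub ((h2.clm_apply h3).inner h3)).add ((h1.inner h3).mul (h1.inner h3))

/-- At the first time when the form has a null vector, sought on the compact unit tangent bundle,
its determinant is zero. The multiplied flow equation still holds there by continuity. Its left side
vanishes because φ_t is finite, whereas its right side is positive. -/
theorem posDef (hn : 1 ≤ n) (hα : 0 < α) (hΩ : IsStrictlyConvexSphericalDomain Ω)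
    (hφ₀ : IsStrictlyConvexDatum Ω φ₀) {t : ℝ} (ht : t ∈ timeInterval T) {x : Amb n}
    (hx : x ∈ closure Ω) (X : Amb n) (hxX : inner ℝ x X = (0 : ℝ)) (hX : X ≠ 0) :
    0 < wForm Ω (fun y => φ y t) x X X := by
  have hsmul : ∀ (f : Amb n → ℝ) (x X : Amb n) (c : ℝ),
      wForm Ω f x (c • X) (c • X) = c ^ 2 * wForm Ω f x X X := by
    intro f x X c
    simp only [wForm, sphHess, map_smul, inner_smul_left, inner_smul_right]
    simp; ring
  by_contra! hneg
  set K : Set (Amb n × Amb n) :=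
    (closure Ω ×ˢ Metric.sphere 0 1) ∩ {q | inner ℝ q.1 q.2 = (0 : ℝ)} with hK
  have hKc : IsCompact K := (hΩ.isCompact_closure.prod (isCompact_sphere 0 1)).inter_right
    (isClosed_eq (by fun_prop) continuous_const)
  have hXn : 0 < ‖X‖ := norm_pos_iff.2 hX
  obtain ⟨t₀, ht₀, htt₀, ⟨⟨y, Y⟩, ⟨⟨hy, hY1⟩, hyY⟩, hZ⟩, hle, hlt⟩ := exists_first_time hKc
    (Z := fun q s => -wForm Ω (fun y => φ y s) q.1 q.2 q.2) ht.1
    (hs.continuousOn_wForm.neg.mono fun q hq =>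
      ⟨⟨hq.1.1.1, mem_univ _⟩, timeInterval_Icc_subset ht hq.2⟩)
    (fun q hq => by
      have h1 : EqOn (fun y => φ y 0) φ₀ (closure Ω) := fun y hy => hs.initial y hy
      rw [hΩ.wForm_congr h1 hq.1.1]
      have h2 : q.2 ≠ 0 := by
        intro h; have := hq.1.2; rw [h] at this; simp at this
      have := hφ₀.posDef q.1 hq.1.1 q.2 hq.2 h2
      linarith)
    ⟨(x, ‖X‖⁻¹ • X), ⟨⟨hx, by simp [norm_smul, hXn.ne']⟩,
      by simp [inner_smul_right, hxX]⟩, by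
        simp only [hsmul]
        nlinarith [sq_nonneg (‖X‖⁻¹)]⟩
  have hT₀ : t₀ ∈ timeInterval T := timeInterval_Icc_subset ht ⟨ht₀.le, htt₀⟩
  have hunit : ∀ z Z : Amb n, z ∈ closure Ω → inner ℝ z Z = (0 : ℝ) → Z ≠ 0 →
      (z, ‖Z‖⁻¹ • Z) ∈ K := fun z Z hz hzZ hZ =>
    ⟨⟨hz, by simp [norm_smul, norm_ne_zero_iff.2 hZ]⟩, by simp [inner_smul_right, hzZ]⟩
  have hnn : ∀ Z : Amb n, inner ℝ y Z = (0 : ℝ) → 0 ≤ wForm Ω (fun y => φ y t₀) y Z Z := by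
    intro Z hZ
    rcases eq_or_ne Z 0 with rfl | hZ0
    · simp [wForm, sphHess]
    · have h1 := hle _ (hunit y Z hy hZ hZ0)
      simp only [hsmul] at h1
      have h2 : 0 < (‖Z‖⁻¹) ^ 2 := by have := norm_pos_iff.2 hZ0; positivity
      by_contra! h3
      nlinarith
  have hY0 : Y ≠ 0 := by rintro rfl; simp at hY1
  have hdet := wDet_eq_zero_of_null hΩ (hs.contDiff_space t₀ hT₀) hy hnn hyY hY0
    (neg_eq_zero.1 hZ)
  have heq := hs.equation_of_posDef hn hα hΩ hT₀ ht₀ (fun z hz s hs0 hst => by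
    refine wDet_pos hΩ (hs.contDiff_space s (timeInterval_Icc_subset hT₀ ⟨hs0.le, hst.le⟩))
      (subset_closure hz) fun Z hzZ hZ0 => ?_
    have h1 := hlt s hs0.le hst _ (hunit z Z (subset_closure hz) hzZ hZ0)
    simp only [hsmul] at h1
    have h2 : 0 < (‖Z‖⁻¹) ^ 2 := by have := norm_pos_iff.2 hZ0; positivity
    by_contra! h3
    nlinarith) y hy t₀ ⟨ht₀.le, le_rfl⟩
  have hn' : (0 : ℝ) < n := by exact_mod_cast hn
  rw [hdet, Real.zero_rpow (by positivity), mul_zero] at heq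
  have : 0 < Real.exp ((α - 1) * φ y t₀) * (1 + ‖sphGrad Ω (fun y => φ y t₀) y‖ ^ 2) ^
    (((α + 1) * (n : ℝ) / 2 + α) / (n : ℝ)) := by positivity
  linarith

theorem wDet_pos (hn : 1 ≤ n) (hα : 0 < α) (hΩ : IsStrictlyConvexSphericalDomain Ω)
    (hφ₀ : IsStrictlyConvexDatum Ω φ₀) {t : ℝ} (ht : t ∈ timeInterval T) {x : Amb n}
    (hx : x ∈ closure Ω) : 0 < wDet Ω (fun y => φ y t) x :=
  _root_.wDet_pos hΩ (hs.contDiff_space t ht) hx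
    fun X hxX hX => hs.posDef hn hα hΩ hφ₀ ht hx X hxX hX

/-- The flow equation holds up to the boundary and up to the initial time. -/
theorem derivWithin_eq (hn : 1 ≤ n) (hα : 0 < α) (hΩ : IsStrictlyConvexSphericalDomain Ω)
    (hφ₀ : IsStrictlyConvexDatum Ω φ₀) (hT : 0 < T) {t : ℝ} (ht : t ∈ timeInterval T) {x : Amb n}
    (hx : x ∈ closure Ω) :
    derivWithin (φ x) (timeInterval T) t = flowOp α Ω (fun y => φ y t) x := by
  have key : ∀ t₀, 0 < t₀ → t₀ ∈ timeInterval T → t ∈ Icc 0 t₀ →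
      derivWithin (φ x) (timeInterval T) t = flowOp α Ω (fun y => φ y t) x := by
    intro t₀ h0 hT₀ htt
    have heq := hs.equation_of_posDef hn hα hΩ hT₀ h0 (fun z hz s hs0 hst =>
      hs.wDet_pos hn hα hΩ hφ₀ (timeInterval_Icc_subset hT₀ ⟨hs0.le, hst.le⟩)
        (subset_closure hz)) x hx t htt
    have h2 : 0 < wDet Ω (fun y => φ y t) x ^ (α / (n : ℝ)) :=
      Real.rpow_pos_of_pos (hs.wDet_pos hn hα hΩ hφ₀ ht hx) _
    rw [flowOp, ← heq]
    field_simp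
  rcases eq_or_lt_of_le ht.1 with h | h
  · obtain ⟨t₀, h1, h2⟩ := exists_pos_mem_timeInterval hT
    exact key t₀ h1 h2 ⟨ht.1, by linarith⟩
  · exact key t h ht ⟨ht.1, le_rfl⟩

theorem neumann' (hT : 0 < T) {t : ℝ} (ht : t ∈ timeInterval T) {x : Amb n}
    (hx : x ∈ sphBoundary Ω) {μ : Amb n} (hμ : IsOutwardUnitNormal Ω x μ) :
    inner ℝ (sphGrad Ω (fun y => φ y t) x) μ = (0 : ℝ) := by
  rcases eq_or_lt_of_le ht.1 with h | h
  · obtain ⟨t₀, h1, h2⟩ := exists_pos_mem_timeInterval hT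
    have hc : ContinuousOn (fun s : ℝ => (inner ℝ (sphGrad Ω (fun y => φ y s) x) μ : ℝ))
        (Icc 0 t₀) := by
      have hc1 : ContinuousOn (fun s : ℝ => sphGrad Ω (fun y => φ y s) x) (Icc 0 t₀) :=
        hs.continuous_grad.comp (f := fun s : ℝ => (x, s)) (by fun_prop)
          fun s hs' => ⟨hx.1, timeInterval_Icc_subset h2 hs'⟩
      exact hc1.inner continuousOn_const
    have key : EqOn (fun s : ℝ => (inner ℝ (sphGrad Ω (fun y => φ y s) x) μ : ℝ)) (fun _ => 0)
        (Icc 0 t₀) := by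
      refine EqOn.of_subset_closure (s := Ioo 0 t₀) (fun s hs' => ?_) hc continuousOn_const
        Ioo_subset_Icc_self ?_
      · exact hs.neumann x hx s (timeInterval_Icc_subset h2 ⟨hs'.1.le, hs'.2.le⟩) hs'.1 μ hμ
      · rw [closure_Ioo h1.ne]
    exact key ⟨ht.1, by linarith⟩
  · exact hs.neumann x hx t ht h μ hμ

end IsSolution

/-! ### Lower bound for the speed -/

theorem flowOp_pos {α : ℝ} {f : Amb n → ℝ} {x : Amb n} (h : 0 < wDet Ω f x) :
    0 < flowOp α Ω f x := by
  unfold flowOp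
  have := Real.rpow_pos_of_pos h (α / (n : ℝ))
  positivity

/-- The exponential factor is the source of contraction: for α < 1 it is less than 1 when f x > g y.
-/
theorem flowOp_le_of_wDet_le {α : ℝ} (hα : 0 < α) {f g : Amb n → ℝ} {x y : Amb n}
    (hG : ‖sphGrad Ω f x‖ = ‖sphGrad Ω g y‖) (hpos : 0 < wDet Ω g y)
    (hle : wDet Ω g y ≤ wDet Ω f x) :
    flowOp α Ω f x ≤ Real.exp ((α - 1) * (f x - g y)) * flowOp α Ω g y := by
  have h1 : Real.exp ((α - 1) * f x) =
      Real.exp ((α - 1) * (f x - g y)) * Real.exp ((α - 1) * g y) := by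
    rw [← Real.exp_add]; ring_nf
  have h2 : wDet Ω g y ^ (α / (n : ℝ)) ≤ wDet Ω f x ^ (α / (n : ℝ)) :=
    Real.rpow_le_rpow hpos.le hle (by positivity)
  have h3 := Real.rpow_pos_of_pos hpos (α / (n : ℝ))
  unfold flowOp
  rw [hG, h1, mul_assoc, mul_div_assoc]
  gcongr

namespace IsSolution

variable {α : ℝ} {T : EReal} {φ₀ : Amb n → ℝ} {φ : Amb n → ℝ → ℝ}
  (hs : IsSolution α Ω T φ₀ φ)
include hs

theorem derivWithin_pos (hn : 1 ≤ n) (hα : 0 < α) (hΩ : IsStrictlyConvexSphericalDomain Ω)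
    (hφ₀ : IsStrictlyConvexDatum Ω φ₀) (hT : 0 < T) {t : ℝ} (ht : t ∈ timeInterval T) {x : Amb n}
    (hx : x ∈ closure Ω) : 0 < derivWithin (φ x) (timeInterval T) t := by
  rw [hs.derivWithin_eq hn hα hΩ hφ₀ hT ht hx]
  exact flowOp_pos (hs.wDet_pos hn hα hΩ hφ₀ ht hx)

/-- Supplies the initial inequality for the comparison in time: the strict bound at t = 0 persists
for a short time, uniformly in x. -/
theorem exists_speed_lower_bound_near_zero (hn : 1 ≤ n) (hα : 0 < α)
    (hΩ : IsStrictlyConvexSphericalDomain Ω) (hφ₀ : IsStrictlyConvexDatum Ω φ₀) (hT : 0 < T)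
    {m : ℝ} (hm : ∀ x ∈ closure Ω, m < flowOp α Ω φ₀ x) :
    ∃ η, 0 < η ∧ η ∈ timeInterval T ∧ ∀ x ∈ closure Ω, ∀ s ∈ Icc 0 η,
      m ≤ derivWithin (φ x) (timeInterval T) s := by
  obtain ⟨t₀, h0, ht₀⟩ := exists_pos_mem_timeInterval hT
  by_cases h : ∃ s ∈ Icc 0 t₀, ∃ x ∈ closure Ω, 0 ≤ m - derivWithin (φ x) (timeInterval T) s
  · obtain ⟨s, hs0, hex⟩ := h
    have hsT := timeInterval_Icc_subset ht₀ hs0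
    obtain ⟨t, ht, hts, -, hle, hlt⟩ := exists_first_time hΩ.isCompact_closure
      (Z := fun x s => m - derivWithin (φ x) (timeInterval T) s) hs0.1
      (continuousOn_const.sub (hs.continuous_time.mono
        (prod_mono_right (timeInterval_Icc_subset hsT))))
      (fun x hx => by
        have h1 := hs.derivWithin_eq hn hα hΩ hφ₀ hT (zero_mem_timeInterval hT) hx
        rw [hΩ.flowOp_congr α (fun y hy => hs.initial y hy) hx] at h1
        have := hm x hx
        simp only [h1]
        linarith) hex
    refine ⟨t, ht, timeInterval_Icc_subset hsT ⟨ht.le, hts⟩, fun x hx u hu => ?_⟩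
    rcases eq_or_lt_of_le hu.2 with h1 | h1
    · rw [h1]; linarith [hle x hx]
    · linarith [hlt u hu.1 h1 x hx]
  · push Not at h
    exact ⟨t₀, h0, ht₀, fun x hx s hs0 => by linarith [h s hs0 x hx]⟩

/-- Comparison principle between φ and the scaled solution φ(x, (1+ε)t + ετ) - log(1+ε)/(1-α). They
are ordered at t = 0 by the speed bound on [0, η] and log(1+ε) ≤ ε. -/
theorem log_le_sub_of_small (hn : 1 ≤ n) (hα : 0 < α) (hα₁ : α < 1)
    (hΩ : IsStrictlyConvexSphericalDomain Ω) (hφ₀ : IsStrictlyConvexDatum Ω φ₀) (hT : 0 < T)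
    {τ η ε t₁ : ℝ} (hτ : 0 < τ) (hη : η ∈ timeInterval T)
    (hηm : ∀ x ∈ closure Ω, ∀ s ∈ Icc 0 η,
      1 / ((1 - α) * τ) ≤ derivWithin (φ x) (timeInterval T) s)
    (hε : 0 < ε) (hεη : ε * τ ≤ η) (ht₁ : 0 ≤ t₁) (hT₁ : t₁ + ε * (t₁ + τ) ∈ timeInterval T)
    {x : Amb n} (hx : x ∈ closure Ω) :
    Real.log (1 + ε) / (1 - α) ≤ φ x (t₁ + ε * (t₁ + τ)) - φ x t₁ := by
  have hα' : 0 < 1 - α := by linarith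
  -- A constant ℓ strictly below log(1+ε)/(1-α) makes both the initial inequality and e^{(1-α)ℓ} < 1
  -- + ε strict.
  refine le_of_forall_lt fun ℓ hℓ => ?_
  by_contra! hneg
  have hmono : ∀ s, 0 ≤ s → s ≤ t₁ → s + ε * (s + τ) ∈ timeInterval T := fun s h0 h1 =>
    timeInterval_Icc_subset hT₁ ⟨by positivity, by gcongr⟩
  have hself : ∀ s, 0 ≤ s → s ≤ t₁ → s ∈ timeInterval T := fun s h0 h1 =>
    timeInterval_Icc_subset hT₁ ⟨h0, by nlinarith [mul_pos hε (by linarith : 0 < t₁ + τ)]⟩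
  have hcont : ContinuousOn (fun p : Amb n × ℝ => ℓ - (φ p.1 (p.2 + ε * (p.2 + τ)) - φ p.1 p.2))
      (closure Ω ×ˢ Icc 0 t₁) := by
    refine continuousOn_const.sub (ContinuousOn.sub ?_ ?_)
    · exact hs.continuous.comp (f := fun p : Amb n × ℝ => (p.1, p.2 + ε * (p.2 + τ)))
        (by fun_prop) fun p hp => ⟨hp.1, hmono _ hp.2.1 hp.2.2⟩
    · exact hs.continuous.mono fun p hp => ⟨hp.1, hself _ hp.2.1 hp.2.2⟩
  obtain ⟨t, ht, htt₁, ⟨z, hz, hzZ⟩, hle, hlt⟩ := exists_first_time hΩ.isCompact_closure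
    (Z := fun x s => ℓ - (φ x (s + ε * (s + τ)) - φ x s)) ht₁ hcont
    (fun y hy => by
      have h1 := Convex.mul_sub_le_image_sub_of_le_deriv (convex_Icc 0 η) (f := φ y)
        (C := 1 / ((1 - α) * τ))
        ((hs.differentiable_time y hy).continuousOn.mono (timeInterval_Icc_subset hη))
        ((hs.differentiable_time y hy).mono (interior_subset.trans (timeInterval_Icc_subset hη)))
        (fun s hs' => by
          rw [interior_Icc] at hs'
          have hs2 : s ∈ Icc 0 η := ⟨hs'.1.le, hs'.2.le⟩
          rw [(hs.hasDerivAt_time hy (timeInterval_Icc_subset hη hs2) hs'.1).deriv]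
          exact hηm y hy s hs2)
        0 ⟨le_rfl, hη.1⟩ (ε * τ) ⟨by positivity, hεη⟩ (by positivity)
      have h2 : 1 / ((1 - α) * τ) * (ε * τ - 0) = ε / (1 - α) := by field_simp; ring
      have h3 : Real.log (1 + ε) / (1 - α) ≤ ε / (1 - α) := by
        gcongr
        have := Real.log_le_sub_one_of_pos (x := 1 + ε) (by linarith)
        linarith
      simp only [zero_add]
      linarith) ⟨x, hx, by linarith⟩
  set t' := t + ε * (t + τ) with ht'
  have htT : t ∈ timeInterval T := hself t ht.le htt₁
  have htT' : t' ∈ timeInterval T := hmono t ht.le htt₁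
  have ht'0 : 0 < t' := by positivity
  have hC := hs.contDiff_space t htT
  have hC' := hs.contDiff_space t' htT'
  have hwC : ContDiffOn ℝ 2 (radialExt fun y => φ y t' - φ y t) (coneOver (closure Ω)) :=
    hC'.sub hC
  have hK : z ∈ coneOver (closure Ω) := subset_coneOver _ hz
  have hsub := hΩ.sphGrad_sub (hC'.differentiableOn (by norm_num))
    (hC.differentiableOn (by norm_num)) hK
  obtain ⟨hG, hH⟩ := hΩ.grad_eq_zero_and_hess_nonneg_of_min hwC hz
    (fun y hy => by
      have := hle y hy
      linarith)
    (fun μ hμ hzb => by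
      rw [hsub, inner_sub_left, hs.neumann' hT htT' hzb hμ, hs.neumann' hT htT hzb hμ, sub_zero])
  rw [hsub, sub_eq_zero] at hG
  have hwle : wDet Ω (fun y => φ y t') z ≤ wDet Ω (fun y => φ y t) z := by
    refine wDet_le_wDet hΩ hC hC' hz hz (LinearIsometryEquiv.refl ℝ _) (fun _ => rfl) (a := 1)
      (by norm_num) (by simp) (fun X => hs.posDef hn hα hΩ hφ₀ htT' hz X) fun X _ => ?_
    have h1 := hH X
    unfold sphHess at h1
    rw [hΩ.sphGradDeriv_sub hC' hC hK, sub_apply, inner_sub_left] at h1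
    rw [show (LinearIsometryEquiv.refl ℝ (Amb n)) X = X from rfl]
    simp only [wForm, sphHess, hG]
    linarith
  have hflow := flowOp_le_of_wDet_le (Ω := Ω) hα (f := fun y => φ y t) (g := fun y => φ y t')
    (x := z) (y := z) (by rw [hG]) (hs.wDet_pos hn hα hΩ hφ₀ htT' hz) hwle
  rw [← hs.derivWithin_eq hn hα hΩ hφ₀ hT htT hz, ← hs.derivWithin_eq hn hα hΩ hφ₀ hT htT' hz]
    at hflow
  have hv' := hs.derivWithin_pos hn hα hΩ hφ₀ hT htT' hz
  have hder : HasDerivAt (fun s => ℓ - (φ z (s + ε * (s + τ)) - φ z s))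
      (-(derivWithin (φ z) (timeInterval T) t' * (1 + ε) - derivWithin (φ z) (timeInterval T) t))
      t := by
    have h1 : HasDerivAt (fun s => s + ε * (s + τ)) (1 + ε) t := by
      have h2 := (hasDerivAt_id' t).add (((hasDerivAt_id' t).add_const τ).const_mul ε)
      rwa [mul_one] at h2
    exact (((hs.hasDerivAt_time hz htT' ht'0).comp t h1).sub
      (hs.hasDerivAt_time hz htT ht)).const_sub ℓ
  have hnonneg := deriv_nonneg_of_first_time ht hder fun s h0 h1 => by
    rw [hzZ]
    exact hlt s h0 h1 z hz
  -- First contact gives (1+ε) φ_t(t') ≤ φ_t(t), while equal gradients and ordered determinants give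
  -- φ_t(t) ≤ e^{(1-α)ℓ} φ_t(t'). As φ_t(t') > 0, this contradicts the choice of ℓ.
  have hexp : Real.exp ((α - 1) * (φ z t - φ z t')) < 1 + ε := by
    rw [← Real.lt_log_iff_exp_lt (by linarith)]
    have h1 : φ z t - φ z t' = -ℓ := by linarith
    rw [h1]
    rw [lt_div_iff₀ hα'] at hℓ
    linarith
  nlinarith

/-- This is the derivative at ε = 0 of `log_le_sub_of_small`: (t + τ) φ_t ≥ 1/(1-α). -/
theorem speed_lower_bound (hn : 1 ≤ n) (hα : 0 < α) (hα₁ : α < 1)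
    (hΩ : IsStrictlyConvexSphericalDomain Ω) (hφ₀ : IsStrictlyConvexDatum Ω φ₀) (hT : 0 < T)
    {τ : ℝ} (hτ : 0 < τ) (hm : ∀ x ∈ closure Ω, 1 / ((1 - α) * τ) < flowOp α Ω φ₀ x)
    {t : ℝ} (ht : t ∈ timeInterval T) {x : Amb n} (hx : x ∈ closure Ω) :
    1 / ((1 - α) * (t + τ)) ≤ derivWithin (φ x) (timeInterval T) t := by
  have hα' : 0 < 1 - α := by linarith
  have ht0 : 0 ≤ t := ht.1
  obtain ⟨η, hη, hηT, hηm⟩ := hs.exists_speed_lower_bound_near_zero hn hα hΩ hφ₀ hT hm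
  have hline : ContinuousAt (fun ε : ℝ => t + ε * (t + τ)) 0 := by fun_prop
  have hev1 : ∀ᶠ ε : ℝ in 𝓝[>] 0, t + ε * (t + τ) ∈ timeInterval T := by
    have h1 : ∀ᶠ s : ℝ in 𝓝 (t + 0 * (t + τ)), (s : EReal) < T :=
      (continuous_coe_real_ereal.tendsto _).eventually (gt_mem_nhds (by simpa using ht.2))
    filter_upwards [nhdsWithin_le_nhds (hline.eventually h1), self_mem_nhdsWithin] with ε h2 h3
    have h3' : (0 : ℝ) < ε := h3
    exact ⟨by positivity, h2⟩
  have hev2 : ∀ᶠ ε : ℝ in 𝓝[>] 0, ε * τ ≤ η := by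
    filter_upwards [Ioo_mem_nhdsGT (div_pos hη hτ)] with ε hε
    exact ((lt_div_iff₀ hτ).1 hε.2).le
  by_contra! hneg
  set v := derivWithin (φ x) (timeInterval T) t with hv
  have hd1 : HasDerivWithinAt (fun ε : ℝ => φ x (t + ε * (t + τ))) (v * (t + τ)) (Ici 0) 0 := by
    have h1 : HasDerivWithinAt (fun ε : ℝ => t + ε * (t + τ)) (t + τ)
        {ε | t + ε * (t + τ) ∈ timeInterval T} 0 := by
      simpa using (((hasDerivAt_id (0 : ℝ)).mul_const (t + τ)).const_add t).hasDerivWithinAt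
    have h2 := (hs.differentiable_time x hx t ht).hasDerivWithinAt
    have h3 := HasDerivWithinAt.comp (0 : ℝ) (h₂ := φ x) (s' := timeInterval T) (h₂' := v)
      (by rw [zero_mul, add_zero]; exact h2) h1 fun ε hε => hε
    refine h3.mono_of_mem_nhdsWithin ?_
    rw [← Ioi_insert, nhdsWithin_insert]
    exact ⟨by simpa using ht, hev1⟩
  have hd2 : HasDerivWithinAt (fun ε : ℝ => Real.log (1 + ε) / (1 - α)) (1 / (1 - α)) (Ici 0) 0 := by
    have h1 : HasDerivAt (fun ε : ℝ => Real.log (1 + ε)) 1 0 := by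
      simpa using ((hasDerivAt_id (0 : ℝ)).const_add 1).log (by norm_num)
    exact (h1.div_const (1 - α)).hasDerivWithinAt
  have hlt : v * (t + τ) - 1 / (1 - α) < 0 := by
    rw [lt_div_iff₀ (by positivity)] at hneg
    rw [sub_neg, lt_div_iff₀ hα']
    linarith
  obtain ⟨ε, h1, h2, h3, h4⟩ := ((eventually_lt_of_hasDerivWithinAt_neg (hd1.sub hd2) hlt).and
    (hev1.and (hev2.and self_mem_nhdsWithin))).exists
  have h5 := hs.log_le_sub_of_small hn hα hα₁ hΩ hφ₀ hT hτ hηT hηm h4 h3 ht.1 h2 hx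
  simp at h1
  linarith

end IsSolution

/-! ### Two-point functions on the sphere -/

open InnerProductGeometry in
theorem angle_eq_arccos_inner {x y : Amb n} (hx : ‖x‖ = 1) (hy : ‖y‖ = 1) :
    angle x y = Real.arccos (inner ℝ x y) := by
  rw [angle, hx, hy, mul_one, div_one]

theorem norm_add_smul_sq {x v : Amb n} (hx : ‖x‖ = 1) (hv : inner ℝ x v = (0 : ℝ)) (s : ℝ) :
    ‖x + s • v‖ ^ 2 = 1 + s ^ 2 * ‖v‖ ^ 2 := by
  rw [norm_add_sq_real, inner_smul_right, hv, norm_smul, hx, mul_pow, Real.norm_eq_abs, sq_abs]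
  ring

theorem inner_mem_Ioo {x y : Amb n} (hx : ‖x‖ = 1) (hy : ‖y‖ = 1) (h1 : y ≠ x) (h2 : y ≠ -x) :
    (inner ℝ x y : ℝ) ∈ Ioo (-1 : ℝ) 1 := by
  constructor
  · have h3 : 0 < ‖x + y‖ ^ 2 := by
      have : x + y ≠ 0 := fun h => h2 (eq_neg_of_add_eq_zero_right h)
      positivity
    rw [norm_add_sq_real, hx, hy] at h3
    linarith
  · have h3 : 0 < ‖x - y‖ ^ 2 := by
      have : x - y ≠ 0 := fun h => h1 (sub_eq_zero.1 h).symm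
      positivity
    rw [norm_sub_sq_real, hx, hy] at h3
    linarith

theorem norm_sub_inner_smul_sq {x y : Amb n} (hx : ‖x‖ = 1) (hy : ‖y‖ = 1) :
    ‖y - (inner ℝ x y : ℝ) • x‖ ^ 2 = 1 - (inner ℝ x y : ℝ) ^ 2 := by
  rw [norm_sub_sq_real, inner_smul_right, real_inner_comm x y, norm_smul, hx, hy, mul_pow,
    Real.norm_eq_abs, sq_abs]
  ring

open InnerProductGeometry in
theorem hasDerivAt_angle_line {x y v : Amb n} (hx : ‖x‖ = 1) (hy : ‖y‖ = 1) (h1 : y ≠ x)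
    (h2 : y ≠ -x) (hv : inner ℝ x v = (0 : ℝ)) :
    HasDerivAt (fun s : ℝ => angle (x + s • v) y)
      (-(inner ℝ v y / √(1 - (inner ℝ x y : ℝ) ^ 2))) 0 := by
  obtain ⟨hc1, hc2⟩ := inner_mem_Ioo hx hy h1 h2
  have hrw : (fun s : ℝ => angle (x + s • v) y) = fun s : ℝ =>
      Real.arccos ((inner ℝ x y + s * inner ℝ v y) / √(1 + s ^ 2 * ‖v‖ ^ 2)) := by
    funext s
    rw [angle, hy, mul_one, inner_add_left, inner_smul_left, ← norm_add_smul_sq hx hv s,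
      Real.sqrt_sq (norm_nonneg _)]
    simp
  have hd1 : HasDerivAt (fun s : ℝ => (inner ℝ x y + s * inner ℝ v y : ℝ)) (inner ℝ v y) 0 := by
    simpa using ((hasDerivAt_id (0 : ℝ)).mul_const (inner ℝ v y : ℝ)).const_add (inner ℝ x y : ℝ)
  have hd2 : HasDerivAt (fun s : ℝ => √(1 + s ^ 2 * ‖v‖ ^ 2)) 0 0 := by
    have h3 : HasDerivAt (fun s : ℝ => 1 + s ^ 2 * ‖v‖ ^ 2) 0 0 := by
      simpa using (((hasDerivAt_id (0 : ℝ)).pow 2).mul_const (‖v‖ ^ 2)).const_add 1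
    simpa using h3.sqrt (by simp)
  have hd3 : HasDerivAt (fun s : ℝ => (inner ℝ x y + s * inner ℝ v y) / √(1 + s ^ 2 * ‖v‖ ^ 2))
      (inner ℝ v y) 0 := by
    have h3 := hd1.div hd2 (by simp)
    rw [show (inner ℝ v y * √(1 + (0 : ℝ) ^ 2 * ‖v‖ ^ 2) -
      (inner ℝ x y + 0 * inner ℝ v y) * 0) / √(1 + (0 : ℝ) ^ 2 * ‖v‖ ^ 2) ^ 2 = inner ℝ v y
      by simp] at h3
    exact h3
  rw [hrw]
  have hd4 := (Real.hasDerivAt_arccos hc1.ne' hc2.ne)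
  have hd5 := HasDerivAt.comp (0 : ℝ) (h₂ := Real.arccos)
    (h₂' := -(1 / √(1 - (inner ℝ x y : ℝ) ^ 2))) (by simpa using hd4) hd3
  have : -(inner ℝ v y / √(1 - (inner ℝ x y : ℝ) ^ 2)) =
      -(1 / √(1 - (inner ℝ x y : ℝ) ^ 2)) * inner ℝ v y := by ring
  rw [this]
  exact hd5

namespace IsStrictlyConvexSphericalDomain

variable (hΩ : IsStrictlyConvexSphericalDomain Ω)
include hΩ

open InnerProductGeometry

theorem mem_closure_of_norm_eq_one {x : Amb n} (hx : x ∈ closure (coneOver Ω)) (h1 : ‖x‖ = 1) :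
    x ∈ closure Ω := by
  refine (mem_coneOver_iff_of_norm_eq_one hΩ.closure_subset_sphere h1).1 ?_
  rw [hΩ.coneOver_closure]
  exact ⟨hx, by rintro rfl; simp at h1⟩

/-- Mean value inequality along the great circle arc γ. The arc stays in `closure Ω` because γ(s) =
(sin(θ-s) x + sin(s) y)/sin θ is a nonnegative combination of x and y. -/
theorem abs_sub_le_of_ne_neg {f : Amb n → ℝ}
    (hf : DifferentiableOn ℝ (radialExt f) (coneOver (closure Ω))) {L : ℝ}
    (hL : ∀ x ∈ closure Ω, ‖sphGrad Ω f x‖ ≤ L) {x y : Amb n} (hx : x ∈ closure Ω)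
    (hy : y ∈ closure Ω) (hne : y ≠ -x) : |f y - f x| ≤ L * angle x y := by
  have hx1 := hΩ.norm_eq_one hx
  have hy1 := hΩ.norm_eq_one hy
  rcases eq_or_ne y x with rfl | hyx
  · have : y ≠ 0 := by rintro rfl; simp at hx1
    simp [angle_self this]
  obtain ⟨hc1, hc2⟩ := inner_mem_Ioo hx1 hy1 hyx hne
  set c : ℝ := inner ℝ x y with hc
  set θ := angle x y with hθ
  have hcos : Real.cos θ = c := by
    rw [hθ, angle_eq_arccos_inner hx1 hy1, Real.cos_arccos hc1.le hc2.le]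
  have hθ0 : 0 ≤ θ := angle_nonneg x y
  have hθπ : θ ≤ Real.pi := angle_le_pi x y
  have hsin : 0 < Real.sin θ := by
    rw [hθ, angle_eq_arccos_inner hx1 hy1, Real.sin_arccos]
    exact Real.sqrt_pos.2 (by nlinarith)
  set e : Amb n := (Real.sin θ)⁻¹ • (y - c • x) with he
  have hxe : inner ℝ x e = (0 : ℝ) := by
    rw [he, inner_smul_right, inner_sub_right, inner_smul_right, inner_self_of_norm_eq_one hx1,
      ← hc]
    ring
  have hee : inner ℝ e e = (1 : ℝ) := by
    rw [real_inner_self_eq_norm_sq, he, norm_smul, mul_pow, norm_sub_inner_smul_sq hx1 hy1, ← hc,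
      ← hcos, norm_inv, Real.norm_of_nonneg hsin.le, ← Real.sin_sq]
    field_simp
  have hxx := inner_self_of_norm_eq_one hx1
  set γ : ℝ → Amb n := fun s => Real.cos s • x + Real.sin s • e with hγ
  set γ' : ℝ → Amb n := fun s => (-Real.sin s) • x + Real.cos s • e with hγ'
  have hnorm : ∀ a b : ℝ, ‖a • x + b • e‖ ^ 2 = a ^ 2 + b ^ 2 := by
    intro a b
    rw [← real_inner_self_eq_norm_sq]
    simp only [inner_add_left, inner_add_right, inner_smul_left, inner_smul_right, hxx, hxe, hee,
      real_inner_comm x e]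
    simp; ring
  have hγ1 : ∀ s, ‖γ s‖ = 1 := by
    intro s
    have := hnorm (Real.cos s) (Real.sin s)
    rw [Real.cos_sq_add_sin_sq] at this
    exact (pow_eq_one_iff_of_nonneg (norm_nonneg _) two_ne_zero).1 this
  have hγ'1 : ∀ s, ‖γ' s‖ = 1 := by
    intro s
    have := hnorm (-Real.sin s) (Real.cos s)
    rw [neg_sq, Real.sin_sq_add_cos_sq] at this
    exact (pow_eq_one_iff_of_nonneg (norm_nonneg _) two_ne_zero).1 this
  have hγd : ∀ s, HasDerivAt γ (γ' s) s := fun s =>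
    ((Real.hasDerivAt_cos s).smul_const x).add ((Real.hasDerivAt_sin s).smul_const e)
  have hγmem : ∀ s ∈ Icc 0 θ, γ s ∈ closure Ω := by
    intro s hs
    refine hΩ.mem_closure_of_norm_eq_one ?_ (hγ1 s)
    have h1 : γ s = (Real.sin θ)⁻¹ • (Real.sin (θ - s) • x + Real.sin s • y) := by
      rw [Real.sin_sub, hcos]
      simp only [hγ, he, smul_add, smul_sub, smul_smul, sub_smul]
      have h2 : (Real.sin θ)⁻¹ * (Real.sin θ * Real.cos s) = Real.cos s := by field_simp
      rw [h2, mul_comm (Real.sin s), mul_comm c (Real.sin s), ← mul_assoc, mul_right_comm]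
      module
    rw [h1]
    have hzero : ∀ (r : ℝ) (z : Amb n), 0 ≤ r → z ∈ closure (coneOver Ω) → ∀ w,
        w ∈ closure (coneOver Ω) → ∀ q : ℝ, 0 < q → r • z + q • w ∈ closure (coneOver Ω) := by
      intro r z hr hz w hw q hq
      rcases eq_or_lt_of_le hr with h | h
      · rw [← h, zero_smul, zero_add]; exact smul_mem_closure_cone hq hw
      · exact hΩ.add_mem_closure (smul_mem_closure_cone h hz) (smul_mem_closure_cone hq hw)
    apply smul_mem_closure_cone (inv_pos.2 hsin)
    rcases eq_or_lt_of_le hs.1 with h0 | h0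
    · have h2 : Real.sin (θ - s) • x + Real.sin s • y = Real.sin θ • x := by simp [← h0]
      rw [h2]
      exact smul_mem_closure_cone hsin (mem_closure_cone hx)
    · have hθlt : θ < Real.pi := by
        refine lt_of_le_of_ne hθπ fun h => ?_
        rw [h, Real.sin_pi] at hsin; exact lt_irrefl _ hsin
      exact hzero _ _ (Real.sin_nonneg_of_nonneg_of_le_pi (by linarith [hs.2])
        (by linarith)) (mem_closure_cone hx) _ (mem_closure_cone hy) _
        (Real.sin_pos_of_pos_of_lt_pi h0 (by linarith [hs.2]))
  have hderiv : ∀ s ∈ Icc 0 θ, HasDerivWithinAt (fun s => radialExt f (γ s))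
      (inner ℝ (sphGrad Ω f (γ s)) (γ' s)) (Icc 0 θ) s := fun s hs => by
    have hK := self_mem (hγmem s hs)
    exact (hasFDerivWithinAt (hf _ hK)).comp_hasDerivWithinAt s (hγd s).hasDerivWithinAt
      fun u hu => self_mem (hγmem u hu)
  have hbound := Convex.norm_image_sub_le_of_norm_hasDerivWithin_le (C := L) hderiv
    (fun s hs => by
      refine (norm_inner_le_norm _ _).trans ?_
      rw [hγ'1, mul_one]
      exact hL _ (hγmem s hs)) (convex_Icc 0 θ) (left_mem_Icc.2 hθ0) (right_mem_Icc.2 hθ0)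
  have hγ0 : γ 0 = x := by simp [hγ]
  have hγθ : γ θ = y := by
    simp only [hγ, he, smul_smul, mul_inv_cancel₀ hsin.ne', hcos]
    module
  rw [hγ0, hγθ, radialExt_of_norm_eq_one f hx1, radialExt_of_norm_eq_one f hy1, sub_zero,
    Real.norm_eq_abs, Real.norm_of_nonneg hθ0] at hbound
  exact hbound

theorem sub_le_mul_angle {f : Amb n → ℝ}
    (hf : DifferentiableOn ℝ (radialExt f) (coneOver (closure Ω))) {L : ℝ}
    (hL : ∀ x ∈ closure Ω, ‖sphGrad Ω f x‖ ≤ L) {x y : Amb n} (hx : x ∈ closure Ω)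
    (hy : y ∈ closure Ω) : f x - f y ≤ L * angle x y := by
  by_cases hne : y = -x
  -- No geodesic between antipodal points is distinguished, so the path goes through a point z of Ω;
  -- the two angles add up to π.
  · subst hne
    obtain ⟨z, hz⟩ := hΩ.nonempty
    have hzc := subset_closure hz
    have hx0 : x ≠ 0 := by rintro rfl; simpa using hΩ.norm_eq_one hx
    have hzx : z ≠ -x := by
      rintro rfl; exact hΩ.neg_notMem hz (by simpa using hx)
    have hzx' : -x ≠ -z := by
      intro h
      rw [neg_inj] at h
      exact hΩ.neg_notMem hz (h ▸ hy)
    have h1 := hΩ.abs_sub_le_of_ne_neg hf hL hx hzc hzx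
    have h2 := hΩ.abs_sub_le_of_ne_neg hf hL hzc hy hzx'
    rw [angle_neg_right, angle_comm z x] at h2
    rw [angle_self_neg_of_nonzero hx0]
    have h3 := neg_le_of_abs_le h1
    have h4 := neg_le_of_abs_le h2
    linarith
  · have := neg_le_of_abs_le (hΩ.abs_sub_le_of_ne_neg hf hL hx hy hne)
    linarith

variable {g : Amb n → ℝ} (hg : ContDiffOn ℝ 2 (radialExt g) (coneOver (closure Ω)))
include hg

/-- With a vanishing normal derivative, `g - A * angle · y` has no maximum at a boundary point. -/
theorem exists_gt_of_boundary {x y : Amb n} (hx : x ∈ sphBoundary Ω) (hy : y ∈ closure Ω)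
    (hxy : y ≠ x) (hN : ∀ μ, IsOutwardUnitNormal Ω x μ → inner ℝ (sphGrad Ω g x) μ = (0 : ℝ))
    {A : ℝ} (hA : 0 < A) :
    ∃ x' ∈ closure Ω, g x - A * angle x y < g x' - A * angle x' y := by
  obtain ⟨μ, hμ⟩ := hΩ.exists_normal hx
  have hx1 := hΩ.norm_eq_one hx.1
  have hy1 := hΩ.norm_eq_one hy
  have hK : x ∈ coneOver (closure Ω) := self_mem hx.1
  have hGx := inner_sphGrad_self hg hK
  have hGμ := hN μ hμ
  set G := sphGrad Ω g x with hG
  have finish : ∀ (v : Amb n) (a : ℝ), (∀ᶠ s in 𝓝[>] (0 : ℝ), x + s • v ∈ coneOver (closure Ω)) →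
      HasDerivWithinAt (fun s : ℝ => angle (x + s • v) y) a (Ici 0) 0 →
      0 < inner ℝ G v - A * a → ∃ x' ∈ closure Ω, g x - A * angle x y < g x' - A * angle x' y := by
    intro v a hv ha hpos
    have h1 := (hasDerivWithinAt_line hg hK hv).sub (ha.const_mul A)
    obtain ⟨s, hs1, hs2⟩ := ((eventually_gt_of_hasDerivWithinAt_pos h1 hpos).and hv).exists
    obtain ⟨hne, hmem⟩ := (mem_coneOver_iff hΩ.closure_subset_sphere).1 hs2
    refine ⟨_, hmem, ?_⟩
    rw [angle_smul_left_of_pos _ _ (inv_pos.2 (norm_pos_iff.2 hne))]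
    simp only [Pi.sub_apply, zero_smul, add_zero, radialExt_of_norm_eq_one g hx1] at hs1
    exact hs1
  by_cases hanti : y = -x
  -- The angle is not differentiable at the antipode. Here the gradient vanishes, because
  -- `eq_zero_of_neg_mem` leaves no tangent direction to ∂Ω, and moving towards any z in Ω decreases
  -- the angle to first order.
  · subst hanti
    have hG0 : G = 0 := hΩ.eq_zero_of_neg_mem hx hμ hy (by rw [real_inner_comm]; exact hGx)
      (by rw [real_inner_comm]; exact hGμ)
    obtain ⟨z, hz⟩ := hΩ.nonempty
    set v := z - (inner ℝ x z : ℝ) • x with hv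
    have hxv : inner ℝ x v = (0 : ℝ) := by
      rw [hv, inner_sub_right, inner_smul_right, inner_self_of_norm_eq_one hx1]; ring
    have hv0 : v ≠ 0 := by
      intro h0
      have h1 : z ≠ x := by rintro rfl; exact hx.2 hz
      have h2 : z ≠ -x := by rintro rfl; exact hΩ.neg_notMem hz (by simpa using hx.1)
      have h3 := norm_sub_inner_smul_sq hx1 (hΩ.norm_eq_one (subset_closure hz))
      obtain ⟨h4, h5⟩ := inner_mem_Ioo hx1 (hΩ.norm_eq_one (subset_closure hz)) h1 h2
      rw [← hv, h0, norm_zero] at h3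
      nlinarith
    have hc : ∀ᶠ s in 𝓝[>] (0 : ℝ), 0 < 1 - s * (inner ℝ x z : ℝ) := by
      have : ContinuousAt (fun s : ℝ => 1 - s * (inner ℝ x z : ℝ)) 0 := by fun_prop
      exact nhdsWithin_le_nhds (this.eventually (lt_mem_nhds (by simp)))
    have hx0 : x ≠ 0 := by rintro rfl; simp at hx1
    refine finish v (-‖v‖) ?_ ?_ ?_
    · filter_upwards [hc, self_mem_nhdsWithin] with s hs hs0
      have h1 : x + s • v = (1 - s * (inner ℝ x z : ℝ)) • x + s • z := by
        rw [hv]; module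
      rw [hΩ.coneOver_closure]
      refine ⟨?_, ?_⟩
      · rw [h1]
        exact hΩ.add_mem_closure (smul_mem_closure_cone hs (mem_closure_cone hx.1))
          (smul_mem_closure_cone hs0 (mem_closure_cone (subset_closure hz)))
      · intro h2
        have h3 := norm_add_smul_sq hx1 hxv s
        rw [show x + s • v = 0 from h2, norm_zero] at h3
        nlinarith [sq_nonneg s, sq_nonneg ‖v‖, mul_nonneg (sq_nonneg s) (sq_nonneg ‖v‖)]
    · have h1 : HasDerivAt (fun s : ℝ => Real.pi - Real.arctan (s * ‖v‖)) (-‖v‖) 0 := by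
        have h2 : HasDerivAt (fun s : ℝ => s * ‖v‖) ‖v‖ 0 := by
          simpa using (hasDerivAt_id (0 : ℝ)).mul_const ‖v‖
        simpa using h2.arctan.const_sub Real.pi
      refine h1.hasDerivWithinAt.congr (fun s hs => ?_) ?_
      · have hs0 : (0 : ℝ) ≤ s := hs
        rw [angle_neg_right, angle_comm, angle_add_eq_arctan_of_inner_eq_zero
          (by rw [inner_smul_right, hxv, mul_zero]) hx0, hx1, div_one, norm_smul,
          Real.norm_of_nonneg hs0]
      · simp [angle_self_neg_of_nonzero hx0]
    · rw [hG0, inner_zero_left]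
      have := norm_pos_iff.2 hv0
      nlinarith
  · obtain ⟨hc1, hc2⟩ := inner_mem_Ioo hx1 hy1 hxy hanti
    set c : ℝ := inner ℝ x y with hc
    have hσ : 0 < √(1 - c ^ 2) := Real.sqrt_pos.2 (by nlinarith)
    set σ := √(1 - c ^ 2) with hσd
    set e : Amb n := σ⁻¹ • (y - c • x) with he
    -- Here e is the unit tangent at x towards y, so v is the gradient of g - A angle(·, y) at x. It
    -- points strictly inward because G is orthogonal to μ and strict convexity gives ⟨μ, y⟩ < 0.
    -- The slope along v is |v|² > 0.
    set v := G + A • e with hv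
    have hμx := hΩ.inner_normal_self hx hμ
    have hμy := hΩ.inner_normal_neg hx hμ hy hxy hanti
    have hμv : inner ℝ μ v < (0 : ℝ) := by
      rw [hv, inner_add_right, real_inner_comm, hGμ, inner_smul_right, he, inner_smul_right,
        inner_sub_right, inner_smul_right, hμx, mul_zero, sub_zero, zero_add]
      exact mul_neg_of_pos_of_neg hA (mul_neg_of_pos_of_neg (inv_pos.2 hσ) hμy)
    have hxv : inner ℝ x v = (0 : ℝ) := by
      rw [hv, inner_add_right, real_inner_comm, hGx, inner_smul_right, he, inner_smul_right,
        inner_sub_right, inner_smul_right, inner_self_of_norm_eq_one hx1, ← hc]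
      ring
    refine finish v _ ((hΩ.eventually_mem hx hμ hμv).mono fun s hs => coneOver_subset_closure hs)
      (hasDerivAt_angle_line hx1 hy1 hxy hanti hxv).hasDerivWithinAt ?_
    have h1 : (inner ℝ v y / √(1 - (inner ℝ x y : ℝ) ^ 2) : ℝ) = inner ℝ e v := by
      rw [he, inner_smul_left, inner_sub_left, inner_smul_left, hxv, real_inner_comm y v, ← hc,
        ← hσd]
      simp; ring
    have h2 : (inner ℝ G v : ℝ) - A * -(inner ℝ v y / √(1 - (inner ℝ x y : ℝ) ^ 2)) =
        inner ℝ v v := by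
      rw [h1]
      conv_rhs => rw [hv, inner_add_left, inner_smul_left, ← hv]
      simp
    rw [h2]
    refine real_inner_self_pos.2 ?_
    intro h0
    rw [h0, inner_zero_right] at hμv
    exact lt_irrefl _ hμv

end IsStrictlyConvexSphericalDomain

namespace IsStrictlyConvexSphericalDomain

open InnerProductGeometry

/-- First and second order comparison at an interior maximum of the two-point function
`f x - f y - A * angle x y`: vary both points simultaneously in directions that correspond under
the reflection that exchanges `x` and `-y`. -/
theorem comparison_of_two_point_max (hΩ : IsStrictlyConvexSphericalDomain Ω) {f : Amb n → ℝ}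
    (hf : ContDiffOn ℝ 2 (radialExt f) (coneOver (closure Ω))) {x y : Amb n} (hx : x ∈ Ω)
    (hy : y ∈ Ω) (hxy : y ≠ x) {A : ℝ} (hA : 0 ≤ A)
    (hmax : ∀ x' ∈ closure Ω, ∀ y' ∈ closure Ω,
      f x' - f y' - A * angle x' y' ≤ f x - f y - A * angle x y)
    (hpos : ∀ X : Amb n, inner ℝ y X = (0 : ℝ) → X ≠ 0 → 0 < wForm Ω f y X X) :
    ‖sphGrad Ω f x‖ = ‖sphGrad Ω f y‖ ∧ wDet Ω f y ≤ wDet Ω f x := by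
  have hxc := subset_closure hx
  have hyc := subset_closure hy
  have hx1 := hΩ.norm_eq_one hxc
  have hy1 := hΩ.norm_eq_one hyc
  have hne : y ≠ -x := by rintro rfl; exact hΩ.neg_notMem hx hyc
  obtain ⟨hc1, hc2⟩ := inner_mem_Ioo hx1 hy1 hxy hne
  set c : ℝ := inner ℝ x y with hc
  set u : Amb n := x - -y with hu
  -- On x^⊥ this is parallel transport along the geodesic from x to y: it fixes what is orthogonal
  -- to x and y, and sends the unit tangent at x to the one at y.
  set S : Amb n ≃ₗᵢ[ℝ] Amb n := (ℝ ∙ u)ᗮ.reflection with hS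
  have hSS : ∀ X, S (S X) = X := fun X => Submodule.reflection_reflection _ X
  have hSx : S x = -y := Submodule.reflection_sub (by rw [norm_neg, hx1, hy1])
  have hSy : S y = -x := by
    have := hSS x
    rw [hSx, map_neg] at this
    rw [← this, neg_neg]
  have hSadj : ∀ X Y, (inner ℝ (S X) Y : ℝ) = inner ℝ X (S Y) := fun X Y => by
    rw [← S.inner_map_map X (S Y), hSS]
  have hyS : ∀ X, inner ℝ x X = (0 : ℝ) → inner ℝ y (S X) = (0 : ℝ) := by
    intro X hX
    rw [← hSadj, hSy, inner_neg_left, hX, neg_zero]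
  have hinner : ∀ X, inner ℝ x X = (0 : ℝ) → c * ‖X‖ ^ 2 ≤ (inner ℝ X (S X) : ℝ) := by
    intro X hX
    have h1 : ‖u‖ ^ 2 = 2 * (1 + c) := by
      rw [hu, sub_neg_eq_add, norm_add_sq_real, hx1, hy1]; ring
    have h2 : inner ℝ u X = (inner ℝ y X : ℝ) := by
      rw [hu, sub_neg_eq_add, inner_add_left, hX, zero_add]
    have h3 : (inner ℝ X (S X) : ℝ) = ‖X‖ ^ 2 - (inner ℝ y X : ℝ) ^ 2 / (1 + c) := by
      rw [hS, Submodule.reflection_orthogonal_apply, Submodule.reflection_singleton_apply,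
        inner_neg_right, inner_sub_right, real_inner_self_eq_norm_sq, two_smul, inner_add_right,
        inner_smul_right, real_inner_comm u X, h2]
      have h4 : ((‖u‖ : ℝ) : ℝ) ^ 2 = 2 * (1 + c) := h1
      simp only [RCLike.ofReal_real_eq_id, id_eq, h4]
      have : 1 + c ≠ 0 := by linarith
      field_simp
      ring
    have h5 : (inner ℝ y X : ℝ) ^ 2 ≤ (1 - c ^ 2) * ‖X‖ ^ 2 := by
      have h6 : (inner ℝ (y - c • x) X : ℝ) = inner ℝ y X := by
        rw [inner_sub_left, inner_smul_left, hX]; simp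
      rw [← norm_sub_inner_smul_sq hx1 hy1, ← h6, ← mul_pow, ← sq_abs]
      exact pow_le_pow_left₀ (abs_nonneg _) (abs_real_inner_le_norm _ _) 2
    rw [h3, le_sub_iff_add_le, ← le_sub_iff_add_le', div_le_iff₀ (by linarith)]
    nlinarith
  -- Both points acquire the same norm, and their inner product c + s²⟨X, S X⟩ is at least c(1 +
  -- s²|X|²). The inequality is exact, so no second derivative of the angle is needed.
  have hangle : ∀ X, inner ℝ x X = (0 : ℝ) → ∀ s : ℝ,
      angle (x + s • X) (y + s • S X) ≤ angle x y := by
    intro X hX s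
    have h1 := norm_add_smul_sq hx1 hX s
    have h2 := norm_add_smul_sq hy1 (hyS X hX) s
    rw [S.norm_map, ← h1] at h2
    have h3 := (pow_left_inj₀ (norm_nonneg _) (norm_nonneg _) two_ne_zero).1 h2
    have hpos1 : 0 < 1 + s ^ 2 * ‖X‖ ^ 2 := by positivity
    rw [angle_eq_arccos_inner hx1 hy1, angle, h3, ← sq, h1]
    apply Real.arccos_le_arccos
    rw [le_div_iff₀ hpos1]
    have h4 : (inner ℝ (x + s • X) (y + s • S X) : ℝ) = c + s ^ 2 * inner ℝ X (S X) := by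
      have h5 : (inner ℝ x (S X) : ℝ) = -inner ℝ X y := by
        rw [← hSadj, hSx, inner_neg_left, real_inner_comm]
      simp only [inner_add_left, inner_add_right, inner_smul_left, inner_smul_right, h5, ← hc]
      simp; ring
    rw [h4]
    nlinarith [hinner X hX, sq_nonneg s, mul_le_mul_of_nonneg_left (hinner X hX) (sq_nonneg s)]
  have hxK : x ∈ coneOver (closure Ω) := self_mem hxc
  have hyK : y ∈ coneOver (closure Ω) := self_mem hyc
  have hlx : ∀ X, ∀ᶠ s in 𝓝[>] (0 : ℝ), x + s • X ∈ coneOver Ω := fun X =>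
    (tendsto_line x X).eventually (hΩ.isOpen_cone.mem_nhds (subset_coneOver _ hx))
  have hly : ∀ X, ∀ᶠ s in 𝓝[>] (0 : ℝ), y + s • X ∈ coneOver Ω := fun X =>
    (tendsto_line y X).eventually (hΩ.isOpen_cone.mem_nhds (subset_coneOver _ hy))
  have hle : ∀ X, inner ℝ x X = (0 : ℝ) → ∀ᶠ s in 𝓝[>] (0 : ℝ),
      radialExt f (x + s • X) - radialExt f (y + s • S X) ≤ f x - f y := by
    intro X hX
    filter_upwards [hlx X, hly (S X)] with s h1 h2
    obtain ⟨h3, h4⟩ := (mem_coneOver_iff hΩ.subset_sphere).1 h1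
    obtain ⟨h5, h6⟩ := (mem_coneOver_iff hΩ.subset_sphere).1 h2
    have h7 := hmax _ (subset_closure h4) _ (subset_closure h6)
    rw [angle_smul_left_of_pos _ _ (inv_pos.2 (norm_pos_iff.2 h3)),
      angle_smul_right_of_pos _ _ (inv_pos.2 (norm_pos_iff.2 h5))] at h7
    have h8 := mul_le_mul_of_nonneg_left (hangle X hX s) hA
    unfold radialExt
    linarith
  have hcl : ∀ {z : Amb n} {X}, (∀ᶠ s in 𝓝[>] (0 : ℝ), z + s • X ∈ coneOver Ω) →
      ∀ᶠ s in 𝓝[>] (0 : ℝ), z + s • X ∈ coneOver (closure Ω) := fun h =>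
    h.mono fun s hs => coneOver_subset_closure hs
  have hd : ∀ X, HasDerivWithinAt
      (fun s : ℝ => radialExt f (x + s • X) - radialExt f (y + s • S X))
      (inner ℝ (sphGrad Ω f x) X - inner ℝ (sphGrad Ω f y) (S X)) (Ici 0) 0 := fun X =>
    (hasDerivWithinAt_line hf hxK (hcl (hlx X))).sub
      (hasDerivWithinAt_line hf hyK (hcl (hly (S X))))
  have hfirst_le : ∀ X, inner ℝ x X = (0 : ℝ) →
      (inner ℝ (sphGrad Ω f x) X - inner ℝ (sphGrad Ω f y) (S X) : ℝ) ≤ 0 := by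
    intro X hX
    by_contra! h
    obtain ⟨s, h1, h2⟩ := ((eventually_gt_of_hasDerivWithinAt_pos (hd X) h).and (hle X hX)).exists
    simp only [zero_smul, add_zero, radialExt_of_norm_eq_one f hx1,
      radialExt_of_norm_eq_one f hy1] at h1
    linarith
  have hfirst : ∀ X, inner ℝ x X = (0 : ℝ) →
      (inner ℝ (sphGrad Ω f x) X - inner ℝ (sphGrad Ω f y) (S X) : ℝ) = 0 := by
    intro X hX
    have h1 := hfirst_le X hX
    have h2 := hfirst_le (-X) (by rw [inner_neg_right, hX, neg_zero])
    rw [map_neg, inner_neg_right, inner_neg_right] at h2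
    linarith
  have hsecond : ∀ X, inner ℝ x X = (0 : ℝ) →
      sphHess Ω f x X X - sphHess Ω f y (S X) (S X) ≤ 0 := by
    intro X hX
    by_contra! h
    have h1 := (hΩ.hasDerivWithinAt_sphGrad_line hf hxK (hcl (hlx X))).sub
      (hΩ.hasDerivWithinAt_sphGrad_line hf hyK (hcl (hly (S X))))
    have h2 : ∀ᶠ s in 𝓝[>] (0 : ℝ), HasDerivAt
        (fun s : ℝ => radialExt f (x + s • X) - radialExt f (y + s • S X))
        (inner ℝ (sphGrad Ω f (x + s • X)) X - inner ℝ (sphGrad Ω f (y + s • S X)) (S X)) s := by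
      filter_upwards [hΩ.eventually_hasDerivAt_line hf (hlx X),
        hΩ.eventually_hasDerivAt_line hf (hly (S X))] with s h3 h4 using h3.sub h4
    obtain ⟨s, h3, h4⟩ := ((eventually_gt_of_second_deriv_pos (hd X).continuousWithinAt h2 h1
      (by simpa using hfirst X hX) h).and (hle X hX)).exists
    simp only [zero_smul, add_zero, radialExt_of_norm_eq_one f hx1,
      radialExt_of_norm_eq_one f hy1] at h3
    linarith
  have hG : sphGrad Ω f x = S (sphGrad Ω f y) := by
    set X := sphGrad Ω f x - S (sphGrad Ω f y) with hX
    have hxX : inner ℝ x X = (0 : ℝ) := by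
      rw [hX, inner_sub_right, real_inner_comm, inner_sphGrad_self hf hxK, ← hSadj, hSx,
        inner_neg_left, real_inner_comm, inner_sphGrad_self hf hyK]
      simp
    have h1 := hfirst X hxX
    rw [← hSadj, ← inner_sub_left, ← hX] at h1
    exact sub_eq_zero.1 (inner_self_eq_zero.1 h1)
  refine ⟨by rw [hG, S.norm_map], ?_⟩
  -- The first order condition equates the gradient terms of the two forms, and the second order
  -- condition orders their Hessian terms.
  refine wDet_le_wDet hΩ hf hf hxc hyc S hSS (a := -1) (by norm_num) (by rw [hSx, neg_one_smul])
    hpos fun X hX => ?_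
  have h1 := hfirst X hX
  have h2 := hsecond X hX
  unfold wForm
  rw [S.inner_map_map, ← sub_eq_zero.1 h1]
  linarith

/-- At interior points, move along the gradient G: the angle is arctan(s|G|), so f grows at rate
|G|² and the bound at rate A|G|. Boundary points follow by continuity. -/
theorem norm_sphGrad_le_of_sub_le (hΩ : IsStrictlyConvexSphericalDomain Ω) {f : Amb n → ℝ}
    (hf : ContDiffOn ℝ 2 (radialExt f) (coneOver (closure Ω))) {A : ℝ}
    (hA : ∀ x ∈ closure Ω, ∀ y ∈ closure Ω, f x - f y ≤ A * angle x y) {x : Amb n}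
    (hx : x ∈ closure Ω) (hA0 : 0 ≤ A) : ‖sphGrad Ω f x‖ ≤ A := by
  refine le_on_closure (s := Ω) (f := fun x => ‖sphGrad Ω f x‖) (g := fun _ => A) ?_
    ((hΩ.contDiffOn_sphGrad hf).continuousOn.mono (subset_coneOver _)).norm continuousOn_const hx
  intro x hx
  have hxc := subset_closure hx
  have hx1 := hΩ.norm_eq_one hxc
  have hK : x ∈ coneOver (closure Ω) := self_mem hxc
  set G := sphGrad Ω f x with hG
  by_contra! hlt
  have hx0 : x ≠ 0 := by rintro rfl; simp at hx1
  have hv : ∀ᶠ s in 𝓝[>] (0 : ℝ), x + s • G ∈ coneOver Ω :=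
    (tendsto_line x G).eventually (hΩ.isOpen_cone.mem_nhds (subset_coneOver _ hx))
  have h1 := hasDerivWithinAt_line hf hK (hv.mono fun s hs => coneOver_subset_closure hs)
  have h2 : HasDerivAt (fun s : ℝ => Real.arctan (s * ‖G‖)) ‖G‖ 0 := by
    have h2 : HasDerivAt (fun s : ℝ => s * ‖G‖) ‖G‖ 0 := by
      simpa using (hasDerivAt_id (0 : ℝ)).mul_const ‖G‖
    simpa using h2.arctan
  have h3 := h1.sub (h2.hasDerivWithinAt.const_mul A)
  have hpos : 0 < (inner ℝ (sphGrad Ω f x) G - A * ‖G‖ : ℝ) := by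
    rw [← hG, real_inner_self_eq_norm_sq]; nlinarith
  obtain ⟨s, h4, h5, h6⟩ := ((eventually_gt_of_hasDerivWithinAt_pos h3 hpos).and
    (hv.and self_mem_nhdsWithin)).exists
  have hs : (0 : ℝ) < s := h6
  obtain ⟨h7, h8⟩ := (mem_coneOver_iff hΩ.subset_sphere).1 h5
  have h9 := hA _ (subset_closure h8) x hxc
  have hGx : inner ℝ x G = (0 : ℝ) := by
    rw [real_inner_comm]; exact inner_sphGrad_self hf hK
  rw [angle_smul_left_of_pos _ _ (inv_pos.2 (norm_pos_iff.2 h7)), angle_comm,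
    angle_add_eq_arctan_of_inner_eq_zero (by rw [inner_smul_right, hGx, mul_zero]) hx0, hx1,
    div_one, norm_smul, Real.norm_of_nonneg hs.le] at h9
  simp only [Pi.sub_apply, zero_smul, add_zero, zero_mul, Real.arctan_zero, mul_zero, sub_zero,
    radialExt_of_norm_eq_one f hx1] at h4
  unfold radialExt at h4
  linarith

end IsStrictlyConvexSphericalDomain

/-! ### The rescaled time -/

theorem rescaledTime_base_pos {α c t : ℝ} (hα₁ : α < 1) (ht : 0 ≤ t) :
    0 < (1 - α) * t + Real.exp ((1 - α) * c) := by
  have : 0 < 1 - α := by linarith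
  positivity

theorem hasDerivAt_log_base {α c t : ℝ} (hα₁ : α < 1) (ht : 0 ≤ t) :
    HasDerivAt (fun t => Real.log ((1 - α) * t + Real.exp ((1 - α) * c)) / (1 - α) - c)
      (1 / ((1 - α) * t + Real.exp ((1 - α) * c))) t := by
  have hα' : 0 < 1 - α := by linarith
  have hb := rescaledTime_base_pos (c := c) hα₁ ht
  have h1 : HasDerivAt (fun t => (1 - α) * t + Real.exp ((1 - α) * c)) (1 - α) t := by
    simpa using ((hasDerivAt_id t).const_mul (1 - α)).add_const (Real.exp ((1 - α) * c))
  have h2 := ((h1.log hb.ne').div_const (1 - α)).sub_const c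
  have h3 : (1 - α) / ((1 - α) * t + Real.exp ((1 - α) * c)) / (1 - α) =
      1 / ((1 - α) * t + Real.exp ((1 - α) * c)) := by field_simp
  rwa [h3] at h2

/-- The exponents cancel to Θ^{α-1} = 1/((1-α)t + e^{(1-α)c}), the same decay in t as in the lower
bound for the speed. -/
theorem rescaledTime_eq {α c t : ℝ} (hα₁ : α < 1) (ht : 0 ≤ t) : rescaledTime α c t =
    Real.log ((1 - α) * t + Real.exp ((1 - α) * c)) / (1 - α) - c := by
  have hα' : 0 < 1 - α := by linarith
  have hcongr : ∀ τ ∈ uIcc 0 t, Theta α c τ ^ (α - 1) =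
      1 / ((1 - α) * τ + Real.exp ((1 - α) * c)) := by
    intro τ hτ
    rw [uIcc_of_le ht] at hτ
    have hb := rescaledTime_base_pos (c := c) hα₁ hτ.1
    rw [Theta, ← Real.rpow_mul hb.le]
    have : 1 / (1 - α) * (α - 1) = -1 := by field_simp; ring
    rw [this, Real.rpow_neg_one, one_div]
  rw [rescaledTime, intervalIntegral.integral_congr hcongr,
    intervalIntegral.integral_eq_sub_of_hasDerivAt
      (f := fun t => Real.log ((1 - α) * t + Real.exp ((1 - α) * c)) / (1 - α) - c)
      (fun τ hτ => hasDerivAt_log_base hα₁ (by rw [uIcc_of_le ht] at hτ; exact hτ.1))]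
  · simp only [mul_zero, zero_add, Real.log_exp]
    field_simp
    ring
  · apply ContinuousOn.intervalIntegrable
    intro τ hτ
    rw [uIcc_of_le ht] at hτ
    have hb := rescaledTime_base_pos (c := c) hα₁ hτ.1
    refine ContinuousAt.continuousWithinAt (ContinuousAt.div (by fun_prop) (by fun_prop) hb.ne')

theorem rescaledTime_zero (α c : ℝ) : rescaledTime α c 0 = 0 := by simp [rescaledTime]

theorem rescaledTime_nonneg {α c t : ℝ} (hα₁ : α < 1) (ht : 0 ≤ t) : 0 ≤ rescaledTime α c t := by
  have hα' : 0 < 1 - α := by linarith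
  rw [rescaledTime_eq hα₁ ht, sub_nonneg, le_div_iff₀ hα']
  rw [Real.le_log_iff_exp_le (rescaledTime_base_pos hα₁ ht), mul_comm c]
  have := mul_nonneg hα'.le ht
  linarith

/-! ### The two-point estimate -/

namespace IsSolution

open InnerProductGeometry

variable {α : ℝ} {T : EReal} {φ₀ : Amb n → ℝ} {φ : Amb n → ℝ → ℝ}
  (hs : IsSolution α Ω T φ₀ φ)
include hs

/-- The δ in the slope keeps it positive when L = 0, as the boundary argument needs. The additive δ
makes the initial inequality strict and keeps the contact point off the diagonal. Hypothesis `hlq`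
says that the gap closes faster than the barrier; its range for Δ comes from δ ≤ 1 and angles at
most π. -/
theorem sub_lt_two_point (hn : 1 ≤ n) (hα : 0 < α) (hα₁ : α < 1)
    (hΩ : IsStrictlyConvexSphericalDomain Ω) (hφ₀ : IsStrictlyConvexDatum Ω φ₀) (hT : 0 < T)
    {L q c lam δ : ℝ} (hL0 : 0 ≤ L) (hL : ∀ x ∈ closure Ω, ‖sphGrad Ω φ₀ x‖ ≤ L)
    (hlam : 0 < lam) (hδ : 0 < δ) (hδ1 : δ ≤ 1)
    (hq : ∀ t ∈ timeInterval T, ∀ x ∈ closure Ω, q / ((1 - α) * t + Real.exp ((1 - α) * c)) ≤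
      derivWithin (φ x) (timeInterval T) t)
    (hlq : ∀ Δ, 0 < Δ → Δ ≤ (L + 1) * Real.pi + 1 →
      lam * Δ < q * (1 - Real.exp ((α - 1) * Δ)))
    {t : ℝ} (ht : t ∈ timeInterval T) {x y : Amb n} (hx : x ∈ closure Ω) (hy : y ∈ closure Ω) :
    φ x t - φ y t <
      Real.exp (-lam * rescaledTime α c t) * ((L + δ) * angle x y + δ) := by
  by_contra! hneg
  set σ : ℝ → ℝ := fun t => Real.log ((1 - α) * t + Real.exp ((1 - α) * c)) / (1 - α) - c with hσ
  have hσeq : ∀ s, 0 ≤ s → rescaledTime α c s = σ s := fun s h => rescaledTime_eq hα₁ h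
  have hσd : ∀ s, 0 ≤ s → HasDerivAt σ (1 / ((1 - α) * s + Real.exp ((1 - α) * c))) s :=
    fun s h => hasDerivAt_log_base hα₁ h
  rw [hσeq t ht.1] at hneg
  have hangle_cont : ContinuousOn (fun p : (Amb n × Amb n) × ℝ => angle p.1.1 p.1.2)
      ((closure Ω ×ˢ closure Ω) ×ˢ Icc 0 t) := by
    have : ContinuousOn (fun p : (Amb n × Amb n) × ℝ => Real.arccos (inner ℝ p.1.1 p.1.2))
        ((closure Ω ×ˢ closure Ω) ×ˢ Icc 0 t) := by fun_prop
    exact this.congr fun p hp => angle_eq_arccos_inner (hΩ.norm_eq_one hp.1.1)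
      (hΩ.norm_eq_one hp.1.2)
  have hσc : ContinuousOn (fun p : (Amb n × Amb n) × ℝ => σ p.2)
      ((closure Ω ×ˢ closure Ω) ×ˢ Icc 0 t) :=
    ContinuousOn.comp (g := σ) (t := Icc 0 t)
      (fun s hs => (hσd s hs.1).continuousAt.continuousWithinAt) (by fun_prop) fun p hp => hp.2
  have hcont : ContinuousOn (fun p : (Amb n × Amb n) × ℝ => φ p.1.1 p.2 - φ p.1.2 p.2 -
      Real.exp (-lam * σ p.2) * ((L + δ) * angle p.1.1 p.1.2 + δ))
      ((closure Ω ×ˢ closure Ω) ×ˢ Icc 0 t) := by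
    have h1 := hs.continuous.comp (f := fun p : (Amb n × Amb n) × ℝ => (p.1.1, p.2))
      (s := (closure Ω ×ˢ closure Ω) ×ˢ Icc 0 t) (by fun_prop)
      fun p hp => ⟨hp.1.1, timeInterval_Icc_subset ht hp.2⟩
    have h2 := hs.continuous.comp (f := fun p : (Amb n × Amb n) × ℝ => (p.1.2, p.2))
      (s := (closure Ω ×ˢ closure Ω) ×ˢ Icc 0 t) (by fun_prop)
      fun p hp => ⟨hp.1.2, timeInterval_Icc_subset ht hp.2⟩
    exact (h1.sub h2).sub ((Real.continuous_exp.comp_continuousOn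
      (continuousOn_const.mul hσc)).mul ((continuousOn_const.mul hangle_cont).add
        continuousOn_const))
  have hσ0 : σ 0 = 0 := by rw [← hσeq 0 le_rfl, rescaledTime_zero]
  obtain ⟨t₁, ht₁, htt₁, ⟨⟨z, w⟩, ⟨hz, hw⟩, hZ⟩, hle, hlt⟩ := exists_first_time
    (hΩ.isCompact_closure.prod hΩ.isCompact_closure)
    (Z := fun p s => φ p.1 s - φ p.2 s -
      Real.exp (-lam * σ s) * ((L + δ) * angle p.1 p.2 + δ)) ht.1 hcont
    (fun p hp => by
      have h1 := hΩ.sub_le_mul_angle (hφ₀.contDiff.differentiableOn (by norm_num)) hL hp.1 hp.2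
      have h2 := angle_nonneg p.1 p.2
      simp only [hs.initial _ hp.1, hs.initial _ hp.2, hσ0, mul_zero, Real.exp_zero, one_mul]
      nlinarith) ⟨(x, y), ⟨hx, hy⟩, by linarith⟩
  simp only at hZ
  have hT₁ : t₁ ∈ timeInterval T := timeInterval_Icc_subset ht ⟨ht₁.le, htt₁⟩
  have hC := hs.contDiff_space t₁ hT₁
  set F := Real.exp (-lam * σ t₁) with hF
  have hF0 : 0 < F := Real.exp_pos _
  have hF1 : F ≤ 1 := by
    rw [hF, Real.exp_le_one_iff]
    have := rescaledTime_nonneg (c := c) hα₁ ht₁.le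
    rw [hσeq t₁ ht₁.le] at this
    nlinarith
  have hLδ : 0 < L + δ := by linarith
  have hA : 0 < F * (L + δ) := mul_pos hF0 hLδ
  have hang0 := angle_nonneg z w
  have hangπ := angle_le_pi z w
  have hwz : w ≠ z := by
    rintro rfl
    have : 0 < F * ((L + δ) * angle w w + δ) := by positivity
    linarith
  have hmax : ∀ x' ∈ closure Ω, ∀ y' ∈ closure Ω,
      φ x' t₁ - φ y' t₁ - F * (L + δ) * angle x' y' ≤
        φ z t₁ - φ w t₁ - F * (L + δ) * angle z w := by
    intro x' hx' y' hy'
    have := hle (x', y') ⟨hx', hy'⟩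
    simp only at this
    linarith
  have hzΩ : z ∈ Ω := by
    by_contra hzb
    obtain ⟨x', hx', h1⟩ := hΩ.exists_gt_of_boundary hC ⟨hz, hzb⟩ hw hwz
      (fun μ hμ => hs.neumann' hT hT₁ ⟨hz, hzb⟩ hμ) hA
    have := hmax x' hx' w hw
    linarith
  have hwΩ : w ∈ Ω := by
    by_contra hwb
    have hK : w ∈ coneOver (closure Ω) := subset_coneOver _ hw
    obtain ⟨y', hy', h1⟩ := hΩ.exists_gt_of_boundary (g := fun y => -φ y t₁) hC.neg ⟨hw, hwb⟩ hz
      hwz.symm (fun μ hμ => by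
        rw [hΩ.sphGrad_neg (hC.differentiableOn (by norm_num)) hK, inner_neg_left,
          hs.neumann' hT hT₁ ⟨hw, hwb⟩ hμ, neg_zero]) hA
    have := hmax z hz y' hy'
    rw [angle_comm w z, angle_comm y' z] at h1
    linarith
  obtain ⟨hGG, hWW⟩ := hΩ.comparison_of_two_point_max hC hzΩ hwΩ hwz hA.le hmax
    (fun X => hs.posDef hn hα hΩ hφ₀ hT₁ hw X)
  have hflow := flowOp_le_of_wDet_le (Ω := Ω) hα hGG (hs.wDet_pos hn hα hΩ hφ₀ hT₁ hw) hWW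
  rw [← hs.derivWithin_eq hn hα hΩ hφ₀ hT hT₁ hz, ← hs.derivWithin_eq hn hα hΩ hφ₀ hT hT₁ hw]
    at hflow
  set Δ := F * ((L + δ) * angle z w + δ) with hΔ
  have hΔ0 : 0 < Δ := by positivity
  have hΔD : Δ ≤ (L + 1) * Real.pi + 1 := by
    have h1 : Δ ≤ 1 * ((L + δ) * angle z w + δ) := by
      rw [hΔ]; gcongr
    have h2 : (L + δ) * angle z w ≤ (L + 1) * Real.pi := by gcongr
    linarith
  have hΔeq : φ z t₁ - φ w t₁ = Δ := by linarith
  rw [hΔeq] at hflow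
  have hb := rescaledTime_base_pos (c := c) hα₁ ht₁.le
  have hder : HasDerivAt (fun s => φ z s - φ w s -
      Real.exp (-lam * σ s) * ((L + δ) * angle z w + δ))
      (derivWithin (φ z) (timeInterval T) t₁ - derivWithin (φ w) (timeInterval T) t₁ -
        F * (-lam * (1 / ((1 - α) * t₁ + Real.exp ((1 - α) * c)))) *
          ((L + δ) * angle z w + δ)) t₁ :=
    ((hs.hasDerivAt_time hz hT₁ ht₁).sub (hs.hasDerivAt_time hw hT₁ ht₁)).sub
      ((((hσd t₁ ht₁.le).const_mul (-lam)).exp).mul_const _)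
  have hnonneg := deriv_nonneg_of_first_time ht₁ hder fun s h0 h1 => by
    have := hlt s h0 h1 (z, w) ⟨hz, hw⟩
    rw [hZ]
    exact this
  set B := (1 - α) * t₁ + Real.exp ((1 - α) * c) with hB
  have h1 : F * (-lam * (1 / B)) * ((L + δ) * angle z w + δ) = -(lam * Δ / B) := by
    rw [hΔ]; ring
  rw [h1] at hnonneg
  have h2 := hq t₁ hT₁ w hw
  -- The gap Δ changes at a rate of at most -(q/B)(1 - e^{(α-1)Δ}), which is strictly below the rate
  -- -λΔ/B of the barrier. This contradicts first contact.
  have h3 : 0 < 1 - Real.exp ((α - 1) * Δ) := by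
    rw [sub_pos, Real.exp_lt_one_iff]
    nlinarith
  have h4 := mul_le_mul_of_nonneg_right h2 h3.le
  have h5 : lam * Δ / B < q / B * (1 - Real.exp ((α - 1) * Δ)) := by
    rw [div_mul_eq_mul_div]
    exact div_lt_div_of_pos_right (hlq Δ hΔ0 hΔD) hb
  linarith

theorem norm_sphGrad_le (hn : 1 ≤ n) (hα : 0 < α) (hα₁ : α < 1)
    (hΩ : IsStrictlyConvexSphericalDomain Ω) (hφ₀ : IsStrictlyConvexDatum Ω φ₀) (hT : 0 < T)
    {L q c lam : ℝ} (hL0 : 0 ≤ L) (hL : ∀ x ∈ closure Ω, ‖sphGrad Ω φ₀ x‖ ≤ L)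
    (hlam : 0 < lam)
    (hq : ∀ t ∈ timeInterval T, ∀ x ∈ closure Ω, q / ((1 - α) * t + Real.exp ((1 - α) * c)) ≤
      derivWithin (φ x) (timeInterval T) t)
    (hlq : ∀ Δ, 0 < Δ → Δ ≤ (L + 1) * Real.pi + 1 →
      lam * Δ < q * (1 - Real.exp ((α - 1) * Δ)))
    {t : ℝ} (ht : t ∈ timeInterval T) {x : Amb n} (hx : x ∈ closure Ω) :
    ‖sphGrad Ω (fun y => φ y t) x‖ ≤ Real.exp (-lam * rescaledTime α c t) * L := by
  refine hΩ.norm_sphGrad_le_of_sub_le (hs.contDiff_space t ht) ?_ hx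
    (mul_nonneg (Real.exp_pos _).le hL0)
  intro x hx y hy
  have hlim : Tendsto (fun δ : ℝ => Real.exp (-lam * rescaledTime α c t) *
      ((L + δ) * angle x y + δ)) (𝓝[>] 0)
      (𝓝 (Real.exp (-lam * rescaledTime α c t) * L * angle x y)) := by
    have h1 : ContinuousAt (fun δ : ℝ => Real.exp (-lam * rescaledTime α c t) *
      ((L + δ) * angle x y + δ)) 0 := by fun_prop
    have h2 : Tendsto (fun δ : ℝ => Real.exp (-lam * rescaledTime α c t) *
      ((L + δ) * angle x y + δ)) (𝓝 0)
      (𝓝 (Real.exp (-lam * rescaledTime α c t) * L * angle x y)) := by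
      simpa [ContinuousAt, mul_assoc] using h1
    exact h2.mono_left nhdsWithin_le_nhds
  refine ge_of_tendsto hlim ?_
  filter_upwards [Ioo_mem_nhdsGT (zero_lt_one (α := ℝ))] with δ hδ
  exact (hs.sub_lt_two_point hn hα hα₁ hΩ hφ₀ hT hL0 hL hlam hδ.1 hδ.2.le hq hlq ht hx hy).le

end IsSolution

/-! ### The uniform decay rate -/

theorem IsStrictlyConvexDatum.exists_speed_lower_bound (α : ℝ) {φ₀ : Amb n → ℝ}
    (hΩ : IsStrictlyConvexSphericalDomain Ω) (hφ₀ : IsStrictlyConvexDatum Ω φ₀) :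
    ∃ m, 0 < m ∧ ∀ x ∈ closure Ω, m < flowOp α Ω φ₀ x := by
  have hsub : closure Ω ⊆ coneOver (closure Ω) := subset_coneOver _
  have hpos : ∀ x ∈ closure Ω, 0 < wDet Ω φ₀ x := fun x hx =>
    wDet_pos hΩ hφ₀.contDiff hx (hφ₀.posDef x hx)
  have hG := (hΩ.contDiffOn_sphGrad hφ₀.contDiff).continuousOn.mono hsub
  have hD : ContinuousOn (fun x => wDet Ω φ₀ x) (closure Ω) :=
    (ContinuousLinearMap.continuous_det.comp_continuousOn (continuousOn_wOp_comp
      (F := fun _ => φ₀) continuousOn_id hG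
      ((hΩ.continuousOn_sphGradDeriv hφ₀.contDiff).mono hsub))).congr
      fun x hx => (det_wOp _ (hΩ.norm_eq_one hx)).symm
  have hφ : ContinuousOn φ₀ (closure Ω) := (hφ₀.contDiff.continuousOn.mono hsub).congr
    fun x hx => (radialExt_of_norm_eq_one φ₀ (hΩ.norm_eq_one hx)).symm
  have hc : ContinuousOn (flowOp α Ω φ₀) (closure Ω) := by
    unfold flowOp
    refine ((Real.continuous_exp.comp_continuousOn (continuousOn_const.mul hφ)).mul
      (ContinuousOn.rpow_const (continuousOn_const.add (hG.norm.pow 2)) ?_)).div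
      (ContinuousOn.rpow_const hD ?_) ?_
    · intro x _; left; exact (by positivity : (0 : ℝ) < 1 + ‖sphGrad Ω φ₀ x‖ ^ 2).ne'
    · intro x hx; left; exact (hpos x hx).ne'
    · intro x hx; exact (Real.rpow_pos_of_pos (hpos x hx) _).ne'
  obtain ⟨x₀, hx₀, hmin⟩ := hΩ.isCompact_closure.exists_isMinOn hΩ.nonempty.closure hc
  have h0 := flowOp_pos (α := α) (hpos x₀ hx₀)
  refine ⟨flowOp α Ω φ₀ x₀ / 2, by linarith, fun x hx => ?_⟩
  have : flowOp α Ω φ₀ x₀ ≤ flowOp α Ω φ₀ x := hmin hx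
  linarith

theorem IsStrictlyConvexDatum.norm_sphGrad_le_supGrad {φ₀ : Amb n → ℝ}
    (hΩ : IsStrictlyConvexSphericalDomain Ω) (hφ₀ : IsStrictlyConvexDatum Ω φ₀) {x : Amb n}
    (hx : x ∈ closure Ω) : ‖sphGrad Ω φ₀ x‖ ≤ supGrad Ω φ₀ :=
  le_csSup (hΩ.isCompact_closure.image_of_continuousOn
    ((hΩ.contDiffOn_sphGrad hφ₀.contDiff).continuousOn.mono (subset_coneOver _)).norm).bddAbove
    ⟨x, hx, rfl⟩

theorem supGrad_nonneg (f : Amb n → ℝ) : 0 ≤ supGrad Ω f :=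
  Real.sSup_nonneg (by rintro _ ⟨x, -, rfl⟩; exact norm_nonneg _)

/-- All constants depend on φ₀ through a positive lower bound m of its speed, sup |Dφ₀| and inf φ₀.
This makes the rate independent of T, of the solution and of c. -/
theorem exists_decay_rate {n : ℕ} {Ω : Set (Amb n)} {α : ℝ} {φ₀ : Amb n → ℝ} (hn : 1 ≤ n)
    (hα : 0 < α) (hα₁ : α < 1)
    (hΩ : IsStrictlyConvexSphericalDomain Ω) (hφ₀ : IsStrictlyConvexDatum Ω φ₀) :
    ∃ lam : ℝ, 0 < lam ∧ ∀ (T : EReal) (φ : Amb n → ℝ → ℝ), 0 < T → IsSolution α Ω T φ₀ φ →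
      ∀ c : ℝ, sInf (φ₀ '' closure Ω) ≤ c → ∀ x ∈ closure Ω, ∀ t ∈ timeInterval T,
        ‖sphGrad Ω (fun y => φ y t) x‖
          ≤ Real.exp (-lam * rescaledTime α c t) * supGrad Ω φ₀ := by
  obtain ⟨m, hm, hmφ⟩ := hφ₀.exists_speed_lower_bound α hΩ
  set k := 1 - α with hk
  have hk0 : 0 < k := by linarith
  set L := supGrad Ω φ₀ with hL
  have hL0 : 0 ≤ L := supGrad_nonneg φ₀
  set D := (L + 1) * Real.pi + 1 with hD
  have hD0 : 0 < D := by positivity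
  set E := Real.exp (k * sInf (φ₀ '' closure Ω)) with hE
  have hE0 : 0 < E := Real.exp_pos _
  -- With τ = 1/(km), the speed is at least 1/(kt + 1/m). The bound q ≤ 1 handles the terms in t,
  -- and q/m ≤ E ≤ e^{kc} the constant terms.
  set q := min 1 (m * E) with hq
  have hq0 : 0 < q := lt_min one_pos (mul_pos hm hE0)
  refine ⟨q * k / (2 * (1 + k * D)), by positivity, fun T φ hT hs c hc x hx t ht => ?_⟩
  have hτ : 0 < 1 / (k * m) := by positivity
  refine hs.norm_sphGrad_le hn hα hα₁ hΩ hφ₀ hT hL0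
    (fun x hx => hφ₀.norm_sphGrad_le_supGrad hΩ hx) (q := q) (by positivity) ?_ ?_ ht hx
  · intro t ht x hx
    have h1 := hs.speed_lower_bound hn hα hα₁ hΩ hφ₀ hT hτ (fun x hx => by
      have : 1 / ((1 - α) * (1 / (k * m))) = m := by rw [← hk]; field_simp
      rw [this]; exact hmφ x hx) ht hx
    refine le_trans ?_ h1
    have ht0 : 0 ≤ t := ht.1
    have hb := rescaledTime_base_pos (c := c) hα₁ ht0
    rw [← hk] at hb ⊢
    have h2 : k * (t + 1 / (k * m)) = k * t + 1 / m := by field_simp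
    rw [h2, div_le_div_iff₀ hb (by positivity), one_mul]
    have h3 : q * (1 / m) ≤ E := by
      rw [mul_one_div, div_le_iff₀ hm, mul_comm E]
      exact min_le_right _ _
    have h4 : q * (k * t) ≤ k * t := mul_le_of_le_one_left (by positivity) (min_le_left _ _)
    have h5 : E ≤ Real.exp (k * c) := by rw [hE]; gcongr
    linarith
  · intro Δ hΔ hΔD
    -- Hence 1 - e^{-kΔ} ≥ kΔ/(1 + kΔ) ≥ kΔ/(1 + kD). The factor 2 in the decay rate makes the final
    -- inequality strict.
    have h1 : Real.exp ((α - 1) * Δ) ≤ 1 / (1 + k * Δ) := by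
      have h2 : (α - 1) * Δ = -(k * Δ) := by rw [hk]; ring
      rw [h2, Real.exp_neg, ← one_div]
      have := Real.add_one_le_exp (k * Δ)
      gcongr
      linarith
    have h2 : k * Δ / (1 + k * D) ≤ k * Δ / (1 + k * Δ) := by gcongr
    have h3 : 1 - 1 / (1 + k * Δ) = k * Δ / (1 + k * Δ) := by
      have : 1 + k * Δ ≠ 0 := by positivity
      field_simp
      ring
    have h4 : k * Δ / (1 + k * D) ≤ 1 - Real.exp ((α - 1) * Δ) := by linarith
    have h5 := mul_le_mul_of_nonneg_left h4 hq0.le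
    have h6 : q * k / (2 * (1 + k * D)) * Δ = q * (k * Δ / (1 + k * D)) / 2 := by field_simp
    have h7 : 0 < q * (k * Δ / (1 + k * D)) := by positivity
    linarith

/-! ### The normal derivative of the squared gradient -/

namespace IsStrictlyConvexSphericalDomain

/-- Radially extending |Df|² means evaluating `sphGrad` at z/|z|. The normalization does not affect
derivatives in directions tangent to the sphere. -/
theorem hasFDerivAt_normalize {p : Amb n} (hp : ‖p‖ = 1) :
    ∃ N' : Amb n →L[ℝ] Amb n, HasFDerivAt (fun z : Amb n => ‖z‖⁻¹ • z) N' p ∧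
      ∀ v, inner ℝ p v = (0 : ℝ) → N' v = v := by
  have hp0 : p ≠ 0 := by rintro rfl; simp at hp
  have hd : DifferentiableAt ℝ (fun z : Amb n => ‖z‖⁻¹ • z) p :=
    ((differentiableAt_id.norm ℝ hp0).inv (norm_ne_zero_iff.2 hp0)).smul differentiableAt_id
  refine ⟨_, hd.hasFDerivAt, fun v hv => ?_⟩
  have h1 : HasDerivAt (fun s : ℝ => p + s • v) v 0 := by
    simpa using ((hasDerivAt_id (0 : ℝ)).smul_const v).const_add p
  have h2 : HasDerivAt (fun s : ℝ => ‖p + s • v‖⁻¹ • (p + s • v))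
      (fderiv ℝ (fun z : Amb n => ‖z‖⁻¹ • z) p v) 0 := by
    have h0 : HasFDerivAt (fun z : Amb n => ‖z‖⁻¹ • z)
        (fderiv ℝ (fun z : Amb n => ‖z‖⁻¹ • z) p) (p + (0 : ℝ) • v) := by
      rw [zero_smul, add_zero]; exact hd.hasFDerivAt
    exact h0.comp_hasDerivAt (0 : ℝ) h1
  have h3 : HasDerivAt (fun s : ℝ => (√(1 + s ^ 2 * ‖v‖ ^ 2))⁻¹) 0 0 := by
    have h4 : HasDerivAt (fun s : ℝ => 1 + s ^ 2 * ‖v‖ ^ 2) 0 0 := by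
      simpa using (((hasDerivAt_id (0 : ℝ)).pow 2).mul_const (‖v‖ ^ 2)).const_add 1
    simpa using (h4.sqrt (by simp)).fun_inv (by simp)
  have h5 : HasDerivAt (fun s : ℝ => ‖p + s • v‖⁻¹ • (p + s • v)) v 0 := by
    have h6 : (fun s : ℝ => ‖p + s • v‖⁻¹ • (p + s • v)) =
        fun s : ℝ => (√(1 + s ^ 2 * ‖v‖ ^ 2))⁻¹ • (p + s • v) := by
      funext s
      rw [← norm_add_smul_sq hp hv s, Real.sqrt_sq (norm_nonneg _)]
    rw [h6]
    simpa using h3.fun_smul h1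
  exact h2.unique h5

variable (hΩ : IsStrictlyConvexSphericalDomain Ω) {p μ : Amb n} (hp : p ∈ sphBoundary Ω)
include hΩ

/-- Rescaling the argument of ρ carries it from a frontier point z of the cone to z/|z|. The Neumann
condition thereby becomes available at all frontier points near p. -/
theorem isOutwardUnitNormal_of_mem_frontier {ρ : Amb n → ℝ} {z w : Amb n} (hρ : ContDiff ℝ ∞ ρ)
    (hz : z ∈ closure (coneOver Ω)) (hz' : z ∉ coneOver Ω) (hz0 : z ≠ 0)
    (hiff : ∀ᶠ y in 𝓝 z, y ∈ coneOver Ω ↔ ρ y < 0) (hw : ∀ X, fderiv ℝ ρ z X = inner ℝ w X)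
    (hw0 : w ≠ 0) :
    ‖z‖⁻¹ • z ∈ sphBoundary Ω ∧ IsOutwardUnitNormal Ω (‖z‖⁻¹ • z) (‖w‖⁻¹ • w) := by
  have hn : 0 < ‖z‖ := norm_pos_iff.2 hz0
  have hnw : 0 < ‖w‖ := norm_pos_iff.2 hw0
  have hzz : ‖z‖ • ‖z‖⁻¹ • z = z := by rw [smul_smul, mul_inv_cancel₀ hn.ne', one_smul]
  have h1 : ‖‖z‖⁻¹ • z‖ = 1 := by rw [norm_smul, norm_inv, norm_norm, inv_mul_cancel₀ hn.ne']
  have hfd : ∀ X, fderiv ℝ (fun y => ρ (‖z‖ • y)) (‖z‖⁻¹ • z) X = ‖z‖ * inner ℝ w X := by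
    intro X
    have h2 : HasFDerivAt ρ (fderiv ℝ ρ z) (‖z‖ • ‖z‖⁻¹ • z) := by
      rw [hzz]; exact (hρ.differentiable (by simp) z).hasFDerivAt
    have h3 : HasFDerivAt (fun y : Amb n => ‖z‖ • y) (‖z‖ • ContinuousLinearMap.id ℝ (Amb n))
        (‖z‖⁻¹ • z) := (hasFDerivAt_id _).const_smul ‖z‖
    have h4 := h2.comp _ h3
    have h5 : fderiv ℝ (fun y => ρ (‖z‖ • y)) (‖z‖⁻¹ • z) =
      (fderiv ℝ ρ z).comp (‖z‖ • ContinuousLinearMap.id ℝ (Amb n)) := h4.fderiv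
    rw [h5]
    simp [hw]
  refine ⟨⟨hΩ.mem_closure_of_norm_eq_one (smul_mem_closure_cone (inv_pos.2 hn) hz) h1,
    fun h => hz' ?_⟩, ?_, fun y => ρ (‖z‖ • y), ⟨?_, ?_, ?_⟩, ‖z‖ * ‖w‖, by positivity, fun X => ?_⟩
  · exact (smul_mem_coneOver_iff (inv_pos.2 hn)).1 (subset_coneOver _ h)
  · rw [norm_smul, norm_inv, norm_norm, inv_mul_cancel₀ hnw.ne']
  · exact hρ.comp (contDiff_const_smul _)
  · have hc : ContinuousAt (fun y : Amb n => ‖z‖ • y) (‖z‖⁻¹ • z) := by fun_prop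
    rw [← hzz] at hiff
    filter_upwards [hc.eventually hiff] with y hy
    rw [← hy, smul_mem_coneOver_iff hn]
  · intro h
    have := hfd w
    rw [h, real_inner_self_eq_norm_sq] at this
    have h2 : 0 < ‖z‖ * ‖w‖ ^ 2 := by positivity
    simp only [zero_apply] at this
    linarith
  · rw [hfd, inner_smul_left]
    simp
    field_simp

include hp

/-- In every direction tangent to the boundary of the cone there are nearby boundary points. -/
theorem eventually_exists_frontier (hμ : IsOutwardUnitNormal Ω p μ) {g : Amb n}
    (hg : inner ℝ μ g = (0 : ℝ)) {ε : ℝ} (hε : 0 < ε) : ∀ᶠ s in 𝓝[>] (0 : ℝ), ∃ r ∈ Icc (-ε) ε,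
      p + s • (g + r • μ) ∈ closure (coneOver Ω) ∧ p + s • (g + r • μ) ∉ coneOver Ω := by
  have hμμ := inner_self_of_norm_eq_one hμ.1
  filter_upwards [hΩ.eventually_mem hp hμ (v := g + (-ε) • μ) (by
    rw [inner_add_right, hg, inner_smul_right, hμμ]; linarith), self_mem_nhdsWithin] with s h1 h2
  have hs : (0 : ℝ) < s := h2
  set γ : ℝ → Amb n := fun r => p + s • (g + r • μ) with hγ
  have hγc : Continuous γ := by fun_prop
  have h3 : γ ε ∉ coneOver Ω := by
    intro h
    have h4 := hΩ.inner_normal_nonpos hp hμ (subset_closure h)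
    rw [hγ] at h4
    simp only [inner_add_right, inner_smul_right, hΩ.inner_normal_self hp hμ, hg, hμμ] at h4
    have := mul_pos hs hε
    linarith
  -- The segment starts in the cone at r = -ε and ends beyond the supporting hyperplane at r = ε, so
  -- it meets the frontier.
  have hpre : IsPreconnected (γ '' Icc (-ε) ε) :=
    isPreconnected_Icc.image _ hγc.continuousOn
  obtain ⟨_, ⟨r, hr, rfl⟩, hfr⟩ : (γ '' Icc (-ε) ε ∩ frontier (coneOver Ω)).Nonempty := by
    by_contra hempty
    have h4 := hpre.subset_or_subset hΩ.isOpen_cone isClosed_closure.isOpen_compl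
      (v := (closure (coneOver Ω))ᶜ) (disjoint_compl_right.mono_left subset_closure) (by
        rintro _ hz
        by_contra h5
        rw [mem_union, not_or, mem_compl_iff, not_not] at h5
        exact hempty ⟨_, hz, by rw [hΩ.isOpen_cone.frontier_eq]; exact ⟨h5.2, h5.1⟩⟩)
    rcases h4 with h4 | h4
    · exact h3 (h4 ⟨ε, right_mem_Icc.2 (by linarith), rfl⟩)
    · exact h4 ⟨-ε, left_mem_Icc.2 (by linarith), rfl⟩ (subset_closure h1)
  rw [hΩ.isOpen_cone.frontier_eq] at hfr
  exact ⟨r, hr, hfr.1, hfr.2⟩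

/-- A function on the closed cone that vanishes on the boundary near `p` has vanishing derivatives
in the directions tangent to the boundary. -/
theorem tangential_deriv_eq_zero (hμ : IsOutwardUnitNormal Ω p μ) {g : Amb n}
    (hg : inner ℝ μ g = (0 : ℝ)) {H : Amb n → ℝ} {H' : Amb n →L[ℝ] ℝ}
    (hH : HasFDerivWithinAt H H' (coneOver (closure Ω)) p)
    (hzero : ∀ᶠ z in 𝓝 p, z ∈ closure (coneOver Ω) → z ∉ coneOver Ω → H z = 0) : H' g = 0 := by
  have hHp : H p = 0 := hzero.self_of_nhds (mem_closure_cone hp.1) (hΩ.notMem_cone hp)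
  have hp0 : p ≠ 0 := by rintro rfl; simpa using hΩ.norm_eq_one hp.1
  -- Nearby frontier points in direction g + rμ with |r| ≤ ε have H = 0, so H'(g + rμ) is small; the
  -- correction r H'(μ) costs at most ε|H'(μ)|.
  have key : ∀ ε, 0 < ε → ε < 1 → |H' g| ≤ ε * (|H' μ| + ‖g‖ + 1) := by
    intro ε hε hε1
    have h1 := (hasFDerivWithinAt_iff_isLittleO.1 hH).def hε
    rw [eventually_nhdsWithin_iff] at h1
    have hne : ∀ᶠ z in 𝓝 p, z ≠ (0 : Amb n) := isOpen_ne.mem_nhds hp0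
    obtain ⟨η, hη, hball⟩ := Metric.eventually_nhds_iff.1 (h1.and (hzero.and hne))
    have hg1 : 0 < ‖g‖ + 1 := by positivity
    obtain ⟨s, ⟨r, hr, hz, hz'⟩, hs, hsη⟩ := ((hΩ.eventually_exists_frontier hp hμ hg hε).and
      (Ioo_mem_nhdsGT (div_pos hη hg1))).exists
    set z := p + s • (g + r • μ) with hzdef
    have hrabs : |r| ≤ ε := abs_le.2 hr
    have hnorm : ‖g + r • μ‖ ≤ ‖g‖ + 1 := by
      refine (norm_add_le _ _).trans ?_
      rw [norm_smul, hμ.1, mul_one, Real.norm_eq_abs]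
      linarith
    have hzp : z - p = s • (g + r • μ) := by rw [hzdef]; abel
    have hdist : dist z p < η := by
      rw [dist_eq_norm, hzp, norm_smul, Real.norm_of_nonneg hs.le]
      rw [lt_div_iff₀ hg1] at hsη
      exact lt_of_le_of_lt (mul_le_mul_of_nonneg_left hnorm hs.le) hsη
    obtain ⟨h2, h3, h4⟩ := hball hdist
    have h5 := h2 (by rw [hΩ.coneOver_closure]; exact ⟨hz, h4⟩)
    rw [h3 hz hz', hHp, hzp, map_smul, norm_smul, Real.norm_eq_abs, sub_zero, zero_sub, abs_neg,
      smul_eq_mul, abs_mul, Real.norm_of_nonneg hs.le, abs_of_pos hs] at h5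
    have h6 : |H' (g + r • μ)| ≤ ε * ‖g + r • μ‖ := by
      have : s * |H' (g + r • μ)| ≤ s * (ε * ‖g + r • μ‖) := by linarith
      exact le_of_mul_le_mul_left this hs
    have h7 : |H' g| ≤ |H' (g + r • μ)| + |r| * |H' μ| := by
      have h8 : H' g = H' (g + r • μ) - r * H' μ := by simp
      rw [← abs_mul]
      nth_rewrite 1 [h8]
      exact abs_sub _ _
    have h9 := mul_le_mul_of_nonneg_right hrabs (abs_nonneg (H' μ))
    have h10 := mul_le_mul_of_nonneg_left hnorm hε.le
    linarith
  by_contra hne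
  have hpos : 0 < |H' g| := abs_pos.2 hne
  set M := |H' μ| + ‖g‖ + 1 with hM
  have hM0 : 0 < M := by positivity
  have h1 := key (min (1 / 2) (|H' g| / (2 * M))) (lt_min (by norm_num) (by positivity))
    (lt_of_le_of_lt (min_le_left _ _) (by norm_num))
  have h2 : min (1 / 2) (|H' g| / (2 * M)) * M ≤ |H' g| / (2 * M) * M :=
    mul_le_mul_of_nonneg_right (min_le_right _ _) hM0.le
  have h3 : |H' g| / (2 * M) * M = |H' g| / 2 := by field_simp
  linarith

/-- By symmetry of the Hessian, D_μ|Df|² = 2 D²f(g, μ) with g = Df(p). Differentiating Dρ(Df) = 0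
along the boundary in the tangent direction g gives a D²f(g, μ) = -D²ρ(g, g) ≤ 0. -/
theorem normal_deriv_norm_sphGrad_sq_nonpos (hμ : IsOutwardUnitNormal Ω p μ) {f : Amb n → ℝ}
    (hf : ContDiffOn ℝ 2 (radialExt f) (coneOver (closure Ω)))
    (hN : ∀ x ∈ sphBoundary Ω, ∀ ν, IsOutwardUnitNormal Ω x ν →
      inner ℝ (sphGrad Ω f x) ν = (0 : ℝ)) :
    DifferentiableWithinAt ℝ (radialExt fun y => ‖sphGrad Ω f y‖ ^ 2) (coneOver (closure Ω)) p ∧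
      inner ℝ (sphGrad Ω (fun y => ‖sphGrad Ω f y‖ ^ 2) p) μ ≤ (0 : ℝ) := by
  have hp1 := hΩ.norm_eq_one hp.1
  have hK : p ∈ coneOver (closure Ω) := self_mem hp.1
  obtain ⟨N', hN', hN'v⟩ := hasFDerivAt_normalize hp1
  set g := sphGrad Ω f p with hg
  have hpp : ‖p‖⁻¹ • p = p := by rw [hp1, inv_one, one_smul]
  have hmaps : MapsTo (fun z : Amb n => ‖z‖⁻¹ • z) (coneOver (closure Ω)) (coneOver (closure Ω)) :=
    fun z hz => subset_coneOver _ ((mem_coneOver_iff hΩ.closure_subset_sphere).1 hz).2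
  have hGN : HasFDerivWithinAt (fun z : Amb n => sphGrad Ω f (‖z‖⁻¹ • z))
      ((sphGradDeriv Ω f p).comp N') (coneOver (closure Ω)) p := by
    have h1 : HasFDerivWithinAt (sphGrad Ω f) (sphGradDeriv Ω f p) (coneOver (closure Ω))
        (‖p‖⁻¹ • p) := by
      rw [hpp]; exact hΩ.hasFDerivWithinAt_sphGrad hf hK
    exact HasFDerivWithinAt.comp (f := fun z : Amb n => ‖z‖⁻¹ • z) p h1 hN'.hasFDerivWithinAt hmaps
  have hq := hGN.norm_sq
  have hqd : DifferentiableWithinAt ℝ (radialExt fun y => ‖sphGrad Ω f y‖ ^ 2)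
      (coneOver (closure Ω)) p := hq.differentiableWithinAt
  refine ⟨hqd, ?_⟩
  have hμp : inner ℝ p μ = (0 : ℝ) := by rw [real_inner_comm]; exact hΩ.inner_normal_self hp hμ
  have hμg : inner ℝ μ g = (0 : ℝ) := by rw [real_inner_comm]; exact hN p hp μ hμ
  have hgp : inner ℝ p g = (0 : ℝ) := by rw [real_inner_comm]; exact inner_sphGrad_self hf hK
  have hval : (inner ℝ (sphGrad Ω (fun y => ‖sphGrad Ω f y‖ ^ 2) p) μ : ℝ) =
      2 * inner ℝ (sphGradDeriv Ω f p g) μ := by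
    have h1 := (hΩ.uniqueDiffOn p hK).eq (hasFDerivWithinAt hqd) hq
    have h2 := DFunLike.congr_fun h1 μ
    have h3 := hΩ.sphHess_symm hf hK μ g
    unfold sphHess at h3
    simp only [innerSL_apply_apply] at h2
    rw [h2]
    simp [hpp, hN'v μ hμp, ← hg, ← h3, real_inner_comm]
  obtain ⟨ρ, hρ, ⟨a, ha, hρa⟩, hconv⟩ := hΩ.exists_convex_definingFunction hp hμ
  -- By the Neumann condition this function vanishes on the frontier near p, so its derivative along
  -- g is zero.
  have hH : HasFDerivWithinAt (fun z => fderiv ℝ ρ z (sphGrad Ω f (‖z‖⁻¹ • z))) _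
      (coneOver (closure Ω)) p :=
    ((hρ.differentiable_fderiv p).hasFDerivAt.hasFDerivWithinAt).clm_apply hGN
  have hzero : ∀ᶠ z in 𝓝 p, z ∈ closure (coneOver Ω) → z ∉ coneOver Ω →
      fderiv ℝ ρ z (sphGrad Ω f (‖z‖⁻¹ • z)) = 0 := by
    have hp0 : p ≠ 0 := by rintro rfl; simp at hp1
    have hne : ∀ᶠ z in 𝓝 p, z ≠ (0 : Amb n) := isOpen_ne.mem_nhds hp0
    have hρne : ∀ᶠ z in 𝓝 p, fderiv ℝ ρ z ≠ 0 :=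
      (hρ.differentiable_fderiv.continuous.tendsto p).eventually (isOpen_ne.mem_nhds hρ.2.2)
    filter_upwards [hρ.2.1.eventually_nhds, hne, hρne] with z h1 h2 h3 h4 h5
    set w := (InnerProductSpace.toDual ℝ (Amb n)).symm (fderiv ℝ ρ z) with hw
    have hwX : ∀ X, fderiv ℝ ρ z X = inner ℝ w X := fun X => by
      rw [hw, InnerProductSpace.toDual_symm_apply]
    have hw0 : w ≠ 0 := fun h => h3 (by simpa [hw] using h)
    obtain ⟨h6, h7⟩ := hΩ.isOutwardUnitNormal_of_mem_frontier hρ.1 h4 h5 h2 h1 hwX hw0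
    have h8 := hN _ h6 _ h7
    rw [inner_smul_right, mul_eq_zero] at h8
    rw [hwX, real_inner_comm]
    exact h8.resolve_left (inv_ne_zero (norm_ne_zero_iff.2 hw0))
  have h1 := hΩ.tangential_deriv_eq_zero hp hμ hμg hH hzero
  have h2 : a * inner ℝ μ (sphGradDeriv Ω f p g) +
      fderiv ℝ (fun y => fderiv ℝ ρ y) p g g = 0 := by
    rw [← h1, ← hρa]
    simp [hpp, hN'v g hgp, ← hg]
  have h3 : 0 ≤ fderiv ℝ (fun y => fderiv ℝ ρ y) p g g := by
    rcases eq_or_ne g 0 with h0 | h0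
    · rw [h0]; simp
    · exact (hconv g (by rw [hρa, hμg, mul_zero]) hgp h0).le
  rw [hval, real_inner_comm]
  have h4 : (inner ℝ μ (sphGradDeriv Ω f p g) : ℝ) ≤ 0 := by
    by_contra! h5
    have := mul_pos ha h5
    linarith
  linarith

end IsStrictlyConvexSphericalDomain

/-! ### Transfer to the rescaled flow and conclusion -/

theorem IsSolution.eqOn_initial {α : ℝ} {T : EReal} {φ₀ : Amb n → ℝ} {φ : Amb n → ℝ → ℝ}
    (hs : IsSolution α Ω T φ₀ φ) : EqOn (fun y => φ y 0) φ₀ (closure Ω) :=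
  fun y hy => hs.initial y hy

theorem IsRescaledFlow.sphGrad_eq (hΩ : IsStrictlyConvexSphericalDomain Ω) {α c : ℝ} {T : EReal}
    {φ ψ : Amb n → ℝ → ℝ} (hψ : IsRescaledFlow α c Ω T φ ψ) {t : ℝ} (ht : t ∈ timeInterval T)
    {x : Amb n} (hx : x ∈ closure Ω) :
    sphGrad Ω (fun y => ψ y (rescaledTime α c t)) x = sphGrad Ω (fun y => φ y t) x := by
  have h1 : EqOn (fun y => ψ y (rescaledTime α c t))
      (fun y => φ y t + -Real.log (Theta α c t)) (closure Ω) := fun y hy => hψ y hy t ht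
  rw [hΩ.sphGrad_congr h1 (subset_coneOver _ hx),
    IsStrictlyConvexSphericalDomain.sphGrad_add_const]

end

theorem mainTheorem5 (n : ℕ) (hn : 1 ≤ n) (α : ℝ) (hα₀ : 0 < α) (hα₁ : α < 1)
    (Ω : Set (Amb n)) (hΩ : IsStrictlyConvexSphericalDomain Ω)
    (φ₀ : Amb n → ℝ) (hφ₀ : IsStrictlyConvexDatum Ω φ₀) :
    (∀ (T : EReal) (φ : Amb n → ℝ → ℝ), 0 < T → IsSolution α Ω T φ₀ φ →
      (∀ x ∈ closure Ω, ∀ t ∈ timeInterval T,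
        ‖sphGrad Ω (fun y => φ y t) x‖ ≤ supGrad Ω (fun y => φ y 0)) ∧
      (∀ x ∈ sphBoundary Ω, ∀ t ∈ timeInterval T, ∀ μ : Amb n, IsOutwardUnitNormal Ω x μ →
        DifferentiableWithinAt ℝ (radialExt fun y => ‖sphGrad Ω (fun z => φ z t) y‖ ^ 2)
          (coneOver (closure Ω)) x ∧
        inner ℝ (sphGrad Ω (fun y => ‖sphGrad Ω (fun z => φ z t) y‖ ^ 2) x) μ ≤ 0)) ∧
    (∃ lam : ℝ, 0 < lam ∧
      ∀ (T : EReal) (φ : Amb n → ℝ → ℝ), 0 < T → IsSolution α Ω T φ₀ φ →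
      ∀ c : ℝ, sInf (φ₀ '' closure Ω) ≤ c → c ≤ sSup (φ₀ '' closure Ω) →
      ∀ ψ : Amb n → ℝ → ℝ, IsRescaledFlow α c Ω T φ ψ →
      ∀ x ∈ closure Ω, ∀ t ∈ timeInterval T,
        ‖sphGrad Ω (fun y => ψ y (rescaledTime α c t)) x‖
          ≤ Real.exp (-lam * rescaledTime α c t) * supGrad Ω (fun y => ψ y 0)) := by
  obtain ⟨lam, hlam, hdecay⟩ := exists_decay_rate hn hα₀ hα₁ hΩ hφ₀
  refine ⟨fun T φ hT hs => ⟨fun x hx t ht => ?_, fun x hx t ht μ hμ => ?_⟩, lam, hlam,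
    fun T φ hT hs c hc _ ψ hψ x hx t ht => ?_⟩
  · rw [hΩ.supGrad_congr hs.eqOn_initial]
    -- Any admissible c serves here; c = inf φ₀ is taken and the exponential factor is bounded by 1.
    refine (hdecay T φ hT hs _ le_rfl x hx t ht).trans
      (mul_le_of_le_one_left (supGrad_nonneg φ₀) ?_)
    rw [Real.exp_le_one_iff]
    have := mul_nonneg hlam.le (rescaledTime_nonneg (c := sInf (φ₀ '' closure Ω)) hα₁ ht.1)
    linarith
  · exact hΩ.normal_deriv_norm_sphGrad_sq_nonpos hx hμ (hs.contDiff_space t ht)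
      fun y hy ν hν => hs.neumann' hT ht hy hν
  · have hsup : supGrad Ω (fun y => ψ y 0) = supGrad Ω φ₀ := by
      rw [← hΩ.supGrad_congr hs.eqOn_initial, ← rescaledTime_zero α c]
      unfold supGrad
      rw [Set.image_congr fun y hy => by
        rw [hψ.sphGrad_eq hΩ (zero_mem_timeInterval hT) hy]]
      simp only [rescaledTime_zero]
    rw [hψ.sphGrad_eq hΩ ht hx, hsup]
    exact hdecay T φ hT hs c hc x hx t ht
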